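/- Let $\langle x\rangle=(1+|x|^2)^{1/2}$ for $x\in\mathbb R^3$, write $L^p=L^p(\mathbb R^3)$, and let $G_0$ be the self-adjoint realization of $-\Delta$ on $L^2$, that is, $G_0u=-\Delta u$ (in the sense of distributions) on the domain $\{u\in L^2:\Delta u\in L^2\}$. For $\lambda\in\mathbb R$ and $0<\varepsilon\le 1$ set $$R_0(\lambda\pm i\varepsilon)=\left(G_0-(\lambda\pm i\varepsilon)^2\right)^{-1}:L^2\to L^2,\qquad R_0^{(k)}(\lambda\pm i\varepsilon)=\frac{d^k}{d\lambda^k}R_0(\lambda\pm i\varepsilon),\quad k\ge 1.$$ These bounded inverses exist, and $\lambda\mapsto R_0(\lambda\pm i\varepsilon)$ is $C^\infty$ in operator norm. An estimate $\|\langle x\rangle^{a}T\langle x\rangle^{b}\|_{L^p\to L^q}\le M$ for a bounded operator $T$ on $L^2$ means that there is a bounded operator $S:L^p\to L^q$ of norm at most $M$ with $Sf=\langle x\rangle^{a}T(\langle x\rangle^{b}f)$ for all $f\in L^p$ with $\langle x\rangle^bf\in L^2$. Proposition 2.1. Let $s>-1/2$, $s_1>1/2$, $0\le\sigma\le 1$,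 and let $k\ge 1$ be an integer. Then for all $\lambda_0>0$ and $\eta>0$ the following estimates hold for both signs $\pm$ and all $0<\varepsilon\le 1$. For all $\lambda\ge\lambda_0$: $$\|\langle x\rangle^{-s_1}R_0(\lambda\pm i\varepsilon)\langle x\rangle^{-s_1}\|_{L^2\to L^2}\le C_1\lambda^{-1},$$ $$\|\langle x\rangle^{-s}R_0(\lambda\pm i\varepsilon)\langle x\rangle^{-s_1}\|_{L^2\to L^2}\le C_2\lambda^{-1}\varepsilon^{-\max\{1/2-s+\eta,0\}},$$ $$\|\langle x\rangle^{-k-s}R_0^{(k)}(\lambda\pm i\varepsilon)\langle x\rangle^{-k-s_1}\|_{L^2\to L^2}\le C_2\lambda^{-1}\varepsilon^{-\max\{1/2-s+\eta,0\}}.$$ For all $\lambda\ge 0$: $$\|R_0(\lambda\pm i\varepsilon)\langle x\rangle^{-s}\|_{L^2\to L^\infty}\le C_3\varepsilon^{-\max\{1/2-s+\eta,0\}}\quad\text{if } s\ge 0,$$ $$\|R_0^{(1)}(\lambda\pm i\varepsilon)\langle x\rangle^{-1-s}\|_{L^2\to L^\infty}\le C_3\varepsilon^{-\max\{1/2-s+\eta,0\}},$$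 $$\|\langle x\rangle^{-k+1-\sigma}R_0^{(k+1)}(\lambda\pm i\varepsilon)\langle x\rangle^{-k-1-s}\|_{L^2\to L^\infty}\le C_3\varepsilon^{-1+\min\{\sigma,\,s+1/2-\eta\}},$$ $$\|\langle x\rangle^{-s}R_0(\lambda\pm i\varepsilon)\|_{L^1\to L^2}\le C_3\varepsilon^{-\max\{1/2-s+\eta,0\}}\quad\text{if } s\ge 0,$$ $$\|\langle x\rangle^{-1-s}R_0^{(1)}(\lambda\pm i\varepsilon)\|_{L^1\to L^2}\le C_3\varepsilon^{-\max\{1/2-s+\eta,0\}},$$ $$\|\langle x\rangle^{-k-1-s}R_0^{(k+1)}(\lambda\pm i\varepsilon)\langle x\rangle^{-k+1-\sigma}\|_{L^1\to L^2}\le C_3\varepsilon^{-1+\min\{\sigma,\,s+1/2-\eta\}}.$$ Here $C_1,C_2,C_3>0$ do not depend on $\lambda$, $\varepsilon$ or the sign. They may depend on $s,s_1,\sigma,k$; in addition $C_2$ may depend on $\eta$ and $\lambda_0$, and $C_3$ on $\eta$, while $C_1$ depends on neither $\eta$ nor $\lambda_0$. -/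

import Mathlib

open MeasureTheory
open scoped ENNReal SchwartzMap Laplacian ContDiff

noncomputable section

namespace FreeResolvent

/-- Three-dimensional Euclidean space. -/
abbrev R3 : Type := EuclideanSpace ℝ (Fin 3)

/-- The complex Hilbert space `L²(ℝ³)` with respect to Lebesgue measure. -/
abbrev L2 : Type := Lp ℂ 2 (volume : Measure R3)

/-- `⟨x⟩ = (1 + |x|²)^{1/2}`. -/
def bracket (x : R3) : ℝ := Real.sqrt (1 + ‖x‖ ^ 2)

/-- The graph of `-Δ` on its maximal domain: the pairs `(u, v)` in `L² × L²` for which `-Δu = v`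
in the sense of (tempered) distributions. -/
def negLaplacianGraph : Submodule ℂ (L2 × L2) where
  carrier := {p | -(Δ (Lp.toTemperedDistribution p.1)) = Lp.toTemperedDistribution p.2}
  zero_mem' := by
    have h : Lp.toTemperedDistribution (0 : L2) = 0 :=
      map_zero (Lp.toTemperedDistributionCLM ℂ (volume : Measure R3) 2)
    simp only [Set.mem_ofPred_eq, Prod.fst_zero, Prod.snd_zero, h]
    rw [← TemperedDistribution.laplacianCLM_apply, map_zero, neg_zero]
  add_mem' := by
    intro p q hp hq
    have h (u v : L2) : Lp.toTemperedDistribution (u + v)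
        = Lp.toTemperedDistribution u + Lp.toTemperedDistribution v :=
      map_add (Lp.toTemperedDistributionCLM ℂ (volume : Measure R3) 2) u v
    simp only [Set.mem_ofPred_eq, Prod.fst_add, Prod.snd_add, h] at hp hq ⊢
    rw [← hp, ← hq, ← TemperedDistribution.laplacianCLM_apply, map_add, neg_add]
    simp only [TemperedDistribution.laplacianCLM_apply]
  smul_mem' := by
    intro c p hp
    have h (u : L2) : Lp.toTemperedDistribution (c • u) = c • Lp.toTemperedDistribution u :=
      map_smul (Lp.toTemperedDistributionCLM ℂ (volume : Measure R3) 2) c u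
    simp only [Set.mem_ofPred_eq, Prod.smul_fst, Prod.smul_snd, h] at hp ⊢
    rw [← hp, ← TemperedDistribution.laplacianCLM_apply, map_smul, smul_neg]
    simp only [TemperedDistribution.laplacianCLM_apply]

/-- The self-adjoint realization `G₀` of `-Δ` on `L²(ℝ³)`: its domain consists of the `u ∈ L²` whose
distributional Laplacian lies in `L²`, and `G₀ u = -Δu`. -/
def G0 : L2 →ₗ.[ℂ] L2 := negLaplacianGraph.toLinearPMap

/-- The graph of `G₀` is the one above. -/
theorem mem_graph_G0 (u v : L2) :
    (u, v) ∈ G0.graph ↔ -(Δ (Lp.toTemperedDistribution u)) = Lp.toTemperedDistribution v := by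
  have h : G0.graph = negLaplacianGraph := by
    refine Submodule.toLinearPMap_graph_eq _ ?_
    rintro ⟨u, v⟩ hx hu
    simp only at hu
    subst hu
    have h0 : Lp.toTemperedDistribution (0 : L2) = 0 :=
      map_zero (Lp.toTemperedDistributionCLM ℂ (volume : Measure R3) 2)
    have hv : Lp.toTemperedDistributionCLM ℂ (volume : Measure R3) 2 v = 0 := by
      have hx' : -(Δ (Lp.toTemperedDistribution (0 : L2))) = Lp.toTemperedDistribution v := hx
      rw [h0, ← TemperedDistribution.laplacianCLM_apply, map_zero, neg_zero] at hx'
      exact hx'.symm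
    have hker := Lp.ker_toTemperedDistributionCLM_eq_bot (F := ℂ) (μ := (volume : Measure R3))
      (p := 2)
    exact (LinearMap.ker_eq_bot'.mp hker) v hv
  rw [h]
  rfl

/-- `R` is a bounded two-sided inverse of `A - ζ`. -/
def IsResolventAt (A : L2 →ₗ.[ℂ] L2) (ζ : ℂ) (R : L2 →L[ℂ] L2) : Prop :=
  (∀ f : L2, ∃ h : R f ∈ A.domain, A ⟨R f, h⟩ - ζ • R f = f) ∧
    ∀ u : A.domain, R (A u - ζ • (u : L2)) = u

theorem IsResolventAt.unique {A : L2 →ₗ.[ℂ] L2} {ζ : ℂ} {R S : L2 →L[ℂ] L2}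
    (hR : IsResolventAt A ζ R) (hS : IsResolventAt A ζ S) : R = S := by
  ext1 f
  obtain ⟨h, hf⟩ := hS.1 f
  have := hR.2 ⟨S f, h⟩
  rwa [hf] at this

open Classical in
/-- The resolvent `(A - ζ)⁻¹`, with the value `0` if `A - ζ` has no bounded inverse. -/
def resolventAt (A : L2 →ₗ.[ℂ] L2) (ζ : ℂ) : L2 →L[ℂ] L2 :=
  if h : ∃ R, IsResolventAt A ζ R then h.choose else 0

theorem IsResolventAt.resolventAt_eq {A : L2 →ₗ.[ℂ] L2} {ζ : ℂ} {R : L2 →L[ℂ] L2}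
    (hR : IsResolventAt A ζ R) : resolventAt A ζ = R := by
  have h : ∃ R, IsResolventAt A ζ R := ⟨R, hR⟩
  rw [resolventAt, dif_pos h]
  exact h.choose_spec.unique hR

/-- The spectral parameter `lam + i τ ε`; the signs `±` are `τ = 1` and `τ = -1`. -/
def specParam (τ lam ε : ℝ) : ℂ := (lam : ℂ) + (τ * ε : ℝ) * Complex.I

/-- `R₀(lam ± iε) = (G₀ - (lam ± iε)²)⁻¹`. -/
def R0 (τ lam ε : ℝ) : L2 →L[ℂ] L2 := resolventAt G0 (specParam τ lam ε ^ 2)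

/-- `R₀^{(k)}(lam ± iε)`, the `k`-th derivative of `R₀` with respect to `lam`, in operator norm. -/
def R0deriv (k : ℕ) (τ lam ε : ℝ) : L2 →L[ℂ] L2 :=
  iteratedDeriv k (fun t : ℝ => R0 τ t ε) lam

/-- `‖⟨x⟩^a T ⟨x⟩^b‖_{L^p → L^q} ≤ C`: there is a bounded operator `S : L^p → L^q` of norm at
most `C` such that `S f = ⟨x⟩^a T (⟨x⟩^b f)` for every `f ∈ L^p` with `⟨x⟩^b f ∈ L²`. (If `b ≤ 0`,
these `f` are dense in `L^p` for `p = 1` and are all of `L^p` for `p = 2`.) -/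
def WeightedBound (p q : ℝ≥0∞) [Fact (1 ≤ p)] [Fact (1 ≤ q)] (a : ℝ) (T : L2 →L[ℂ] L2) (b : ℝ)
    (C : ℝ) : Prop :=
  ∃ S : Lp ℂ p (volume : Measure R3) →L[ℂ] Lp ℂ q (volume : Measure R3), ‖S‖ ≤ C ∧
    ∀ (f : Lp ℂ p (volume : Measure R3)) (g : L2),
      (∀ᵐ x, g x = ((bracket x ^ b : ℝ) : ℂ) * f x) →
        ∀ᵐ x, S f x = ((bracket x ^ a : ℝ) : ℂ) * T g x

end FreeResolvent

end

noncomputable section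

namespace FreeResolvent

/-! ### Integrals of functions of one coordinate and the norm -/

/-! In dimension three `R0` is convolution with `e^{(iτλ-ε)|z|} / (4π|z|)`: the Fourier transform of
this kernel reduces to the Laplace transform of `sin(ρr)/ρ`, computed in `laplace_mul_sinc`. The
`n`-th derivative in `λ` multiplies the kernel by `(iτ|z|)^n`. Every estimate is therefore one on
explicit convolution operators `freeOp n`.

The bounds involving `L^∞` or `L^1` need no oscillation. By Cauchy–Schwarz it suffices to bound the
`L²` norm in one variable of the weighted kernel, uniformly in the other. Part of `e^{-ε|z|}` is
traded for `ε^{-θ}⟨z⟩^{-θ}`, and the squared kernel is then dominated by `W(x-y) + W(y)` with `W(z)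
= |z|^{-2}⟨z⟩^{-δ}`, which is integrable for `δ > 1`. The exponents of the theorem are those for
which `δ = 1 + 2η` is reached.

The `L² → L²` bounds carry the factor `λ^{-1}` and do need oscillation. With `κ = iτλ - ε`, the
matrix element of the `n`-th derivative is `∫ (iτr)^n e^{κr} w(r) dr` over `r > 0`, where `w(r) =
⟪g, sin(r√-Δ)/√-Δ f⟫`. If the distances between the supports of `f` and `g` lie in `[a, b]`,
Huygens' principle (`wave_eq_zero_of_notMem`) confines `w` to `[a, b]`. One integration by parts has
no boundary terms and gains `1/κ`; since `|w'| ≤ ‖f‖‖g‖`, this gives `λ^{-1} ε^{-θ} (b-a) b^{n-θ}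
‖f‖‖g‖` up to a constant (`norm_inner_freeOp_le`).

The factor `b - a` is what makes weights just above `1/2` sufficient. For `f` in a dyadic shell of
radius `s`, the exterior is cut into shells of thickness `s`, on each of which `b - a ≤ 6s`.
Cauchy–Schwarz over these shells (`norm_inner_exterior_le`) and a geometric sum over dyadic `s`
(`norm_inner_le_of_shellBound`) give the weighted bounds. -/

/-- The range of `x ↦ (x 0, ‖x‖)`, up to a null set. -/
def coordNormRegion : Set (ℝ × ℝ) := {p | |p.1| < p.2}

theorem measurableSet_coordNormRegion : MeasurableSet coordNormRegion :=
  measurableSet_lt (by fun_prop) (by fun_prop)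

/-- The substitution `r = √(s² + q²)` maps `(0, ∞)` onto `(|s|, ∞)` and satisfies `q dq = r dr`. -/
theorem lintegral_radius_shift (s : ℝ) (Φ : ℝ → ℝ≥0∞) :
    ∫⁻ q in Set.Ioi (0 : ℝ), ENNReal.ofReal q * Φ (Real.sqrt (s ^ 2 + q ^ 2)) =
      ∫⁻ r in Set.Ioi |s|, ENNReal.ofReal r * Φ r := by
  have himg : (fun q : ℝ => Real.sqrt (s ^ 2 + q ^ 2)) '' Set.Ioi 0 = Set.Ioi |s| := by
    ext r
    constructor
    · rintro ⟨q, hq, rfl⟩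
      have hq : 0 < q := hq
      rw [Set.mem_Ioi, ← Real.sqrt_sq_eq_abs]
      exact Real.sqrt_lt_sqrt (sq_nonneg s) (by nlinarith)
    · intro hr
      have hr : |s| < r := hr
      have h0 : 0 < r := (abs_nonneg s).trans_lt hr
      have h1 : s ^ 2 < r ^ 2 := by rw [← sq_abs s]; gcongr
      refine ⟨Real.sqrt (r ^ 2 - s ^ 2), Real.sqrt_pos.2 (by linarith), ?_⟩
      simp only
      rw [Real.sq_sqrt (by linarith), add_sub_cancel, Real.sqrt_sq h0.le]
  have hpos : ∀ q ∈ Set.Ioi (0 : ℝ), 0 < s ^ 2 + q ^ 2 := fun q hq => by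
    have hq : 0 < q := hq
    positivity
  have hd : ∀ q ∈ Set.Ioi (0 : ℝ), HasDerivWithinAt (fun q : ℝ => Real.sqrt (s ^ 2 + q ^ 2))
      (q / Real.sqrt (s ^ 2 + q ^ 2)) (Set.Ioi 0) q := by
    intro q hq
    have h := (((hasDerivAt_id q).pow 2).const_add (s ^ 2)).sqrt (hpos q hq).ne'
    refine (h.congr_deriv ?_).hasDerivWithinAt
    have := (Real.sqrt_pos.2 (hpos q hq)).ne'
    simp
    field_simp
  have hinj : Set.InjOn (fun q : ℝ => Real.sqrt (s ^ 2 + q ^ 2)) (Set.Ioi 0) := by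
    intro a ha b hb hab
    have ha' : 0 < a := ha
    have hb' : 0 < b := hb
    have := (Real.sqrt_inj (hpos a ha).le (hpos b hb).le).1 hab
    exact (sq_eq_sq₀ ha'.le hb'.le).1 (by linarith)
  rw [← himg, lintegral_image_eq_lintegral_abs_deriv_mul measurableSet_Ioi hd hinj]
  refine setLIntegral_congr_fun measurableSet_Ioi fun q hq => ?_
  have hq' : 0 < q := hq
  have h1 := Real.sqrt_pos.2 (hpos q hq)
  rw [← mul_assoc, ← ENNReal.ofReal_mul (abs_nonneg _), abs_of_pos (div_pos hq' h1),
    div_mul_cancel₀ _ h1.ne']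

theorem lintegral_plane_radial (Φ : ℝ → ℝ≥0∞) (hΦ : Measurable Φ) :
    ∫⁻ y : ℝ × ℝ, Φ (y.1 ^ 2 + y.2 ^ 2) =
      ENNReal.ofReal (2 * Real.pi) * ∫⁻ q in Set.Ioi (0 : ℝ), ENNReal.ofReal q * Φ (q ^ 2) := by
  rw [← lintegral_comp_polarCoord_symm, polarCoord_target, Measure.volume_eq_prod,
    ← Measure.prod_restrict, lintegral_prod_symm]
  · have : ∀ θ q : ℝ, ENNReal.ofReal q • Φ ((polarCoord.symm (q, θ)).1 ^ 2 +
        (polarCoord.symm (q, θ)).2 ^ 2) = ENNReal.ofReal q * Φ (q ^ 2) := by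
      intro θ q
      rw [polarCoord_symm_apply, smul_eq_mul]
      congr 2
      simp only
      rw [mul_pow, mul_pow, ← mul_add, Real.cos_sq_add_sin_sq, mul_one]
    simp only [this, lintegral_const, Measure.restrict_apply_univ, Real.volume_Ioo]
    rw [mul_comm]
    congr 2
    ring
  · have h : Measurable fun p : ℝ × ℝ => ENNReal.ofReal p.1 * Φ (p.1 ^ 2) := by fun_prop
    convert h.aemeasurable using 2 with p
    rw [polarCoord_symm_apply, smul_eq_mul]
    congr 2
    simp only
    rw [mul_pow, mul_pow, ← mul_add, Real.cos_sq_add_sin_sq, mul_one]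

/-- Polar coordinates in the plane orthogonal to the first axis, then passage from the planar radius
to the full radius. As Archimedes observed, the density `2πr` does not depend on the coordinate;
this is what makes Fourier transforms of radial functions in dimension three elementary. -/
theorem lintegral_coord_norm (Ψ : ℝ × ℝ → ℝ≥0∞) (hΨ : Measurable Ψ) :
    ∫⁻ x : R3, Ψ (x 0, ‖x‖) =
      ∫⁻ p in coordNormRegion, ENNReal.ofReal (2 * Real.pi * p.2) * Ψ p := by
  let e₁ := (MeasurableEquiv.toLp 2 (Fin 3 → ℝ)).symm
  let e₂ := MeasurableEquiv.piFinSuccAbove (fun _ : Fin 3 => ℝ) 0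
  let e₃ := MeasurableEquiv.prodCongr (MeasurableEquiv.refl ℝ) (MeasurableEquiv.finTwoArrow (α := ℝ))
  have h₁ : MeasurePreserving e₁ := EuclideanSpace.volume_preserving_symm_measurableEquiv_toLp (Fin 3)
  have h₂ : MeasurePreserving e₂ := volume_preserving_piFinSuccAbove (fun _ : Fin 3 => ℝ) 0
  have h₃ : MeasurePreserving e₃ := (MeasurePreserving.id _).prod (volume_preserving_finTwoArrow ℝ)
  have h := h₃.comp (h₂.comp h₁)
  let G : ℝ × ℝ × ℝ → ℝ≥0∞ := fun p => Ψ (p.1, Real.sqrt (p.1 ^ 2 + (p.2.1 ^ 2 + p.2.2 ^ 2)))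
  have hG : Measurable G := by fun_prop
  have hx : ∀ x : R3, Ψ (x 0, ‖x‖) = G ((e₃ ∘ e₂ ∘ e₁) x) := by
    intro x
    have h4 : (e₃ ∘ e₂ ∘ e₁) x = (x 0, x 1, x 2) := rfl
    rw [h4]
    simp only [G]
    rw [EuclideanSpace.norm_eq, Fin.sum_univ_three]
    simp only [Real.norm_eq_abs, sq_abs, add_assoc]
  simp only [hx]
  rw [h.lintegral_comp hG, Measure.volume_eq_prod, lintegral_prod _ hG.aemeasurable]
  have hS := measurableSet_coordNormRegion
  rw [← lintegral_indicator hS, Measure.volume_eq_prod,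
    lintegral_prod _ (Measurable.indicator (by fun_prop) hS).aemeasurable]
  refine lintegral_congr fun s => ?_
  have h5 := lintegral_plane_radial (fun t => Ψ (s, Real.sqrt (s ^ 2 + t))) (by fun_prop)
  simp only [G]
  rw [← Measure.volume_eq_prod, h5, lintegral_radius_shift s (fun r => Ψ (s, r)), ← lintegral_const_mul _ (by fun_prop),
    ← lintegral_indicator measurableSet_Ioi]
  refine lintegral_congr fun r => ?_
  by_cases hr : |s| < r
  · rw [Set.indicator_of_mem (show r ∈ Set.Ioi |s| from hr),
      Set.indicator_of_mem (show (s, r) ∈ coordNormRegion from hr), ← mul_assoc,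
      ENNReal.ofReal_mul (by positivity : 0 ≤ 2 * Real.pi)]
  · rw [Set.indicator_of_notMem (show r ∉ Set.Ioi |s| from hr),
      Set.indicator_of_notMem (show (s, r) ∉ coordNormRegion from hr)]

theorem lintegral_inner_norm (e : R3) (he : ‖e‖ = 1) (Ψ : ℝ × ℝ → ℝ≥0∞) (hΨ : Measurable Ψ) :
    ∫⁻ x : R3, Ψ (inner ℝ e x, ‖x‖) =
      ∫⁻ p in coordNormRegion, ENNReal.ofReal (2 * Real.pi * p.2) * Ψ p := by
  let e₀ : R3 := EuclideanSpace.single 0 1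
  -- A reflection exchanging two unit vectors preserves volume and norm, so the direction may be
  -- taken to be the first axis.
  let U : R3 ≃ₗᵢ[ℝ] R3 := (ℝ ∙ (e - e₀))ᗮ.reflection
  have hU : U e = e₀ := Submodule.reflection_sub (by simp [he, e₀])
  rw [← lintegral_coord_norm Ψ hΨ, ← (U.measurePreserving).lintegral_comp (f := fun x : R3 => Ψ (x 0, ‖x‖))
    (by fun_prop)]
  refine lintegral_congr fun x => ?_
  have : inner ℝ e x = (U x) 0 := by
    rw [← U.inner_map_map, hU]
    simp [e₀, PiLp.inner_apply]
  rw [this, U.norm_map]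

theorem map_inner_norm (e : R3) (he : ‖e‖ = 1) :
    Measure.map (fun x : R3 => ((inner ℝ e x : ℝ), ‖x‖)) volume =
      (volume.restrict coordNormRegion).withDensity (fun p => ENNReal.ofReal (2 * Real.pi * p.2)) := by
  have hm : Measurable fun x : R3 => ((inner ℝ e x : ℝ), ‖x‖) := by fun_prop
  refine Measure.ext_of_lintegral _ fun Ψ hΨ => ?_
  rw [lintegral_map hΨ hm, lintegral_inner_norm e he Ψ hΨ,
    lintegral_withDensity_eq_lintegral_mul _ (by fun_prop) hΨ]
  rfl

theorem integral_inner_norm (e : R3) (he : ‖e‖ = 1) (F : ℝ × ℝ → ℂ) (hF : Measurable F) :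
    ∫ x : R3, F (inner ℝ e x, ‖x‖) =
      ∫ p in coordNormRegion, (2 * Real.pi * p.2 : ℝ) • F p := by
  have hm : Measurable fun x : R3 => ((inner ℝ e x : ℝ), ‖x‖) := by fun_prop
  rw [← integral_map (f := F) hm.aemeasurable hF.aestronglyMeasurable, map_inner_norm e he,
    integral_withDensity_eq_integral_toReal_smul (by fun_prop) (by simp)]
  refine setIntegral_congr_fun measurableSet_coordNormRegion fun p hp => ?_
  have hp : |p.1| < p.2 := hp
  have : 0 ≤ p.2 := (abs_nonneg _).trans hp.le
  rw [ENNReal.toReal_ofReal (by positivity)]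

theorem lintegral_norm (φ : ℝ → ℝ≥0∞) (hφ : Measurable φ) :
    ∫⁻ x : R3, φ ‖x‖ = ∫⁻ r in Set.Ioi (0 : ℝ), ENNReal.ofReal (4 * Real.pi * r ^ 2) * φ r := by
  rw [lintegral_coord_norm (fun p => φ p.2) (by fun_prop),
    ← lintegral_indicator measurableSet_coordNormRegion, Measure.volume_eq_prod,
    lintegral_prod_symm _ ((Measurable.indicator (by fun_prop)
      measurableSet_coordNormRegion).aemeasurable), ← lintegral_indicator measurableSet_Ioi]
  refine lintegral_congr fun r => ?_
  have : ∀ s : ℝ, coordNormRegion.indicator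
      (fun p : ℝ × ℝ => ENNReal.ofReal (2 * Real.pi * p.2) * φ p.2) (s, r) =
      (Set.Ioo (-r) r).indicator (fun _ => ENNReal.ofReal (2 * Real.pi * r) * φ r) s := by
    intro s
    have h : (s, r) ∈ coordNormRegion ↔ s ∈ Set.Ioo (-r) r := by
      rw [Set.mem_Ioo, ← abs_lt]; rfl
    by_cases hs : s ∈ Set.Ioo (-r) r
    · rw [Set.indicator_of_mem hs, Set.indicator_of_mem (h.2 hs)]
    · rw [Set.indicator_of_notMem hs, Set.indicator_of_notMem (fun h' => hs (h.1 h'))]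
  simp only [this]
  rw [lintegral_indicator measurableSet_Ioo, setLIntegral_const, Real.volume_Ioo]
  by_cases hr : 0 < r
  · rw [Set.indicator_of_mem (show r ∈ Set.Ioi (0 : ℝ) from hr), mul_right_comm,
      ← ENNReal.ofReal_mul (by positivity)]
    congr 2
    ring
  · rw [Set.indicator_of_notMem (show r ∉ Set.Ioi (0 : ℝ) from hr),
      ENNReal.ofReal_of_nonpos (by linarith : r - -r ≤ 0), mul_zero]

/-! ### Radial kernels and their Fourier transforms -/

/-- The character `e^{-2πi⟨z, ξ⟩}`. -/
def phase (z ξ : R3) : ℂ := Complex.exp (((-2 * Real.pi * inner ℝ z ξ : ℝ) : ℂ) * Complex.I)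

theorem norm_phase (z ξ : R3) : ‖phase z ξ‖ = 1 := Complex.norm_exp_ofReal_mul_I _

theorem continuous_phase : Continuous fun p : R3 × R3 => phase p.1 p.2 := by
  unfold phase; fun_prop

/-- The function `k(|z|) / (4π|z|)`. -/
def radialKernel (k : ℝ → ℂ) (z : R3) : ℂ := ((4 * Real.pi * ‖z‖)⁻¹ : ℝ) • k ‖z‖

theorem measurable_radialKernel {k : ℝ → ℂ} (hk : Measurable k) : Measurable (radialKernel k) := by
  unfold radialKernel; fun_prop

theorem norm_radialKernel (k : ℝ → ℂ) (z : R3) :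
    ‖radialKernel k z‖ = (4 * Real.pi * ‖z‖)⁻¹ * ‖k ‖z‖‖ := by
  rw [radialKernel, norm_smul, Real.norm_of_nonneg (by positivity)]

theorem lintegral_radialKernel {k : ℝ → ℂ} (hk : Measurable k) :
    ∫⁻ z, ‖radialKernel k z‖ₑ = ∫⁻ r in Set.Ioi (0 : ℝ), ‖(r : ℂ) * k r‖ₑ := by
  have h : ∀ z : R3, ‖radialKernel k z‖ₑ = ENNReal.ofReal ((4 * Real.pi * ‖z‖)⁻¹) * ‖k ‖z‖‖ₑ := by
    intro z
    rw [radialKernel, enorm_smul, Real.enorm_of_nonneg (by positivity)]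
  simp only [h]
  rw [lintegral_norm (fun r => ENNReal.ofReal ((4 * Real.pi * r)⁻¹) * ‖k r‖ₑ) (by fun_prop)]
  refine setLIntegral_congr_fun measurableSet_Ioi fun r hr => ?_
  have hr : 0 < r := hr
  rw [← mul_assoc, ← ENNReal.ofReal_mul (by positivity), enorm_mul, ← ofReal_norm (r : ℂ),
    Complex.norm_real, Real.norm_of_nonneg hr.le]
  congr 2
  field_simp

theorem integrable_radialKernel {k : ℝ → ℂ} (hk : Measurable k)
    (hi : IntegrableOn (fun r : ℝ => (r : ℂ) * k r) (Set.Ioi 0)) : Integrable (radialKernel k) := by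
  refine ⟨(measurable_radialKernel hk).aestronglyMeasurable, ?_⟩
  have := hi.2
  rw [HasFiniteIntegral] at this ⊢
  rwa [lintegral_radialKernel hk]

theorem integral_norm_radialKernel {k : ℝ → ℂ} (hk : Measurable k) :
    ∫ z, ‖radialKernel k z‖ = ∫ r in Set.Ioi (0 : ℝ), ‖(r : ℂ) * k r‖ := by
  rw [integral_norm_eq_lintegral_enorm (measurable_radialKernel hk).aestronglyMeasurable,
    integral_norm_eq_lintegral_enorm (by fun_prop), lintegral_radialKernel hk]

theorem integral_exp_symm (ρ r : ℝ) (hr : 0 ≤ r) :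
    ∫ s in Set.Ioo (-r) r, Complex.exp (((-ρ * s : ℝ) : ℂ) * Complex.I) =
      ((2 * (r * Real.sinc (ρ * r)) : ℝ) : ℂ) := by
  rw [← integral_Ioc_eq_integral_Ioo, ← intervalIntegral.integral_of_le (by linarith)]
  rcases eq_or_ne ρ 0 with rfl | hρ
  · simp; ring
  rcases hr.eq_or_lt with rfl | hr
  · simp
  have hc : (-(ρ : ℂ) * Complex.I) ≠ 0 := by simp [hρ]
  have : ∀ s : ℝ, Complex.exp (((-ρ * s : ℝ) : ℂ) * Complex.I) =
      Complex.exp ((-(ρ : ℂ) * Complex.I) * s) := fun s => by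
    congr 1; push_cast; ring
  simp only [this]
  rw [integral_exp_mul_complex hc, Real.sinc_of_ne_zero (by positivity)]
  push_cast
  rw [Complex.sin]
  have hr' : (r : ℂ) ≠ 0 := by exact_mod_cast hr.ne'
  have hρ' : (ρ : ℂ) ≠ 0 := by exact_mod_cast hρ
  have e1 : -(ρ : ℂ) * Complex.I * -r = ρ * r * Complex.I := by ring
  have e2 : -(ρ : ℂ) * Complex.I * r = -(ρ * r) * Complex.I := by ring
  rw [e1, e2]
  field_simp
  rw [Complex.I_sq]
  ring

theorem exists_unit_smul (ξ : R3) : ∃ e : R3, ‖e‖ = 1 ∧ ξ = ‖ξ‖ • e := by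
  rcases eq_or_ne ξ 0 with rfl | h
  · exact ⟨EuclideanSpace.single 0 1, by simp, by simp⟩
  · have := norm_ne_zero_iff.2 h
    refine ⟨‖ξ‖⁻¹ • ξ, ?_, ?_⟩
    · rw [norm_smul, norm_inv, norm_norm, inv_mul_cancel₀ this]
    · rw [smul_smul, mul_inv_cancel₀ this, one_smul]

/-- The density `2πr` cancels the factor `1/(4πr)` up to `1/2`. Integrating the character over the
coordinate along `ξ`, which runs through `(-r, r)`, produces `r sinc(2π|ξ|r)` and leaves a radial
integral. -/
theorem integral_radialKernel_mul_phase {k : ℝ → ℂ} (hk : Measurable k)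
    (hi : IntegrableOn (fun r : ℝ => (r : ℂ) * k r) (Set.Ioi 0)) (ξ : R3) :
    ∫ z, radialKernel k z * phase z ξ =
      ∫ r in Set.Ioi (0 : ℝ), k r * ((r * Real.sinc (2 * Real.pi * ‖ξ‖ * r) : ℝ) : ℂ) := by
  obtain ⟨e, he, hξ⟩ := exists_unit_smul ξ
  set ρ := 2 * Real.pi * ‖ξ‖ with hρ
  let F : ℝ × ℝ → ℂ := fun p => ((4 * Real.pi * p.2)⁻¹ : ℝ) • k p.2 *
    Complex.exp (((-ρ * p.1 : ℝ) : ℂ) * Complex.I)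
  have hF : Measurable F := by fun_prop
  have hm : Measurable fun x : R3 => ((inner ℝ e x : ℝ), ‖x‖) := by fun_prop
  have hFx : ∀ z, radialKernel k z * phase z ξ = F (inner ℝ e z, ‖z‖) := by
    intro z
    have : inner ℝ z ξ = ‖ξ‖ * inner ℝ e z := by
      conv_lhs => rw [hξ]
      rw [real_inner_smul_right, real_inner_comm]
    simp only [F, radialKernel, phase, this, hρ]
    congr 4
    ring
  have hFi : Integrable (fun p : ℝ × ℝ => (2 * Real.pi * p.2 : ℝ) • F p)
      (volume.restrict coordNormRegion) := by
    have h1 : Integrable (fun z : R3 => F (inner ℝ e z, ‖z‖)) := by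
      simp only [← hFx]
      refine (integrable_radialKernel hk hi).mul_bdd (c := 1) ?_ ?_
      · exact (continuous_phase.comp (Continuous.prodMk_left ξ)).aestronglyMeasurable
      · exact Filter.Eventually.of_forall fun z => (norm_phase z ξ).le
    have h2 : Integrable F (Measure.map (fun x : R3 => ((inner ℝ e x : ℝ), ‖x‖)) volume) :=
      (integrable_map_measure hF.aestronglyMeasurable hm.aemeasurable).2 h1
    rw [map_inner_norm e he, integrable_withDensity_iff_integrable_smul' (by fun_prop) (by simp)]
      at h2
    refine h2.congr ?_
    filter_upwards [ae_restrict_mem measurableSet_coordNormRegion] with p hp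
    have hp : |p.1| < p.2 := hp
    have : 0 ≤ p.2 := (abs_nonneg _).trans hp.le
    rw [ENNReal.toReal_ofReal (by positivity)]
  simp only [hFx]
  rw [integral_inner_norm e he F hF, ← integral_indicator measurableSet_coordNormRegion,
    Measure.volume_eq_prod, integral_prod_symm _
      ((integrable_indicator_iff measurableSet_coordNormRegion).2 hFi),
    ← integral_indicator measurableSet_Ioi]
  congr 1
  funext r
  have : ∀ s : ℝ, coordNormRegion.indicator (fun p : ℝ × ℝ => (2 * Real.pi * p.2 : ℝ) • F p) (s, r) =
      (Set.Ioo (-r) r).indicator (fun s => (k r / 2) *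
        Complex.exp (((-ρ * s : ℝ) : ℂ) * Complex.I)) s := by
    intro s
    have h : (s, r) ∈ coordNormRegion ↔ s ∈ Set.Ioo (-r) r := by
      rw [Set.mem_Ioo, ← abs_lt]; rfl
    by_cases hs : s ∈ Set.Ioo (-r) r
    · rw [Set.indicator_of_mem hs, Set.indicator_of_mem (h.2 hs)]
      have hr : 0 < r := by have := hs.1.trans hs.2; linarith
      have hr' : (r : ℂ) ≠ 0 := by exact_mod_cast hr.ne'
      have hpi : (Real.pi : ℂ) ≠ 0 := by exact_mod_cast Real.pi_ne_zero
      simp only [F, Complex.real_smul]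
      push_cast
      field_simp
      norm_num
    · rw [Set.indicator_of_notMem hs, Set.indicator_of_notMem (fun h' => hs (h.1 h'))]
  simp only [this]
  rw [integral_indicator measurableSet_Ioo]
  by_cases hr : 0 < r
  · rw [Set.indicator_of_mem (show r ∈ Set.Ioi (0 : ℝ) from hr), integral_const_mul,
      integral_exp_symm ρ r hr.le]
    push_cast
    ring
  · rw [Set.indicator_of_notMem (show r ∉ Set.Ioi (0 : ℝ) from hr), Set.Ioo_eq_empty (by linarith)]
    simp

/-! ### Multiplication and translation operators on `L²` -/

open scoped FourierTransform ComplexConjugate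

theorem memLp_bdd_mul {m : R3 → ℂ} (hm : Measurable m) {C : ℝ} (hC : ∀ x, ‖m x‖ ≤ C) (f : L2) :
    MemLp (fun x => m x * f x) 2 (volume : Measure R3) :=
  (Lp.memLp f).of_le_mul (hm.aestronglyMeasurable.mul (Lp.aestronglyMeasurable f))
    (Filter.Eventually.of_forall fun x => by
      rw [norm_mul]; exact mul_le_mul_of_nonneg_right (hC x) (norm_nonneg _))

/-- Multiplication by a bounded measurable function on `L²`. -/
def mulOp (m : R3 → ℂ) (hm : Measurable m) (C : ℝ) (hC : ∀ x, ‖m x‖ ≤ C) : L2 →L[ℂ] L2 :=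
  LinearMap.mkContinuous
    { toFun := fun f => (memLp_bdd_mul hm hC f).toLp _
      map_add' := fun f g => by
        rw [← MemLp.toLp_add]
        refine MemLp.toLp_congr _ _ ?_
        filter_upwards [Lp.coeFn_add f g] with x hx
        simp only [hx, Pi.add_apply, mul_add]
      map_smul' := fun c f => by
        rw [RingHom.id_apply, ← MemLp.toLp_const_smul]
        refine MemLp.toLp_congr _ _ ?_
        filter_upwards [Lp.coeFn_smul c f] with x hx
        simp only [hx, Pi.smul_apply, smul_eq_mul]
        ring } C fun f => by
      refine Lp.norm_le_mul_norm_of_ae_le_mul ?_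
      filter_upwards [(memLp_bdd_mul hm hC f).coeFn_toLp] with x hx
      simp only [LinearMap.coe_mk, AddHom.coe_mk, hx, norm_mul]
      exact mul_le_mul_of_nonneg_right (hC x) (norm_nonneg _)

theorem mulOp_ae (m : R3 → ℂ) (hm : Measurable m) (C : ℝ) (hC : ∀ x, ‖m x‖ ≤ C) (f : L2) :
    ∀ᵐ x, mulOp m hm C hC f x = m x * f x :=
  (memLp_bdd_mul hm hC f).coeFn_toLp

/-- Translation by `z` on `L²`. -/
def trans (z : R3) : L2 →ₗᵢ[ℂ] L2 :=
  Lp.compMeasurePreservingₗᵢ ℂ (fun x => x - z) (measurePreserving_sub_right volume z)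

theorem trans_ae (z : R3) (f : L2) : ∀ᵐ x, trans z f x = f (x - z) :=
  Lp.coeFn_compMeasurePreserving f (measurePreserving_sub_right volume z)

/-- Strong continuity of translations supplies the measurability of `z ↦ K z • trans z f`, so that a
convolution can be defined as a Bochner integral in `L²`. -/
theorem continuous_trans (f : L2) : Continuous fun z => trans z f := by
  let g : C(R3, C(R3, R3)) :=
    (ContinuousMap.mk (fun p : R3 × R3 => p.2 - p.1) (by fun_prop)).curry
  exact (continuous_const (y := f)).compMeasurePreservingLp g.continuous
    (fun z => measurePreserving_sub_right volume z) (by simp)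

theorem measurable_phase (z : R3) : Measurable (phase z) :=
  (continuous_phase.comp (Continuous.prodMk_right z)).measurable

theorem fourier_compSubConst (z : R3) (φ : 𝓢(R3, ℂ)) (ξ : R3) :
    (𝓕 (SchwartzMap.compSubConstCLM ℂ z φ)) ξ = phase z ξ * (𝓕 φ) ξ := by
  rw [SchwartzMap.fourier_coe, SchwartzMap.fourier_coe, Real.fourier_eq', Real.fourier_eq', phase,
    ← integral_const_mul, ← integral_add_right_eq_self _ z]
  refine integral_congr_ae (Filter.Eventually.of_forall fun x => ?_)
  simp only [SchwartzMap.compSubConstCLM_apply, add_sub_cancel_right, smul_eq_mul]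
  rw [← mul_assoc, ← Complex.exp_add, inner_add_left]
  congr 2
  push_cast
  ring

/-- On Schwartz functions this is a change of variables; both sides are continuous in `f`, and
Schwartz functions are dense. -/
theorem fourier_trans (z : R3) (f : L2) :
    𝓕 (trans z f) = mulOp (phase z) (measurable_phase z) 1 (fun x => (norm_phase z x).le) (𝓕 f) := by
  let A : L2 →L[ℂ] L2 := (Lp.fourierTransformₗᵢ R3 ℂ).toContinuousLinearEquiv.toContinuousLinearMap
  let M := mulOp (phase z) (measurable_phase z) 1 (fun x => (norm_phase z x).le)
  have hd := SchwartzMap.denseRange_toLpCLM (E := R3) (F := ℂ) (p := 2) (by simp)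
    (μ := (volume : Measure R3))
  have h : (fun f => A (trans z f)) = fun f => M (A f) := by
    refine hd.equalizer (A.continuous.comp (trans z).continuous)
      (M.continuous.comp A.continuous) ?_
    funext φ
    change 𝓕 (trans z (φ.toLp 2)) = M (𝓕 (φ.toLp 2))
    have h1 : trans z (φ.toLp 2) = (SchwartzMap.compSubConstCLM ℂ z φ).toLp 2 := by
      refine Lp.ext ?_
      have h2 := (measurePreserving_sub_right volume z).quasiMeasurePreserving.ae
        (φ.coeFn_toLp 2 (volume : Measure R3))
      filter_upwards [trans_ae z (φ.toLp 2), h2,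
        (SchwartzMap.compSubConstCLM ℂ z φ).coeFn_toLp 2 (volume : Measure R3)] with x hx hy hz
      rw [hx, hy, hz]
      rfl
    rw [h1, SchwartzMap.toLp_fourier_eq, SchwartzMap.toLp_fourier_eq]
    refine Lp.ext ?_
    filter_upwards [mulOp_ae (phase z) (measurable_phase z) 1 (fun x => (norm_phase z x).le)
      ((𝓕 φ).toLp 2), (𝓕 φ).coeFn_toLp 2 (volume : Measure R3),
      (𝓕 (SchwartzMap.compSubConstCLM ℂ z φ)).coeFn_toLp 2 (volume : Measure R3)] with ξ h3 h4 h5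
    rw [h5, h3, h4]
    exact fourier_compSubConst z φ ξ
  exact congrFun h f

/-- The product of Fourier transforms that represents `z ↦ ⟪g, trans z f⟫`. -/
def pairing (f g : L2) (ξ : R3) : ℂ := inner ℂ ((𝓕 g : L2) ξ) ((𝓕 f : L2) ξ)

theorem integrable_pairing (f g : L2) : Integrable (pairing f g) :=
  L2.integrable_inner (𝓕 g : L2) (𝓕 f : L2)

theorem integral_norm_inner_le (f g : L2) :
    ∫ x, ‖(inner ℂ (g x) (f x) : ℂ)‖ ≤ ‖f‖ * ‖g‖ := by
  have h1 := eLpNorm_smul_le_mul_eLpNorm (p := 2) (q := 2) (r := 1)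
    (Lp.aestronglyMeasurable f) (Lp.aestronglyMeasurable g)
  have h2 : ∫ x, ‖(inner ℂ (g x) (f x) : ℂ)‖ = (eLpNorm (⇑g • ⇑f) 1 (volume : Measure R3)).toReal := by
    rw [eLpNorm_one_eq_lintegral_enorm, ← integral_norm_eq_lintegral_enorm
      ((Lp.aestronglyMeasurable g).smul (Lp.aestronglyMeasurable f))]
    refine integral_congr_ae (Filter.Eventually.of_forall fun x => ?_)
    simp only [RCLike.inner_apply, norm_mul, RCLike.norm_conj, Pi.smul_apply', smul_eq_mul]
    exact mul_comm _ _
  rw [h2, Lp.norm_def, Lp.norm_def, mul_comm, ← ENNReal.toReal_mul]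
  exact ENNReal.toReal_mono (ENNReal.mul_ne_top (Lp.eLpNorm_ne_top g) (Lp.eLpNorm_ne_top f)) h1

theorem integral_norm_pairing_le (f g : L2) : ∫ ξ, ‖pairing f g ξ‖ ≤ ‖f‖ * ‖g‖ := by
  refine (integral_norm_inner_le (𝓕 f : L2) (𝓕 g : L2)).trans ?_
  rw [Lp.norm_fourier_eq, Lp.norm_fourier_eq]

theorem inner_trans (f g : L2) (z : R3) :
    (inner ℂ g (trans z f) : ℂ) = ∫ ξ, phase z ξ * pairing f g ξ := by
  rw [← Lp.inner_fourier_eq, fourier_trans, L2.inner_def]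
  refine integral_congr_ae ?_
  filter_upwards [mulOp_ae (phase z) (measurable_phase z) 1 (fun x => (norm_phase z x).le) (𝓕 f)]
    with ξ hξ
  simp only [hξ, pairing, RCLike.inner_apply]
  ring

/-! ### Convolution operators on `L²` -/

theorem integrable_smul_trans {K : R3 → ℂ} (hK : Integrable K) (f : L2) :
    Integrable fun z => K z • trans z f := by
  refine (hK.norm.mul_const ‖f‖).mono'
    (hK.aestronglyMeasurable.smul (continuous_trans f).aestronglyMeasurable) ?_
  filter_upwards with z
  rw [norm_smul, LinearIsometry.norm_map]

/-- Convolution with an integrable kernel, as an operator on `L²`. -/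
def convOp (K : R3 → ℂ) (hK : Integrable K) : L2 →L[ℂ] L2 :=
  LinearMap.mkContinuous
    { toFun := fun f => ∫ z, K z • trans z f
      map_add' := fun f g => by
        rw [← integral_add (integrable_smul_trans hK f) (integrable_smul_trans hK g)]
        simp only [map_add, smul_add]
      map_smul' := fun c f => by
        rw [RingHom.id_apply, ← integral_smul]
        simp only [map_smul, smul_comm c] } (∫ z, ‖K z‖) fun f => by
      refine (norm_integral_le_integral_norm _).trans_eq ?_
      rw [← integral_mul_const]
      simp only [norm_smul, LinearIsometry.norm_map]

theorem convOp_apply {K : R3 → ℂ} (hK : Integrable K) (f : L2) :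
    convOp K hK f = ∫ z, K z • trans z f := rfl

theorem norm_convOp_le {K : R3 → ℂ} (hK : Integrable K) : ‖convOp K hK‖ ≤ ∫ z, ‖K z‖ :=
  LinearMap.mkContinuous_norm_le _ (integral_nonneg fun _ => norm_nonneg _) _

theorem convOp_sub {K K' : R3 → ℂ} (hK : Integrable K) (hK' : Integrable K') :
    convOp (fun z => K z - K' z) (hK.sub hK') = convOp K hK - convOp K' hK' := by
  ext1 f
  rw [_root_.sub_apply, convOp_apply, convOp_apply, convOp_apply,
    ← integral_sub (integrable_smul_trans hK f) (integrable_smul_trans hK' f)]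
  simp only [sub_smul]

theorem convOp_smul {K : R3 → ℂ} (hK : Integrable K) (c : ℂ) :
    convOp (fun z => c * K z) (hK.const_mul c) = c • convOp K hK := by
  ext1 f
  rw [_root_.smul_apply, convOp_apply, convOp_apply, ← integral_smul]
  simp only [mul_smul]

theorem inner_convOp {K : R3 → ℂ} (hK : Integrable K) (f g : L2) :
    (inner ℂ g (convOp K hK f) : ℂ) = ∫ z, K z * inner ℂ g (trans z f) := by
  rw [convOp_apply, ← integral_inner (integrable_smul_trans hK f)]
  simp only [inner_smul_right]

/-- Parseval for each translate, then Fubini: the integrand is dominated by `‖K z‖ ‖pairing f g ξ‖`,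
which is integrable on the product. -/
theorem inner_convOp_eq_integral_pairing {K : R3 → ℂ} (hK : Integrable K) (f g : L2) :
    (inner ℂ g (convOp K hK f) : ℂ) = ∫ ξ, (∫ z, K z * phase z ξ) * pairing f g ξ := by
  rw [inner_convOp]
  simp only [inner_trans, ← integral_const_mul, ← integral_mul_const]
  rw [integral_integral_swap]
  · simp only [mul_assoc]
  · have h := (hK.mul_prod (integrable_pairing f g)).mul_bdd (c := 1)
      (g := fun p : R3 × R3 => phase p.1 p.2)
      continuous_phase.aestronglyMeasurable (Filter.Eventually.of_forall fun p => (norm_phase _ _).le)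
    refine h.congr (Filter.Eventually.of_forall fun p => ?_)
    simp only [Function.uncurry]
    ring

open scoped FourierTransform ComplexConjugate

/-! ### `G₀` on the Fourier side -/

theorem neg_laplacian_eq_iff (u v : L2) :
    -(Δ (Lp.toTemperedDistribution u)) = Lp.toTemperedDistribution v ↔
      ∀ ψ : 𝓢(R3, ℂ), ∫ ξ, ψ ξ * ((((2 * Real.pi * ‖ξ‖) ^ 2 : ℝ) : ℂ) * (𝓕 u : L2) ξ) =
        ∫ ξ, ψ ξ * (𝓕 v : L2) ξ := by
  have hg : (fun x : R3 => Complex.ofReal (‖x‖ ^ 2)).HasTemperateGrowth := by fun_prop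
  have h1 : -(Δ (Lp.toTemperedDistribution u)) = Lp.toTemperedDistribution v ↔
      (((2 * Real.pi) ^ 2 : ℝ) : ℂ) • TemperedDistribution.smulLeftCLM ℂ
        (fun x : R3 => Complex.ofReal (‖x‖ ^ 2)) (Lp.toTemperedDistribution (𝓕 u : L2)) =
        Lp.toTemperedDistribution (𝓕 v : L2) := by
    rw [← Lp.fourier_toTemperedDistribution_eq, ← Lp.fourier_toTemperedDistribution_eq,
      TemperedDistribution.laplacian_eq_fourierMultiplierCLM,
      TemperedDistribution.fourierMultiplierCLM_apply, neg_smul, neg_neg, ← Complex.coe_smul]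
    constructor
    · intro h
      rw [← h, FourierTransform.fourier_smul, FourierTransform.fourier_fourierInv_eq]
    · intro h
      rw [← FourierTransform.fourierInv_smul, h, FourierTransform.fourierInv_fourier_eq]
  rw [h1]
  have h2 : ∀ ψ : 𝓢(R3, ℂ), ((((2 * Real.pi) ^ 2 : ℝ) : ℂ) • TemperedDistribution.smulLeftCLM ℂ
        (fun x : R3 => Complex.ofReal (‖x‖ ^ 2)) (Lp.toTemperedDistribution (𝓕 u : L2))) ψ =
      ∫ ξ, ψ ξ * ((((2 * Real.pi * ‖ξ‖) ^ 2 : ℝ) : ℂ) * (𝓕 u : L2) ξ) := by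
    intro ψ
    rw [_root_.smul_apply, TemperedDistribution.smulLeftCLM_apply_apply,
      Lp.toTemperedDistribution_apply, ← integral_smul]
    refine integral_congr_ae (Filter.Eventually.of_forall fun x => ?_)
    simp only [SchwartzMap.smulLeftCLM_apply_apply hg, smul_eq_mul]
    push_cast
    ring
  constructor
  · intro h ψ
    rw [← h2, h, Lp.toTemperedDistribution_apply]
    simp only [smul_eq_mul]
  · intro h
    ext ψ
    rw [h2, h, Lp.toTemperedDistribution_apply]
    simp only [smul_eq_mul]

/-- The Laplacian is a Fourier multiplier on tempered distributions. The function `|ξ|²û` is only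
known to be locally integrable at first, so the pointwise identity is recovered from compactly
supported smooth test functions. -/
theorem mem_graph_G0_iff_fourier (u v : L2) :
    (u, v) ∈ G0.graph ↔
      ∀ᵐ ξ, (((2 * Real.pi * ‖ξ‖) ^ 2 : ℝ) : ℂ) * (𝓕 u : L2) ξ = (𝓕 v : L2) ξ := by
  rw [mem_graph_G0, neg_laplacian_eq_iff]
  constructor
  · intro h
    have hU : LocallyIntegrable (fun ξ => (𝓕 u : L2) ξ) (volume : Measure R3) :=
      (Lp.memLp _).locallyIntegrable (by norm_num)
    have hV : LocallyIntegrable (fun ξ => (𝓕 v : L2) ξ) (volume : Measure R3) :=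
      (Lp.memLp _).locallyIntegrable (by norm_num)
    have hc : Continuous fun ξ : R3 => (((2 * Real.pi * ‖ξ‖) ^ 2 : ℝ) : ℂ) := by fun_prop
    have hU' : LocallyIntegrable
        (fun ξ => (((2 * Real.pi * ‖ξ‖) ^ 2 : ℝ) : ℂ) * (𝓕 u : L2) ξ) (volume : Measure R3) :=
      hU.continuous_mul hc
    have hz := ae_eq_zero_of_integral_contDiff_smul_eq_zero (hU'.sub hV) (fun g hg hgc => by
      have hg₁ : HasCompactSupport (Complex.ofRealCLM ∘ g) := hgc.comp_left rfl
      have hg₂ : ContDiff ℝ ∞ (Complex.ofRealCLM ∘ g) := by fun_prop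
      have h3 := h (hg₁.toSchwartzMap hg₂)
      have hi₁ := hU'.integrable_smul_left_of_hasCompactSupport hg.continuous hgc
      have hi₂ := hV.integrable_smul_left_of_hasCompactSupport hg.continuous hgc
      simp only [Pi.sub_apply, smul_sub]
      rw [integral_sub hi₁ hi₂, sub_eq_zero]
      simpa using h3)
    filter_upwards [hz] with ξ hξ
    exact sub_eq_zero.1 hξ
  · intro h ψ
    refine integral_congr_ae ?_
    filter_upwards [h] with ξ hξ
    simp only [hξ]

/-! ### Fourier transforms of convolutions -/

/-- The Fourier transform of a kernel. -/
def symbol (K : R3 → ℂ) (ξ : R3) : ℂ := ∫ z, K z * phase z ξ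

theorem continuous_symbol {K : R3 → ℂ} (hK : Integrable K) : Continuous (symbol K) := by
  refine continuous_of_dominated (bound := fun z => ‖K z‖) (fun ξ => ?_) (fun ξ => ?_) hK.norm ?_
  · exact hK.aestronglyMeasurable.mul
      (continuous_phase.comp (Continuous.prodMk_left ξ)).aestronglyMeasurable
  · exact Filter.Eventually.of_forall fun z => by rw [norm_mul, norm_phase, mul_one]
  · exact Filter.Eventually.of_forall fun z =>
      continuous_const.mul (continuous_phase.comp (Continuous.prodMk_right z))

theorem norm_symbol_le (K : R3 → ℂ) (ξ : R3) : ‖symbol K ξ‖ ≤ ∫ z, ‖K z‖ := by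
  refine (norm_integral_le_integral_norm _).trans_eq ?_
  simp only [norm_mul, norm_phase, mul_one]

theorem fourier_convOp {K : R3 → ℂ} (hK : Integrable K) (f : L2) :
    ∀ᵐ ξ, (𝓕 (convOp K hK f) : L2) ξ = symbol K ξ * (𝓕 f : L2) ξ := by
  let M := mulOp (symbol K) (continuous_symbol hK).measurable _ (norm_symbol_le K)
  have hM : ∀ᵐ ξ, M (𝓕 f : L2) ξ = symbol K ξ * (𝓕 f : L2) ξ := mulOp_ae _ _ _ _ _
  have h : (𝓕 (convOp K hK f) : L2) = M (𝓕 f : L2) := by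
    refine ext_inner_left ℂ fun g => ?_
    have hg : g = 𝓕 (𝓕⁻ g : L2) := (FourierTransform.fourier_fourierInv_eq g).symm
    rw [hg, Lp.inner_fourier_eq, inner_convOp_eq_integral_pairing, L2.inner_def]
    refine integral_congr_ae ?_
    filter_upwards [hM] with ξ hξ
    rw [hξ]
    simp only [pairing, RCLike.inner_apply, symbol]
    ring
  rw [h]
  exact hM

/-- On the Fourier side the symbol is the reciprocal of `(2π|ξ|)² - ζ`. This puts the range of the
convolution in the maximal domain and gives one inverse identity; the other follows from injectivity
of the Fourier transform. -/
theorem isResolventAt_convOp {K : R3 → ℂ} (hK : Integrable K) {ζ : ℂ}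
    (h : ∀ ξ, ((((2 * Real.pi * ‖ξ‖) ^ 2 : ℝ) : ℂ) - ζ) * symbol K ξ = 1) :
    IsResolventAt G0 ζ (convOp K hK) := by
  have hadd : ∀ (a b : L2) , ∀ᵐ ξ, (𝓕 (a + b) : L2) ξ = (𝓕 a : L2) ξ + (𝓕 b : L2) ξ := by
    intro a b
    rw [FourierTransform.fourier_add]
    exact Lp.coeFn_add _ _
  have hsmul : ∀ (c : ℂ) (a : L2), ∀ᵐ ξ, (𝓕 (c • a) : L2) ξ = c * (𝓕 a : L2) ξ := by
    intro c a
    rw [FourierTransform.fourier_smul]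
    exact Lp.coeFn_smul _ _
  constructor
  · intro f
    have hmem : (convOp K hK f, f + ζ • convOp K hK f) ∈ G0.graph := by
      rw [mem_graph_G0_iff_fourier]
      filter_upwards [fourier_convOp hK f, hadd f (ζ • convOp K hK f), hsmul ζ (convOp K hK f)]
        with ξ h1 h2 h3
      rw [h2, h3, h1]
      linear_combination (𝓕 f : L2) ξ * h ξ
    have hdom : convOp K hK f ∈ G0.domain := LinearPMap.mem_domain_of_mem_graph hmem
    refine ⟨hdom, ?_⟩
    rw [← (LinearPMap.image_iff hdom).2 hmem, add_sub_cancel_right]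
  · intro u
    have hmem : ((u : L2), G0 u) ∈ G0.graph := G0.mem_graph u
    rw [mem_graph_G0_iff_fourier] at hmem
    set v : L2 := G0 u - ζ • (u : L2) with hv
    have hG : G0 u = v + ζ • (u : L2) := by rw [hv, sub_add_cancel]
    rw [hG] at hmem
    have : (𝓕 (convOp K hK v) : L2) = 𝓕 (u : L2) := by
      refine Lp.ext ?_
      filter_upwards [fourier_convOp hK v, hadd v (ζ • (u : L2)), hsmul ζ (u : L2), hmem]
        with ξ h1 h2 h3 h4
      rw [h2, h3] at h4
      rw [h1]
      linear_combination (𝓕 (u : L2) : L2) ξ * h ξ - symbol K ξ * h4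
    exact (Lp.fourierTransformₗᵢ R3 ℂ).injective this

/-! ### The kernel of the free resolvent and of its derivatives -/

/-- `(iτr)^n e^{(iτ lam - ε) r}`. -/
def freeProfile (n : ℕ) (τ lam ε r : ℝ) : ℂ :=
  (Complex.I * (τ * r : ℝ)) ^ n * Complex.exp ((Complex.I * (τ * lam : ℝ) - ε) * r)

/-- The kernel of the `n`-th derivative of the free resolvent. -/
def freeKernel (n : ℕ) (τ lam ε : ℝ) : R3 → ℂ := radialKernel (freeProfile n τ lam ε)

theorem continuous_freeProfile (n : ℕ) (τ lam ε : ℝ) : Continuous (freeProfile n τ lam ε) := by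
  unfold freeProfile; fun_prop

theorem norm_freeProfile (n : ℕ) {τ : ℝ} (hτ : τ = 1 ∨ τ = -1) (lam ε : ℝ) {r : ℝ} (hr : 0 ≤ r) :
    ‖freeProfile n τ lam ε r‖ = r ^ n * Real.exp (-ε * r) := by
  have h1 : |τ| = 1 := by rcases hτ with rfl | rfl <;> simp
  rw [freeProfile, norm_mul, norm_pow, norm_mul, Complex.norm_I, Complex.norm_real, norm_mul,
    Real.norm_eq_abs, Real.norm_eq_abs, h1, abs_of_nonneg hr, Complex.norm_exp, one_mul, one_mul]
  congr 2
  simp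

theorem integrableOn_pow_mul_exp (n : ℕ) {ε : ℝ} (hε : 0 < ε) :
    IntegrableOn (fun r : ℝ => r ^ n * Real.exp (-ε * r)) (Set.Ioi 0) := by
  have := integrableOn_rpow_mul_exp_neg_mul_rpow (p := 1) (s := n) (b := ε)
    (by have : (0 : ℝ) ≤ n := n.cast_nonneg
        linarith) one_pos hε
  simpa only [Real.rpow_one, Real.rpow_natCast] using this

theorem integrableOn_mul_freeProfile (n : ℕ) {τ : ℝ} (hτ : τ = 1 ∨ τ = -1) (lam : ℝ) {ε : ℝ}
    (hε : 0 < ε) : IntegrableOn (fun r : ℝ => (r : ℂ) * freeProfile n τ lam ε r) (Set.Ioi 0) := by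
  refine (integrableOn_pow_mul_exp (n + 1) hε).mono'
    (Complex.continuous_ofReal.mul (continuous_freeProfile n τ lam ε)).aestronglyMeasurable ?_
  filter_upwards [ae_restrict_mem measurableSet_Ioi] with r hr
  have hr : 0 < r := hr
  rw [norm_mul, norm_freeProfile n hτ lam ε hr.le, Complex.norm_real, Real.norm_of_nonneg hr.le,
    pow_succ']
  exact (mul_assoc _ _ _).ge

theorem integrable_freeKernel (n : ℕ) {τ : ℝ} (hτ : τ = 1 ∨ τ = -1) (lam : ℝ) {ε : ℝ}
    (hε : 0 < ε) : Integrable (freeKernel n τ lam ε) :=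
  integrable_radialKernel (continuous_freeProfile n τ lam ε).measurable
    (integrableOn_mul_freeProfile n hτ lam hε)

/-- Convolution with `freeKernel`. -/
def freeOp (n : ℕ) {τ : ℝ} (hτ : τ = 1 ∨ τ = -1) (lam : ℝ) {ε : ℝ} (hε : 0 < ε) : L2 →L[ℂ] L2 :=
  convOp (freeKernel n τ lam ε) (integrable_freeKernel n hτ lam hε)

theorem hasDerivAt_mul_sinc (ρ r : ℝ) :
    HasDerivAt (fun r => r * Real.sinc (ρ * r)) (Real.cos (ρ * r)) r := by
  rcases eq_or_ne ρ 0 with rfl | hρ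
  · simpa using hasDerivAt_id' r
  have : (fun r => r * Real.sinc (ρ * r)) = fun r => Real.sin (ρ * r) / ρ := by
    funext r
    rcases eq_or_ne r 0 with rfl | hr
    · simp
    · rw [Real.sinc_of_ne_zero (mul_ne_zero hρ hr)]
      field_simp
  rw [this]
  have h := (((hasDerivAt_id r).const_mul ρ).sin).div_const ρ
  refine h.congr_deriv ?_
  simp only [id, mul_one]
  field_simp

theorem mul_mul_sinc (ρ r : ℝ) : ρ * (r * Real.sinc (ρ * r)) = Real.sin (ρ * r) := by
  rcases eq_or_ne (ρ * r) 0 with h | h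
  · rw [← mul_assoc, h]; simp
  · rw [Real.sinc_of_ne_zero h, ← mul_assoc, mul_div_cancel₀ _ h]

theorem abs_mul_sinc_le (ρ r : ℝ) : |r * Real.sinc (ρ * r)| ≤ |r| := by
  rw [abs_mul]
  exact mul_le_of_le_one_right (abs_nonneg _) (Real.abs_sinc_le_one _)

/-- With `S(r) = r sinc(ρr)`, so that `S' = cos(ρr)` and `S'' = -ρ²S`, the function `e^{κr}(κS -
S')` is a primitive of `(κ² + ρ²)e^{κr}S`. It equals `-1` at `0` and decays at infinity. The product
form avoids dividing by `κ² + ρ²` and treats `ρ = 0` as well. -/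
theorem laplace_mul_sinc {κ : ℂ} (hκ : κ.re < 0) (ρ : ℝ) :
    (κ ^ 2 + (ρ : ℂ) ^ 2) * ∫ r in Set.Ioi (0 : ℝ),
      Complex.exp (κ * r) * ((r * Real.sinc (ρ * r) : ℝ) : ℂ) = 1 := by
  let G : ℝ → ℂ := fun r => Complex.exp (κ * r) *
    (κ * ((r * Real.sinc (ρ * r) : ℝ) : ℂ) - ((Real.cos (ρ * r) : ℝ) : ℂ))
  have hexp : ∀ r : ℝ, ‖Complex.exp (κ * r)‖ = Real.exp (-(-κ.re) * r) := fun r => by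
    rw [Complex.norm_exp]; simp
  have hderiv : ∀ r : ℝ, HasDerivAt G ((κ ^ 2 + (ρ : ℂ) ^ 2) *
      (Complex.exp (κ * r) * ((r * Real.sinc (ρ * r) : ℝ) : ℂ))) r := by
    intro r
    have h1 : HasDerivAt (fun r : ℝ => Complex.exp (κ * r)) (Complex.exp (κ * r) * κ) r := by
      have := ((hasDerivAt_id (r : ℂ)).const_mul κ).cexp.comp_ofReal
      simpa using this
    have h2 := (hasDerivAt_mul_sinc ρ r).ofReal_comp
    have h3 : HasDerivAt (fun r => Real.cos (ρ * r)) (-(ρ ^ 2 * (r * Real.sinc (ρ * r)))) r := by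
      refine (((hasDerivAt_id r).const_mul ρ).cos).congr_deriv ?_
      rw [sq, mul_assoc ρ ρ, mul_mul_sinc]
      simp [mul_comm]
    refine (h1.mul ((h2.const_mul κ).sub h3.ofReal_comp)).congr_deriv ?_
    simp only [Pi.sub_apply]
    push_cast
    ring
  have hint : IntegrableOn (fun r : ℝ => Complex.exp (κ * r) *
      ((r * Real.sinc (ρ * r) : ℝ) : ℂ)) (Set.Ioi 0) := by
    refine (integrableOn_pow_mul_exp 1 (neg_pos.2 hκ)).mono' ?_ ?_
    · exact (by fun_prop : Continuous fun r : ℝ => Complex.exp (κ * r) *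
        ((r * Real.sinc (ρ * r) : ℝ) : ℂ)).aestronglyMeasurable
    · filter_upwards [ae_restrict_mem measurableSet_Ioi] with r hr
      have hr : 0 < r := hr
      rw [norm_mul, hexp, Complex.norm_real, Real.norm_eq_abs, pow_one, mul_comm]
      gcongr
      exact (abs_mul_sinc_le ρ r).trans (abs_of_pos hr).le
  have hlim : Filter.Tendsto G Filter.atTop (nhds 0) := by
    have h0 : 0 < -κ.re := neg_pos.2 hκ
    have hb : Filter.Tendsto (fun r : ℝ => ‖κ‖ * (r * Real.exp (-(-κ.re) * r)) +
        Real.exp (-(-κ.re) * r)) Filter.atTop (nhds 0) := by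
      have e0 : Filter.Tendsto (fun r : ℝ => -κ.re * r) Filter.atTop Filter.atTop :=
        Filter.tendsto_id.const_mul_atTop h0
      have e1 := (Real.tendsto_pow_mul_exp_neg_atTop_nhds_zero 1).comp e0
      have e2 := (Real.tendsto_pow_mul_exp_neg_atTop_nhds_zero 0).comp e0
      have e3 := (e1.const_mul (‖κ‖ * (-κ.re)⁻¹)).add e2
      simp only [mul_zero, add_zero] at e3
      refine e3.congr fun r => ?_
      simp only [Function.comp, pow_one, pow_zero, one_mul, neg_mul]
      have : κ.re ≠ 0 := hκ.ne
      field_simp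
    refine squeeze_zero_norm' ?_ hb
    filter_upwards [Filter.eventually_ge_atTop 0] with r hr
    rw [norm_mul, hexp]
    have h1 : ‖κ * ((r * Real.sinc (ρ * r) : ℝ) : ℂ) - ((Real.cos (ρ * r) : ℝ) : ℂ)‖ ≤
        ‖κ‖ * r + 1 := by
      refine (norm_sub_le _ _).trans (add_le_add ?_ ?_)
      · rw [norm_mul, Complex.norm_real, Real.norm_eq_abs]
        gcongr
        exact (abs_mul_sinc_le ρ r).trans (abs_of_nonneg hr).le
      · rw [Complex.norm_real, Real.norm_eq_abs]
        exact Real.abs_cos_le_one _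
    calc _ ≤ Real.exp (-(-κ.re) * r) * (‖κ‖ * r + 1) := by gcongr
      _ = _ := by ring
  have := integral_Ioi_of_hasDerivAt_of_tendsto (a := 0) (hderiv 0).continuousAt.continuousWithinAt
    (fun r _ => hderiv r) (hint.const_mul _) hlim
  rw [integral_const_mul] at this
  rw [this]
  simp [G]

/-- As `τ² = 1`, `κ = iτλ - ε` equals `iτ(λ + iτε)`, so `-κ²` is the square of the spectral
parameter. The decay `Re κ = -ε` selects the same kernel formula for both signs. -/
theorem symbol_freeKernel_zero {τ : ℝ} (hτ : τ = 1 ∨ τ = -1) (lam : ℝ) {ε : ℝ} (hε : 0 < ε)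
    (ξ : R3) : ((((2 * Real.pi * ‖ξ‖) ^ 2 : ℝ) : ℂ) - specParam τ lam ε ^ 2) *
      symbol (freeKernel 0 τ lam ε) ξ = 1 := by
  have h := laplace_mul_sinc (κ := Complex.I * (τ * lam : ℝ) - ε) (by simpa using hε)
    (2 * Real.pi * ‖ξ‖)
  rw [symbol, freeKernel, integral_radialKernel_mul_phase
    (continuous_freeProfile 0 τ lam ε).measurable (integrableOn_mul_freeProfile 0 hτ lam hε)]
  simp only [freeProfile, pow_zero, one_mul]
  rw [← h]
  congr 1
  have h2 : (τ : ℂ) ^ 2 = 1 := by rcases hτ with rfl | rfl <;> simp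
  rw [specParam]
  push_cast
  linear_combination (-(τ : ℂ) ^ 2 * lam ^ 2 - (τ : ℂ) ^ 2 * ε ^ 2) * Complex.I_sq + ((ε : ℂ) ^ 2 + (lam : ℂ) ^ 2) * h2

theorem isResolventAt_freeOp {τ : ℝ} (hτ : τ = 1 ∨ τ = -1) (lam : ℝ) {ε : ℝ} (hε : 0 < ε) :
    IsResolventAt G0 (specParam τ lam ε ^ 2) (freeOp 0 hτ lam hε) :=
  isResolventAt_convOp _ (symbol_freeKernel_zero hτ lam hε)

theorem R0_eq_freeOp {τ : ℝ} (hτ : τ = 1 ∨ τ = -1) (lam : ℝ) {ε : ℝ} (hε : 0 < ε) :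
    R0 τ lam ε = freeOp 0 hτ lam hε :=
  (isResolventAt_freeOp hτ lam hε).resolventAt_eq

/-! ### Differentiation in the spectral parameter -/

theorem norm_exp_I_sub_one_sub_le (x : ℝ) :
    ‖Complex.exp (Complex.I * x) - 1 - Complex.I * x‖ ≤ 3 * x ^ 2 := by
  rcases le_or_gt |x| 1 with h | h
  · have hn : ‖Complex.I * (x : ℂ)‖ = |x| := by simp
    refine (Complex.norm_exp_sub_one_sub_id_le (hn.trans_le h)).trans ?_
    rw [hn, sq_abs]
    nlinarith [sq_nonneg x]
  · have h1 : ‖Complex.exp (Complex.I * x)‖ = 1 := by rw [mul_comm, Complex.norm_exp_ofReal_mul_I]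
    have h2 : ‖Complex.exp (Complex.I * x) - 1 - Complex.I * x‖ ≤ 1 + 1 + |x| := by
      refine (norm_sub_le _ _).trans (add_le_add ((norm_sub_le _ _).trans ?_) ?_)
      · rw [h1, norm_one]
      · simp
    rw [← sq_abs x]
    nlinarith

theorem freeProfile_sub_sub (n : ℕ) (τ lam ε h r : ℝ) :
    freeProfile n τ (lam + h) ε r - freeProfile n τ lam ε r - h * freeProfile (n + 1) τ lam ε r =
      freeProfile n τ lam ε r *
        (Complex.exp (Complex.I * (τ * h * r : ℝ)) - 1 - Complex.I * (τ * h * r : ℝ)) := by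
  have : Complex.exp ((Complex.I * (τ * (lam + h) : ℝ) - ε) * r) =
      Complex.exp ((Complex.I * (τ * lam : ℝ) - ε) * r) * Complex.exp (Complex.I * (τ * h * r : ℝ)) := by
    rw [← Complex.exp_add]
    congr 1
    push_cast
    ring
  simp only [freeProfile]
  rw [this]
  push_cast
  ring

/-- The operator norm is at most the `L¹` norm of the kernel. The second-order Taylor remainder of
`e^{iτhr}` is at most `3(hr)²`, and the factor `e^{-εr}` makes the resulting moment `r^{n+3}`
integrable. -/
theorem hasDerivAt_freeOp (n : ℕ) {τ : ℝ} (hτ : τ = 1 ∨ τ = -1) (lam : ℝ) {ε : ℝ} (hε : 0 < ε) :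
    HasDerivAt (fun t => freeOp n hτ t hε) (freeOp (n + 1) hτ lam hε) lam := by
  rw [hasDerivAt_iff_isLittleO_nhds_zero]
  set C := ∫ r in Set.Ioi (0 : ℝ), r ^ (n + 3) * Real.exp (-ε * r)
  have hbound : ∀ h : ℝ, ‖freeOp n hτ (lam + h) hε - freeOp n hτ lam hε -
      h • freeOp (n + 1) hτ lam hε‖ ≤ 3 * C * ‖h ^ 2‖ := by
    intro h
    have hK₀ := integrable_freeKernel n hτ (lam + h) hε
    have hK₁ := integrable_freeKernel n hτ lam hε
    have hK₂ := integrable_freeKernel (n + 1) hτ lam hε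
    have hK₃ : Integrable fun z => freeKernel n τ (lam + h) ε z - freeKernel n τ lam ε z :=
      hK₀.sub hK₁
    have hsm : h • freeOp (n + 1) hτ lam hε = (h : ℂ) • freeOp (n + 1) hτ lam hε := rfl
    rw [hsm, freeOp, freeOp, freeOp, ← convOp_smul hK₂ (h : ℂ), ← convOp_sub hK₀ hK₁,
      ← convOp_sub hK₃ (hK₂.const_mul (h : ℂ))]
    refine (norm_convOp_le _).trans ?_
    let p : ℝ → ℂ := fun r => freeProfile n τ lam ε r *
      (Complex.exp (Complex.I * (τ * h * r : ℝ)) - 1 - Complex.I * (τ * h * r : ℝ))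
    have hp : Continuous p := (continuous_freeProfile n τ lam ε).mul (by fun_prop)
    have he : ∀ z, freeKernel n τ (lam + h) ε z - freeKernel n τ lam ε z -
        (h : ℂ) * freeKernel (n + 1) τ lam ε z = radialKernel p z := by
      intro z
      simp only [p, ← freeProfile_sub_sub, freeKernel, radialKernel, Complex.real_smul]
      ring
    simp only [he]
    rw [integral_norm_radialKernel hp.measurable]
    have hle : ∀ r ∈ Set.Ioi (0 : ℝ), ‖(r : ℂ) * p r‖ ≤
        (3 * ‖h ^ 2‖) * (r ^ (n + 3) * Real.exp (-ε * r)) := by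
      intro r hr
      have hr : 0 < r := hr
      have hτ2 : τ ^ 2 = 1 := by rcases hτ with rfl | rfl <;> norm_num
      rw [norm_mul, norm_mul, norm_freeProfile n hτ lam ε hr.le, Complex.norm_real,
        Real.norm_of_nonneg hr.le, Real.norm_of_nonneg (sq_nonneg h)]
      calc _ ≤ r * (r ^ n * Real.exp (-ε * r) * (3 * (τ * h * r) ^ 2)) := by
            gcongr
            exact norm_exp_I_sub_one_sub_le _
        _ = τ ^ 2 * ((3 * h ^ 2) * (r ^ (n + 3) * Real.exp (-ε * r))) := by ring
        _ = _ := by rw [hτ2, one_mul]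
    have hI := (integrableOn_pow_mul_exp (n + 3) hε).const_mul (3 * ‖h ^ 2‖)
    refine (setIntegral_mono_on (hI.mono' ?_ ?_) hI measurableSet_Ioi hle).trans_eq ?_
    · exact (Complex.continuous_ofReal.mul hp).norm.aestronglyMeasurable
    · filter_upwards [ae_restrict_mem measurableSet_Ioi] with r hr
      rw [norm_norm]
      exact hle r hr
    · rw [integral_const_mul]
      ring
  refine (Asymptotics.IsBigO.of_bound (3 * C) (Filter.Eventually.of_forall hbound)).trans_isLittleO
    (Asymptotics.isLittleO_pow_id one_lt_two)

theorem iteratedDeriv_freeOp (n : ℕ) {τ : ℝ} (hτ : τ = 1 ∨ τ = -1) {ε : ℝ} (hε : 0 < ε) :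
    iteratedDeriv n (fun t => freeOp 0 hτ t hε) = fun t => freeOp n hτ t hε := by
  induction n with
  | zero => exact iteratedDeriv_zero
  | succ n ih =>
    rw [iteratedDeriv_succ, ih]
    exact funext fun t => (hasDerivAt_freeOp n hτ t hε).deriv

theorem R0deriv_eq_freeOp (n : ℕ) {τ : ℝ} (hτ : τ = 1 ∨ τ = -1) (lam : ℝ) {ε : ℝ} (hε : 0 < ε) :
    R0deriv n τ lam ε = freeOp n hτ lam hε := by
  rw [R0deriv]
  simp only [R0_eq_freeOp hτ _ hε]
  rw [iteratedDeriv_freeOp]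

theorem contDiff_R0 {τ : ℝ} (hτ : τ = 1 ∨ τ = -1) {ε : ℝ} (hε : 0 < ε) :
    ContDiff ℝ ∞ (fun lam : ℝ => R0 τ lam ε) := by
  simp only [R0_eq_freeOp hτ _ hε]
  refine contDiff_of_differentiable_iteratedDeriv fun m _ => ?_
  rw [iteratedDeriv_freeOp]
  exact fun t => (hasDerivAt_freeOp m hτ t hε).differentiableAt

/-! ### Matrix elements of the wave propagator -/

/-- The matrix element `⟪g, sin(r√-Δ)/√-Δ f⟫`. -/
def wave (f g : L2) (r : ℝ) : ℂ :=
  ∫ ξ, pairing f g ξ * ((r * Real.sinc (2 * Real.pi * ‖ξ‖ * r) : ℝ) : ℂ)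

/-- The matrix element `⟪g, cos(r√-Δ) f⟫`. -/
def waveDeriv (f g : L2) (r : ℝ) : ℂ :=
  ∫ ξ, pairing f g ξ * ((Real.cos (2 * Real.pi * ‖ξ‖ * r) : ℝ) : ℂ)

theorem integrable_pairing_mul (f g : L2) {m : R3 → ℝ} (hm : Continuous m) {C : ℝ}
    (hC : ∀ ξ, |m ξ| ≤ C) : Integrable fun ξ => pairing f g ξ * (m ξ : ℂ) :=
  (integrable_pairing f g).mul_bdd (c := C) (Complex.continuous_ofReal.comp hm).aestronglyMeasurable
    (Filter.Eventually.of_forall fun ξ => by rw [Complex.norm_real, Real.norm_eq_abs]; exact hC ξ)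

theorem norm_integral_pairing_mul_le (f g : L2) {m : R3 → ℝ} {C : ℝ} (hC : ∀ ξ, |m ξ| ≤ C) :
    ‖∫ ξ, pairing f g ξ * (m ξ : ℂ)‖ ≤ C * (‖f‖ * ‖g‖) := by
  have hC0 : 0 ≤ C := (abs_nonneg _).trans (hC 0)
  have h1 : ‖∫ ξ, pairing f g ξ * (m ξ : ℂ)‖ ≤ ∫ ξ, C * ‖pairing f g ξ‖ := by
    refine norm_integral_le_of_norm_le ((integrable_pairing f g).norm.const_mul C)
      (Filter.Eventually.of_forall fun ξ => ?_)
    rw [norm_mul, Complex.norm_real, Real.norm_eq_abs, mul_comm]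
    gcongr
    exact hC ξ
  rw [integral_const_mul] at h1
  exact h1.trans (by gcongr; exact integral_norm_pairing_le f g)

theorem norm_wave_le (f g : L2) (r : ℝ) : ‖wave f g r‖ ≤ |r| * (‖f‖ * ‖g‖) :=
  norm_integral_pairing_mul_le f g fun _ => abs_mul_sinc_le _ _

theorem norm_waveDeriv_le (f g : L2) (r : ℝ) : ‖waveDeriv f g r‖ ≤ ‖f‖ * ‖g‖ := by
  have := norm_integral_pairing_mul_le f g
    (m := fun ξ => Real.cos (2 * Real.pi * ‖ξ‖ * r)) fun _ => Real.abs_cos_le_one _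
  rwa [one_mul] at this

theorem continuous_waveDeriv (f g : L2) : Continuous (waveDeriv f g) := by
  refine continuous_of_dominated (bound := fun ξ => ‖pairing f g ξ‖) (fun r => ?_) (fun r => ?_)
    (integrable_pairing f g).norm ?_
  · exact (integrable_pairing_mul f g (m := fun ξ => Real.cos (2 * Real.pi * ‖ξ‖ * r)) (by fun_prop)
      (fun _ => Real.abs_cos_le_one _)).aestronglyMeasurable
  · refine Filter.Eventually.of_forall fun ξ => ?_
    rw [norm_mul, Complex.norm_real, Real.norm_eq_abs]
    exact mul_le_of_le_one_right (norm_nonneg _) (Real.abs_cos_le_one _)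
  · exact Filter.Eventually.of_forall fun ξ => by fun_prop

/-- Differentiation under the integral needs no regularity of `f` or `g`: the derivative of `r
sinc(ρr)` is a cosine, bounded by `1` uniformly in the frequency. -/
theorem hasDerivAt_wave (f g : L2) (r : ℝ) : HasDerivAt (wave f g) (waveDeriv f g r) r := by
  refine (hasDerivAt_integral_of_dominated_loc_of_deriv_le (μ := (volume : Measure R3))
    (F := fun t ξ => pairing f g ξ * ((t * Real.sinc (2 * Real.pi * ‖ξ‖ * t) : ℝ) : ℂ))
    (F' := fun t ξ => pairing f g ξ * ((Real.cos (2 * Real.pi * ‖ξ‖ * t) : ℝ) : ℂ))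
    (bound := fun ξ => ‖pairing f g ξ‖)
    Filter.univ_mem (Filter.Eventually.of_forall fun t => ?_) ?_ ?_ ?_
    (integrable_pairing f g).norm ?_).2
  · exact (integrable_pairing_mul f g (m := fun ξ => t * Real.sinc (2 * Real.pi * ‖ξ‖ * t))
      (by fun_prop) (fun _ => abs_mul_sinc_le _ _)).aestronglyMeasurable
  · exact integrable_pairing_mul f g (m := fun ξ => r * Real.sinc (2 * Real.pi * ‖ξ‖ * r))
      (by fun_prop) (fun _ => abs_mul_sinc_le _ _)
  · exact (integrable_pairing_mul f g (m := fun ξ => Real.cos (2 * Real.pi * ‖ξ‖ * r)) (by fun_prop)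
      (fun _ => Real.abs_cos_le_one _)).aestronglyMeasurable
  · refine Filter.Eventually.of_forall fun ξ t _ => ?_
    rw [norm_mul, Complex.norm_real, Real.norm_eq_abs]
    exact mul_le_of_le_one_right (norm_nonneg _) (Real.abs_cos_le_one _)
  · exact Filter.Eventually.of_forall fun ξ t _ =>
      (hasDerivAt_mul_sinc _ t).ofReal_comp.const_mul _

theorem continuous_wave (f g : L2) : Continuous (wave f g) :=
  continuous_iff_continuousAt.2 fun r => (hasDerivAt_wave f g r).continuousAt

theorem wave_zero (f g : L2) : wave f g 0 = 0 := by simp [wave]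

/-- Superposing the wave propagator against any radial profile `k` gives convolution with
`k(|z|)/(4π|z|)`. This single formula serves both for the resolvent and, with test profiles, for
Huygens' principle. -/
theorem inner_convOp_radialKernel {k : ℝ → ℂ} (hk : Measurable k)
    (hi : IntegrableOn (fun r : ℝ => (r : ℂ) * k r) (Set.Ioi 0)) (f g : L2) :
    (inner ℂ g (convOp (radialKernel k) (integrable_radialKernel hk hi) f) : ℂ) =
      ∫ r in Set.Ioi (0 : ℝ), k r * wave f g r := by
  rw [inner_convOp_eq_integral_pairing]
  simp only [integral_radialKernel_mul_phase hk hi, wave, ← integral_const_mul,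
    ← integral_mul_const]
  rw [integral_integral_swap]
  · refine integral_congr_ae (Filter.Eventually.of_forall fun r => ?_)
    refine integral_congr_ae (Filter.Eventually.of_forall fun ξ => ?_)
    simp only
    ring
  · have h := ((integrable_pairing f g).mul_prod hi).mul_bdd (c := 1)
      (g := fun p : R3 × ℝ => ((Real.sinc (2 * Real.pi * ‖p.1‖ * p.2) : ℝ) : ℂ))
      (by fun_prop : Continuous fun p : R3 × ℝ =>
        ((Real.sinc (2 * Real.pi * ‖p.1‖ * p.2) : ℝ) : ℂ)).aestronglyMeasurable
      (Filter.Eventually.of_forall fun p => by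
        rw [Complex.norm_real, Real.norm_eq_abs]; exact Real.abs_sinc_le_one _)
    refine h.congr (Filter.Eventually.of_forall fun p => ?_)
    simp only [Function.uncurry]
    push_cast
    ring

/-- Huygens' principle. -/
theorem wave_eq_zero_of_notMem {f g : L2} {a b : ℝ}
    (h : ∀ z : R3, ‖z‖ ∉ Set.Icc a b → (inner ℂ g (trans z f) : ℂ) = 0) :
    Set.EqOn (wave f g) 0 (Set.Ioi 0 \ Set.Icc a b) := by
  have hO : IsOpen (Set.Ioi (0 : ℝ) \ Set.Icc a b) := isOpen_Ioi.sdiff isClosed_Icc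
  -- The cut-off at `T` keeps the test profile integrable.
  have hT : ∀ T : ℝ, ∀ᵐ r, r ∈ (Set.Ioo (0 : ℝ) T \ Set.Icc a b) → wave f g r = 0 := by
    intro T
    set S : Set ℝ := Set.Ioo (0 : ℝ) T \ Set.Icc a b with hS
    have hSm : MeasurableSet S := measurableSet_Ioo.diff measurableSet_Icc
    have hSub : S ⊆ Set.Ioi 0 := fun r hr => hr.1.1
    -- Testing with the conjugate of the wave itself turns the spectral side into `∫ |w|²` over `S`.
    -- The spatial side vanishes because the kernel lives where `‖z‖ ∉ [a, b]`. This replaces any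
    -- use of spherical surface measures.
    let k : ℝ → ℂ := S.indicator fun r => starRingEnd ℂ (wave f g r)
    have hc := continuous_wave f g
    have hc' : Continuous fun r => starRingEnd ℂ (wave f g r) := Complex.continuous_conj.comp hc
    have hk : Measurable k := hc'.measurable.indicator hSm
    have hS' : S ⊆ Set.Icc 0 T := fun r hr => ⟨hr.1.1.le, hr.1.2.le⟩
    have hi : IntegrableOn (fun r : ℝ => (r : ℂ) * k r) (Set.Ioi 0) := by
      have h1 : IntegrableOn (fun r : ℝ => (r : ℂ) * starRingEnd ℂ (wave f g r)) S :=
        ((Complex.continuous_ofReal.mul hc').integrableOn_Icc).mono_set hS'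
      have h2 := ((integrable_indicator_iff hSm).2 h1).integrableOn (s := Set.Ioi 0)
      refine h2.congr_fun (fun r _ => ?_) measurableSet_Ioi
      simp only [k, Set.indicator_apply]
      split_ifs <;> simp
    have h1 := inner_convOp_radialKernel hk hi f g
    have h0 : (inner ℂ g (convOp (radialKernel k) (integrable_radialKernel hk hi) f) : ℂ) = 0 := by
      rw [inner_convOp]
      have : ∀ z, radialKernel k z * inner ℂ g (trans z f) = 0 := by
        intro z
        by_cases hz : ‖z‖ ∈ Set.Icc a b
        · have : k ‖z‖ = 0 := Set.indicator_of_notMem (fun h' => h'.2 hz) _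
          rw [radialKernel, this, smul_zero, zero_mul]
        · rw [h z hz, mul_zero]
      simp only [this, integral_zero]
    have h2 : ∀ r, k r * wave f g r = S.indicator (fun r => ((‖wave f g r‖ ^ 2 : ℝ) : ℂ)) r := by
      intro r
      simp only [k, Set.indicator_apply]
      split_ifs
      · rw [mul_comm, Complex.mul_conj, Complex.normSq_eq_norm_sq]
      · rw [zero_mul]
    rw [h0] at h1
    simp only [h2] at h1
    rw [setIntegral_indicator hSm, Set.inter_eq_right.2 hSub, integral_complex_ofReal, eq_comm,
      Complex.ofReal_eq_zero, setIntegral_eq_zero_iff_of_nonneg_ae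
        (Filter.Eventually.of_forall fun r => by positivity)] at h1
    · rw [← ae_restrict_iff' hSm]
      filter_upwards [h1] with r hr
      simpa using hr
    · exact ((hc.norm.pow 2).integrableOn_Icc).mono_set hS'
  refine Measure.eqOn_open_of_ae_eq (μ := (volume : Measure ℝ)) ?_ hO (continuous_wave f g).continuousOn continuousOn_const
  rw [Filter.EventuallyEq, ae_restrict_iff' hO.measurableSet]
  filter_upwards [ae_all_iff.2 fun n : ℕ => hT n] with r hr hrO
  obtain ⟨n, hn⟩ := exists_nat_gt r
  exact hr n ⟨⟨hrO.1, hn⟩, hrO.2⟩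

/-- Together with `wave_right_eq_zero`, this removes the boundary terms of the integration by parts.
At `a = 0` the wave vanishes because it starts from zero; otherwise continuity carries the vanishing
up to the endpoint. -/
theorem wave_left_eq_zero {f g : L2} {a b : ℝ} (ha : 0 ≤ a)
    (h : ∀ z : R3, ‖z‖ ∉ Set.Icc a b → (inner ℂ g (trans z f) : ℂ) = 0) : wave f g a = 0 := by
  rcases ha.eq_or_lt with rfl | ha
  · exact wave_zero f g
  have h0 : Set.EqOn (wave f g) 0 (Set.Ioo 0 a) := fun r hr =>
    wave_eq_zero_of_notMem h ⟨hr.1, fun h' => absurd h'.1 (not_le.2 hr.2)⟩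
  refine h0.closure (continuous_wave f g) continuous_const ?_
  rw [closure_Ioo ha.ne]
  exact ⟨ha.le, le_rfl⟩

theorem wave_right_eq_zero {f g : L2} {a b : ℝ} (hb : 0 ≤ b)
    (h : ∀ z : R3, ‖z‖ ∉ Set.Icc a b → (inner ℂ g (trans z f) : ℂ) = 0) : wave f g b = 0 := by
  have h0 : Set.EqOn (wave f g) 0 (Set.Ioi b) := fun r hr =>
    wave_eq_zero_of_notMem h ⟨hb.trans_lt hr, fun h' => absurd h'.2 (not_le.2 hr)⟩
  refine h0.closure (continuous_wave f g) continuous_const ?_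
  rw [closure_Ioi]
  exact Set.self_mem_Ici

theorem inner_freeOp_eq (n : ℕ) {τ : ℝ} (hτ : τ = 1 ∨ τ = -1) (lam : ℝ) {ε : ℝ} (hε : 0 < ε)
    {f g : L2} {a b : ℝ} (ha : 0 ≤ a) (hab : a ≤ b)
    (h : ∀ z : R3, ‖z‖ ∉ Set.Icc a b → (inner ℂ g (trans z f) : ℂ) = 0) :
    (inner ℂ g (freeOp n hτ lam hε f) : ℂ) = ∫ r in a..b, freeProfile n τ lam ε r * wave f g r := by
  have h1 := inner_convOp_radialKernel (continuous_freeProfile n τ lam ε).measurable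
    (integrableOn_mul_freeProfile n hτ lam hε) f g
  refine h1.trans ?_
  rw [intervalIntegral.integral_of_le hab]
  refine (setIntegral_eq_of_subset_of_forall_sdiff_eq_zero measurableSet_Ioi
    (fun r hr => ha.trans_lt hr.1) fun r hr => ?_)
  by_cases hra : r = a
  · rw [hra, wave_left_eq_zero ha h, mul_zero]
  · rw [wave_eq_zero_of_notMem h ⟨hr.1, fun h' => hr.2 ⟨lt_of_le_of_ne h'.1 (Ne.symm hra), h'.2⟩⟩]
    exact mul_zero _

/-- One integration by parts against `e^{κr}`, where `|κ| ≥ λ`. The boundary terms vanish by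
Huygens' principle, and the derivative of `(iτr)^n w` is controlled by `‖f‖‖g‖` alone. -/
theorem norm_inner_freeOp_le_integral (n : ℕ) {τ : ℝ} (hτ : τ = 1 ∨ τ = -1) {lam : ℝ}
    (hlam : 0 < lam) {ε : ℝ} (hε : 0 < ε) {f g : L2} {a b : ℝ} (ha : 0 ≤ a) (hab : a ≤ b)
    (h : ∀ z : R3, ‖z‖ ∉ Set.Icc a b → (inner ℂ g (trans z f) : ℂ) = 0) :
    lam * ‖(inner ℂ g (freeOp n hτ lam hε f) : ℂ)‖ ≤
      (n + 1) * (‖f‖ * ‖g‖) * ∫ r in a..b, r ^ n * Real.exp (-ε * r) := by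
  set κ : ℂ := Complex.I * (τ * lam : ℝ) - ε with hκ
  have hκn : lam ≤ ‖κ‖ := by
    refine le_trans ?_ (Complex.abs_im_le_norm κ)
    have : κ.im = τ * lam := by simp [hκ]
    rw [this, abs_mul, abs_of_pos hlam]
    rcases hτ with rfl | rfl <;> simp
  let p : ℝ → ℂ := fun r => (Complex.I * (τ * r : ℝ)) ^ n * wave f g r
  let p' : ℝ → ℂ := fun r => n * (Complex.I * (τ * r : ℝ)) ^ (n - 1) * (Complex.I * τ) * wave f g r +
    (Complex.I * (τ * r : ℝ)) ^ n * waveDeriv f g r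
  have hp : ∀ r, HasDerivAt p (p' r) r := by
    intro r
    have h1 : HasDerivAt (fun r : ℝ => Complex.I * ((τ * r : ℝ) : ℂ)) (Complex.I * τ) r := by
      have := (((hasDerivAt_id' r).const_mul τ).ofReal_comp).const_mul Complex.I
      simpa using this
    exact (h1.pow n).mul (hasDerivAt_wave f g r)
  have he : ∀ r : ℝ, HasDerivAt (fun r : ℝ => Complex.exp (κ * r)) (κ * Complex.exp (κ * r)) r := by
    intro r
    have := ((hasDerivAt_id (r : ℂ)).const_mul κ).cexp.comp_ofReal
    simpa [mul_comm] using this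
  have hcw := continuous_wave f g
  have hcw' := continuous_waveDeriv f g
  have hp'c : Continuous p' := by fun_prop
  have hpa : p a = 0 := by simp only [p, wave_left_eq_zero ha h, mul_zero]
  have hpb : p b = 0 := by simp only [p, wave_right_eq_zero (ha.trans hab) h, mul_zero]
  have hparts := intervalIntegral.integral_mul_deriv_eq_deriv_mul (a := a) (b := b)
    (fun r _ => hp r) (fun r _ => he r) (hp'c.intervalIntegrable _ _)
    ((by fun_prop : Continuous fun r : ℝ => κ * Complex.exp (κ * r)).intervalIntegrable _ _)
  rw [hpa, hpb, zero_mul, zero_mul, sub_zero, zero_sub] at hparts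
  have hprod : κ * (inner ℂ g (freeOp n hτ lam hε f) : ℂ) =
      ∫ r in a..b, p r * (κ * Complex.exp (κ * r)) := by
    rw [inner_freeOp_eq n hτ lam hε ha hab h, ← intervalIntegral.integral_const_mul]
    refine intervalIntegral.integral_congr fun r _ => ?_
    simp only [freeProfile, p, hκ]
    ring
  have hnorm : ‖κ‖ * ‖(inner ℂ g (freeOp n hτ lam hε f) : ℂ)‖ ≤
      (n + 1) * (‖f‖ * ‖g‖) * ∫ r in a..b, r ^ n * Real.exp (-ε * r) := by
    rw [← norm_mul, hprod, hparts, norm_neg, ← intervalIntegral.integral_const_mul]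
    refine intervalIntegral.norm_integral_le_of_norm_le hab
      (Filter.Eventually.of_forall fun r hr => ?_)
      ((by fun_prop : Continuous fun r : ℝ =>
        (n + 1) * (‖f‖ * ‖g‖) * (r ^ n * Real.exp (-ε * r))).intervalIntegrable _ _)
    have hr0 : 0 < r := ha.trans_lt hr.1
    have hexp : ‖Complex.exp (κ * r)‖ = Real.exp (-ε * r) := by
      rw [Complex.norm_exp]; simp [hκ]
    have hIτ : ‖Complex.I * (τ : ℂ)‖ = 1 := by
      rcases hτ with rfl | rfl <;> simp
    have hIτr : ‖Complex.I * ((τ * r : ℝ) : ℂ)‖ = r := by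
      rw [Complex.ofReal_mul, ← mul_assoc, norm_mul, hIτ, one_mul, Complex.norm_real,
        Real.norm_of_nonneg hr0.le]
    have h1 : ‖p' r‖ ≤ (n + 1) * (‖f‖ * ‖g‖) * r ^ n := by
      refine (norm_add_le _ _).trans ?_
      have e1 : ‖(n : ℂ) * (Complex.I * (τ * r : ℝ)) ^ (n - 1) * (Complex.I * τ) * wave f g r‖ =
          n * r ^ (n - 1) * 1 * ‖wave f g r‖ := by
        rw [norm_mul, norm_mul, norm_mul, norm_pow, hIτ, hIτr, Complex.norm_natCast]
      have e2 : ‖(Complex.I * (τ * r : ℝ)) ^ n * waveDeriv f g r‖ = r ^ n * ‖waveDeriv f g r‖ := by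
        rw [norm_mul, norm_pow, hIτr]
      rw [e1, e2]
      have hw := norm_wave_le f g r
      rw [abs_of_pos hr0] at hw
      -- The derivative of `r^n` contributes `n`, after `|w| ≤ r‖f‖‖g‖` restores the lost power; the
      -- derivative of `w` contributes `1`.
      calc (n : ℝ) * r ^ (n - 1) * 1 * ‖wave f g r‖ + r ^ n * ‖waveDeriv f g r‖
          ≤ n * r ^ (n - 1) * 1 * (r * (‖f‖ * ‖g‖)) + r ^ n * (‖f‖ * ‖g‖) := by
            gcongr
            exact norm_waveDeriv_le f g r
        _ = (n * (r ^ (n - 1) * r) + r ^ n) * (‖f‖ * ‖g‖) := by ring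
        _ = (n + 1) * (‖f‖ * ‖g‖) * r ^ n := by
            rcases n with _ | n
            · simp
            · rw [Nat.add_sub_cancel, ← pow_succ]; ring
    rw [norm_mul, hexp, ← mul_assoc]
    gcongr
  exact (mul_le_mul_of_nonneg_right hκn (norm_nonneg _)).trans hnorm

/-- Here `e^{-εr} ≤ (εr)^{-θ}`, and `b^{1-θ} - a^{1-θ} ≤ (b-a)b^{-θ}` since `t^{-θ}` decreases. The
length `b - a` is retained and the power falls on the larger radius; `θ < 1` makes `r^{-θ}`
integrable at `0`. -/
theorem integral_pow_mul_exp_le (n : ℕ) {θ : ℝ} (hθ₀ : 0 ≤ θ) (hθ₁ : θ < 1) {ε : ℝ} (hε : 0 < ε)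
    {a b : ℝ} (ha : 0 ≤ a) (hab : a ≤ b) (hb : 0 < b) :
    ∫ r in a..b, r ^ n * Real.exp (-ε * r) ≤
      (1 - θ)⁻¹ * ε ^ (-θ) * ((b - a) * b ^ ((n : ℝ) - θ)) := by
  have hexp : ∀ t : ℝ, 0 < t → Real.exp (-t) ≤ t ^ (-θ) := by
    intro t ht
    rw [Real.exp_neg, Real.rpow_neg ht.le]
    refine inv_anti₀ (Real.rpow_pos_of_pos ht _) ?_
    rcases le_or_gt t 1 with h | h
    · exact (Real.rpow_le_one ht.le h hθ₀).trans (Real.one_le_exp ht.le)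
    · calc t ^ θ ≤ t ^ (1 : ℝ) := Real.rpow_le_rpow_of_exponent_le h.le hθ₁.le
        _ = t := Real.rpow_one t
        _ ≤ Real.exp t := by linarith [Real.add_one_le_exp t]
  have hint : IntervalIntegrable (fun r : ℝ => b ^ n * ε ^ (-θ) * r ^ (-θ)) volume a b :=
    (intervalIntegral.intervalIntegrable_rpow' (by linarith)).const_mul _
  have h1 : ∫ r in a..b, r ^ n * Real.exp (-ε * r) ≤
      ∫ r in a..b, b ^ n * ε ^ (-θ) * r ^ (-θ) := by
    refine intervalIntegral.integral_mono_on_of_le_Ioo hab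
      ((by fun_prop : Continuous fun r : ℝ => r ^ n * Real.exp (-ε * r)).intervalIntegrable _ _)
      hint fun r hr => ?_
    have hr0 : 0 < r := ha.trans_lt hr.1
    have h2 := hexp (ε * r) (mul_pos hε hr0)
    rw [Real.mul_rpow hε.le hr0.le, ← neg_mul] at h2
    rw [mul_assoc]
    have hrb : r ≤ b := hr.2.le
    gcongr
  refine h1.trans ?_
  rw [intervalIntegral.integral_const_mul, integral_rpow (Or.inl (by linarith)),
    Real.rpow_sub hb, Real.rpow_natCast]
  have h3 : b ^ (-θ + 1) - a ^ (-θ + 1) ≤ (b - a) * b ^ (-θ) := by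
    rw [Real.rpow_add hb, Real.rpow_one]
    rcases ha.eq_or_lt with rfl | ha
    · rw [Real.zero_rpow (by linarith)]
      linarith [mul_comm b (b ^ (-θ))]
    · rw [Real.rpow_add ha, Real.rpow_one]
      have : b ^ (-θ) ≤ a ^ (-θ) := Real.rpow_le_rpow_of_nonpos ha hab (by linarith)
      nlinarith
  have hθ : 0 < 1 - θ := by linarith
  have e : -θ + 1 = 1 - θ := by ring
  calc b ^ n * ε ^ (-θ) * ((b ^ (-θ + 1) - a ^ (-θ + 1)) / (-θ + 1))
      ≤ b ^ n * ε ^ (-θ) * (((b - a) * b ^ (-θ)) / (1 - θ)) := by rw [← e]; gcongr; linarith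
    _ = _ := by
      rw [Real.rpow_neg hb.le]
      field_simp

theorem norm_inner_freeOp_le (n : ℕ) {θ : ℝ} (hθ₀ : 0 ≤ θ) (hθ₁ : θ < 1) {τ : ℝ}
    (hτ : τ = 1 ∨ τ = -1) {lam : ℝ} (hlam : 0 < lam) {ε : ℝ} (hε : 0 < ε) {f g : L2} {a b : ℝ}
    (ha : 0 ≤ a) (hab : a ≤ b) (hb : 0 < b)
    (h : ∀ z : R3, ‖z‖ ∉ Set.Icc a b → (inner ℂ g (trans z f) : ℂ) = 0) :
    ‖(inner ℂ g (freeOp n hτ lam hε f) : ℂ)‖ ≤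
      ((n + 1) * (1 - θ)⁻¹ * lam⁻¹ * ε ^ (-θ)) * ((b - a) * b ^ ((n : ℝ) - θ)) * (‖f‖ * ‖g‖) := by
  have h1 := norm_inner_freeOp_le_integral n hτ hlam hε ha hab h
  have h2 := integral_pow_mul_exp_le n hθ₀ hθ₁ hε ha hab hb
  have h3 : lam * ‖(inner ℂ g (freeOp n hτ lam hε f) : ℂ)‖ ≤ (n + 1) * (‖f‖ * ‖g‖) *
      ((1 - θ)⁻¹ * ε ^ (-θ) * ((b - a) * b ^ ((n : ℝ) - θ))) := h1.trans (by gcongr)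
  rw [← le_div_iff₀' hlam] at h3
  refine h3.trans_eq ?_
  rw [div_eq_mul_inv]
  ring

theorem inner_trans_eq_zero {f g : L2} {A B : Set R3} {a b : ℝ} (hf : ∀ᵐ x, x ∉ A → f x = 0)
    (hg : ∀ᵐ x, x ∉ B → g x = 0) (hAB : ∀ y ∈ A, ∀ x ∈ B, ‖x - y‖ ∈ Set.Icc a b) (z : R3)
    (hz : ‖z‖ ∉ Set.Icc a b) : (inner ℂ g (trans z f) : ℂ) = 0 := by
  rw [L2.inner_def]
  refine integral_eq_zero_of_ae ?_
  have hf' := (measurePreserving_sub_right volume z).quasiMeasurePreserving.ae hf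
  filter_upwards [trans_ae z f, hf', hg] with x h1 h2 h3
  by_cases hx : x ∈ B
  · have : x - z ∉ A := fun h' => hz (by simpa using hAB _ h' x hx)
    rw [h1, h2 this, inner_zero_right]
    rfl
  · rw [h3 hx, inner_zero_left]
    rfl

/-! ### Spatial cut-offs -/

theorem continuous_bracket : Continuous bracket := by unfold bracket; fun_prop

theorem one_le_bracket (x : R3) : 1 ≤ bracket x := by
  rw [bracket, Real.one_le_sqrt]
  nlinarith [sq_nonneg ‖x‖]

theorem bracket_pos (x : R3) : 0 < bracket x := one_pos.trans_le (one_le_bracket x)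

theorem norm_le_bracket (x : R3) : ‖x‖ ≤ bracket x :=
  Real.le_sqrt_of_sq_le (by linarith)

theorem bracket_le_one_add_norm (x : R3) : bracket x ≤ 1 + ‖x‖ := by
  rw [bracket, Real.sqrt_le_iff]
  constructor <;> nlinarith [norm_nonneg x]

theorem measurable_bracket_rpow (p : ℝ) : Measurable fun x : R3 => bracket x ^ p :=
  continuous_bracket.measurable.pow_const p

/-- Restriction of a square integrable function to a measurable set. -/
def cut (A : Set R3) (hA : MeasurableSet A) : L2 →L[ℂ] L2 :=
  mulOp (A.indicator 1) (measurable_one.indicator hA) 1 fun x => by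
    by_cases hx : x ∈ A <;> simp [hx]

theorem cut_ae (A : Set R3) (hA : MeasurableSet A) (f : L2) :
    ∀ᵐ x, cut A hA f x = A.indicator f x := by
  filter_upwards [mulOp_ae (A.indicator 1) (measurable_one.indicator hA) 1 (fun x => by
    by_cases hx : x ∈ A <;> simp [hx]) f] with x hx
  rw [cut, hx]
  by_cases h : x ∈ A <;> simp [h]

theorem cut_eq_zero_of_notMem (A : Set R3) (hA : MeasurableSet A) (f : L2) :
    ∀ᵐ x, x ∉ A → cut A hA f x = 0 := by
  filter_upwards [cut_ae A hA f] with x hx h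
  rw [hx, Set.indicator_of_notMem h]

theorem L2_norm_sq (f : L2) : ‖f‖ ^ 2 = ∫ x, ‖f x‖ ^ 2 := by
  rw [← inner_self_eq_norm_sq (𝕜 := ℂ), L2.inner_def, ← integral_re (L2.integrable_inner f f)]
  simp only [inner_self_eq_norm_sq]

theorem L2_integrable_norm_sq (f : L2) : Integrable fun x => ‖f x‖ ^ 2 :=
  (Lp.memLp f).integrable_norm_pow (by norm_num)

theorem norm_cut_sq (A : Set R3) (hA : MeasurableSet A) (f : L2) :
    ‖cut A hA f‖ ^ 2 = ∫ x in A, ‖f x‖ ^ 2 := by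
  rw [L2_norm_sq, ← integral_indicator hA]
  refine integral_congr_ae ?_
  filter_upwards [cut_ae A hA f] with x hx
  rw [hx]
  by_cases h : x ∈ A <;> simp [h]

theorem norm_cut_le (A : Set R3) (hA : MeasurableSet A) (f : L2) : ‖cut A hA f‖ ≤ ‖f‖ := by
  refine (sq_le_sq₀ (norm_nonneg _) (norm_nonneg _)).1 ?_
  rw [norm_cut_sq, L2_norm_sq]
  exact setIntegral_le_integral (L2_integrable_norm_sq f)
    (Filter.Eventually.of_forall fun x => sq_nonneg _)

theorem cut_eq_add {A B C : Set R3} (hA : MeasurableSet A) (hB : MeasurableSet B)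
    (hC : MeasurableSet C) (hAB : Disjoint A B) (h : A ∪ B = C) (f : L2) :
    cut C hC f = cut A hA f + cut B hB f := by
  refine Lp.ext ?_
  filter_upwards [cut_ae A hA f, cut_ae B hB f, cut_ae C hC f,
    Lp.coeFn_add (cut A hA f) (cut B hB f)] with x h1 h2 h3 h4
  rw [h4, Pi.add_apply, h1, h2, h3, ← h, Set.indicator_union_of_disjoint hAB]

theorem norm_cut_le_of_weight {A : Set R3} (hA : MeasurableSet A) {w : R3 → ℝ} {c : ℝ}
    (hc : ∀ x ∈ A, |w x| ≤ c) {f F : L2} (hf : ∀ᵐ x, f x = (w x : ℂ) * F x) :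
    ‖cut A hA f‖ ≤ c * ‖cut A hA F‖ := by
  refine Lp.norm_le_mul_norm_of_ae_le_mul ?_
  filter_upwards [cut_ae A hA f, cut_ae A hA F, hf] with x h1 h2 h3
  rw [h1, h2]
  by_cases h : x ∈ A
  · rw [Set.indicator_of_mem h, Set.indicator_of_mem h, h3, norm_mul, Complex.norm_real]
    exact mul_le_mul_of_nonneg_right (hc x h) (norm_nonneg _)
  · simp [h]

/-- The shell `r ≤ ⟨x⟩ < R`. -/
def shell (r R : ℝ) : Set R3 := {x | r ≤ bracket x ∧ bracket x < R}

/-- The exterior region `r ≤ ⟨x⟩`. -/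
def exterior (r : ℝ) : Set R3 := {x | r ≤ bracket x}

theorem measurableSet_shell (r R : ℝ) : MeasurableSet (shell r R) :=
  (measurableSet_le measurable_const continuous_bracket.measurable).inter
    (measurableSet_lt continuous_bracket.measurable measurable_const)

theorem measurableSet_exterior (r : ℝ) : MeasurableSet (exterior r) :=
  measurableSet_le measurable_const continuous_bracket.measurable

/-- Restriction to a shell. -/
def cutShell (r R : ℝ) : L2 →L[ℂ] L2 := cut (shell r R) (measurableSet_shell r R)

/-- Restriction to an exterior region. -/
def cutExterior (r : ℝ) : L2 →L[ℂ] L2 := cut (exterior r) (measurableSet_exterior r)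

theorem cutExterior_eq_add {r R : ℝ} (h : r ≤ R) (f : L2) :
    cutExterior r f = cutShell r R f + cutExterior R f := by
  refine cut_eq_add _ _ _ ?_ ?_ f
  · rw [Set.disjoint_left]
    rintro x ⟨_, h1⟩ h2
    exact absurd h2 (not_le.2 h1)
  · ext x
    constructor
    · rintro (h1 | h1)
      · exact h1.1
      · exact h.trans h1
    · intro h1
      rcases lt_or_ge (bracket x) R with h2 | h2
      · exact Or.inl ⟨h1, h2⟩
      · exact Or.inr h2

theorem cutExterior_one (f : L2) : cutExterior 1 f = f := by
  refine Lp.ext ?_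
  filter_upwards [cut_ae (exterior 1) (measurableSet_exterior 1) f] with x hx
  rw [cutExterior, hx, Set.indicator_of_mem (show x ∈ exterior 1 from one_le_bracket x)]

theorem tendsto_norm_cutExterior {r : ℕ → ℝ} (hr : Monotone r)
    (hr' : Filter.Tendsto r Filter.atTop Filter.atTop) (f : L2) :
    Filter.Tendsto (fun n => ‖cutExterior (r n) f‖) Filter.atTop (nhds 0) := by
  have h1 : Filter.Tendsto (fun n => ∫ x in exterior (r n), ‖f x‖ ^ 2) Filter.atTop
      (nhds (∫ x in ⋂ n, exterior (r n), ‖f x‖ ^ 2)) :=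
    tendsto_setIntegral_of_antitone (fun n => measurableSet_exterior _)
      (fun m n hmn x hx => (hr hmn).trans hx) ⟨0, (L2_integrable_norm_sq f).integrableOn⟩
  have h2 : ⋂ n, exterior (r n) = ∅ := by
    rw [Set.eq_empty_iff_forall_notMem]
    intro x hx
    obtain ⟨n, hn⟩ := (hr'.eventually_gt_atTop (bracket x)).exists
    exact absurd (Set.mem_iInter.1 hx n) (not_le.2 hn)
  rw [h2, Measure.restrict_empty, integral_zero_measure] at h1
  have h3 := h1.sqrt
  rw [Real.sqrt_zero] at h3
  refine h3.congr fun n => ?_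
  rw [← norm_cut_sq _ (measurableSet_exterior _), Real.sqrt_sq (norm_nonneg _)]
  rfl

theorem sum_norm_cutShell_sq_le {r : ℕ → ℝ} (hr : Monotone r) (N : ℕ) (f : L2) :
    ∑ m ∈ Finset.range N, ‖cutShell (r m) (r (m + 1)) f‖ ^ 2 ≤ ‖f‖ ^ 2 := by
  simp only [cutShell, norm_cut_sq]
  rw [← integral_biUnion_finset _ (fun m _ => measurableSet_shell _ _) ?_
    (fun m _ => (L2_integrable_norm_sq f).integrableOn), L2_norm_sq]
  · exact setIntegral_le_integral (L2_integrable_norm_sq f)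
      (Filter.Eventually.of_forall fun x => sq_nonneg _)
  · intro i _ j _ hij
    rw [Function.onFun, Set.disjoint_left]
    rintro x ⟨h1, h2⟩ ⟨h3, h4⟩
    rcases lt_or_gt_of_ne hij with h | h
    · exact absurd ((hr (Nat.succ_le_of_lt h)).trans h3) (not_le.2 h2)
    · exact absurd ((hr (Nat.succ_le_of_lt h)).trans h1) (not_le.2 h4)

theorem cutExterior_eq_sum {r : ℕ → ℝ} (hr : Monotone r) (N : ℕ) (f : L2) :
    cutExterior (r 0) f =
      ∑ m ∈ Finset.range N, cutShell (r m) (r (m + 1)) f + cutExterior (r N) f := by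
  induction N with
  | zero => simp
  | succ N ih =>
    rw [ih, Finset.sum_range_succ, add_assoc, ← cutExterior_eq_add (hr N.le_succ)]

/-! ### Weighted bounds from bounds between separated sets -/

/-- If `f` and `g` are supported in sets whose mutual distances lie in `[a, b]`, then
`|⟪g, T f⟫| ≤ M (b - a) b^q ‖f‖ ‖g‖`. -/
def ShellBound (T : L2 →L[ℂ] L2) (M q : ℝ) : Prop :=
  ∀ (f g : L2) (A B : Set R3) (a b : ℝ), 0 ≤ a → a ≤ b → 0 < b →
    (∀ᵐ x, x ∉ A → f x = 0) → (∀ᵐ x, x ∉ B → g x = 0) →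
    (∀ y ∈ A, ∀ x ∈ B, ‖x - y‖ ∈ Set.Icc a b) →
    ‖(inner ℂ g (T f) : ℂ)‖ ≤ M * ((b - a) * b ^ q) * (‖f‖ * ‖g‖)

theorem ShellBound.adjoint {T : L2 →L[ℂ] L2} {M q : ℝ} (h : ShellBound T M q) :
    ShellBound (ContinuousLinearMap.adjoint T) M q := by
  intro f g A B a b ha hab hb hf hg hAB
  have h1 := h g f B A a b ha hab hb hg hf fun y hy x hx => by
    rw [norm_sub_rev]; exact hAB x hx y hy
  rwa [ContinuousLinearMap.adjoint_inner_right, ← inner_conj_symm, RCLike.norm_conj,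
    mul_comm ‖f‖]

theorem rpow_le_of_comparable {t y c : ℝ} (p : ℝ) (ht : 0 < t) (hty : t ≤ y) (hyc : y ≤ c * t) :
    y ^ p ≤ c ^ |p| * t ^ p := by
  have hc : 1 ≤ c := by
    by_contra h
    nlinarith [not_le.1 h]
  rcases le_or_gt 0 p with hp | hp
  · rw [abs_of_nonneg hp, ← Real.mul_rpow (by linarith) ht.le]
    exact Real.rpow_le_rpow (by linarith) hyc hp
  · calc y ^ p ≤ t ^ p := Real.rpow_le_rpow_of_nonpos ht hty hp.le
      _ ≤ c ^ |p| * t ^ p := le_mul_of_one_le_left (by positivity)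
          (Real.one_le_rpow hc (abs_nonneg _))

theorem norm_cutShell_le {p r : ℝ} (hr : 0 < r) {R : ℝ} (hR : R ≤ 2 * r) {f F : L2}
    (hf : ∀ᵐ x, f x = ((bracket x ^ (-p) : ℝ) : ℂ) * F x) :
    ‖cutShell r R f‖ ≤ 2 ^ |p| * r ^ (-p) * ‖cutShell r R F‖ := by
  refine norm_cut_le_of_weight _ (fun x hx => ?_) hf
  rw [abs_of_nonneg (Real.rpow_nonneg (bracket_pos x).le _), ← abs_neg p]
  exact rpow_le_of_comparable (-p) hr hx.1 (hx.2.le.trans hR)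

/-- Since `⟨x⟩ - 1 ≤ |x| ≤ ⟨x⟩` and `s ≥ 1`, the distances lie between `max(m-2, 0)s` and `(m+4)s`.
Thus `b - a ≤ 6s` for every `m`, while `b` is comparable to `(m+1)s` with ratio at most `4`,
whatever the sign of `q`. -/
theorem norm_inner_shell_le {T : L2 →L[ℂ] L2} {M q : ℝ} (hM : 0 ≤ M) (hT : ShellBound T M q)
    {s : ℝ} (hs : 1 ≤ s) {f : L2} (hf : ∀ᵐ x, x ∉ shell s (2 * s) → f x = 0) (g : L2) (m : ℕ) :
    ‖(inner ℂ (cutShell ((m + 1) * s) ((m + 1 + 1) * s) g) (T f) : ℂ)‖ ≤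
      6 * 4 ^ |q| * M * s * ((m + 1) * s) ^ q *
        (‖f‖ * ‖cutShell ((m + 1) * s) ((m + 1 + 1) * s) g‖) := by
  have hs0 : 0 < s := by linarith
  have hm : (0 : ℝ) ≤ m := m.cast_nonneg
  have h1 := hT f (cutShell ((m + 1) * s) ((m + 1 + 1) * s) g) _ _ (max ((m : ℝ) - 2) 0 * s)
    ((m + 4) * s) (by positivity)
    (mul_le_mul_of_nonneg_right (max_le (by linarith) (by linarith)) hs0.le) (by positivity) hf
    (cut_eq_zero_of_notMem _ (measurableSet_shell _ _) g) (fun y hy x hx => by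
      have hy1 := norm_le_bracket y
      have hx1 := norm_le_bracket x
      have hx2 := bracket_le_one_add_norm x
      have hy2 := hy.2
      have hx3 := hx.1
      have hx4 := hx.2
      constructor
      · rw [max_mul_of_nonneg _ _ hs0.le, zero_mul]
        refine max_le ?_ (norm_nonneg _)
        have := norm_sub_norm_le x y
        nlinarith
      · have := norm_sub_le x y
        nlinarith)
  refine h1.trans ?_
  have h2 : (m + 4) * s - max ((m : ℝ) - 2) 0 * s ≤ 6 * s := by
    have := le_max_left ((m : ℝ) - 2) 0
    nlinarith
  have h3 : (((m : ℝ) + 4) * s) ^ q ≤ 4 ^ |q| * ((m + 1) * s) ^ q :=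
    rpow_le_of_comparable q (by positivity) (by nlinarith) (by nlinarith)
  calc _ ≤ M * ((6 * s) * (4 ^ |q| * ((m + 1) * s) ^ q)) *
        (‖f‖ * ‖cutShell ((m + 1) * s) ((m + 1 + 1) * s) g‖) := by gcongr
    _ = _ := by ring

theorem summable_shell {δ : ℝ} (hδ : 1 / 2 < δ) : Summable fun m : ℕ => (((m : ℝ) + 1) ^ (-δ)) ^ 2 := by
  have h := (summable_nat_add_iff 1).2 (Real.summable_nat_rpow_inv.2 (by linarith : 1 < 2 * δ))
  refine h.congr fun m => ?_
  have : (0 : ℝ) ≤ (m : ℝ) + 1 := by positivity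
  push_cast
  rw [← Real.rpow_natCast, ← Real.rpow_mul this, ← Real.rpow_neg this]
  congr 1
  push_cast
  ring

/-- The constant in `norm_inner_exterior_le`. -/
def shellConst (p q : ℝ) : ℝ :=
  6 * 4 ^ |q| * 2 ^ |p| * Real.sqrt (∑' m : ℕ, (((m : ℝ) + 1) ^ (-(p - q))) ^ 2)

theorem shellConst_nonneg (p q : ℝ) : 0 ≤ shellConst p q := by
  unfold shellConst; positivity

/-- In the exterior shells of thickness `s`, the weight of `g` and the bound for `T` combine to
`s^{1-(p-q)}(m+1)^{-(p-q)}`. Orthogonality of the pieces of `G` allows Cauchy–Schwarz in `m`, and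
square summability is exactly `p - q > 1/2`. -/
theorem norm_inner_exterior_le {T : L2 →L[ℂ] L2} {M p q : ℝ} (hM : 0 ≤ M) (hT : ShellBound T M q)
    (hpq : 1 / 2 < p - q) {s : ℝ} (hs : 1 ≤ s) {f : L2}
    (hf : ∀ᵐ x, x ∉ shell s (2 * s) → f x = 0) {g G : L2}
    (hg : ∀ᵐ x, g x = ((bracket x ^ (-p) : ℝ) : ℂ) * G x) :
    ‖(inner ℂ (cutExterior s g) (T f) : ℂ)‖ ≤
      shellConst p q * M * s ^ (1 - (p - q)) * (‖f‖ * ‖G‖) := by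
  have hs0 : 0 < s := by linarith
  let r : ℕ → ℝ := fun m => (m + 1) * s
  have hr : Monotone r := fun a b hab => by
    have : (a : ℝ) ≤ b := by exact_mod_cast hab
    simp only [r]
    gcongr
  have hr' : Filter.Tendsto r Filter.atTop Filter.atTop :=
    (Filter.tendsto_atTop_add_const_right _ _ tendsto_natCast_atTop_atTop).atTop_mul_const hs0
  set S := Real.sqrt (∑' m : ℕ, (((m : ℝ) + 1) ^ (-(p - q))) ^ 2) with hS
  have hterm : ∀ m : ℕ, ‖(inner ℂ (cutShell (r m) (r (m + 1)) g) (T f) : ℂ)‖ ≤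
      6 * 4 ^ |q| * 2 ^ |p| * M * s ^ (1 - (p - q)) * ‖f‖ *
        (((m : ℝ) + 1) ^ (-(p - q)) * ‖cutShell (r m) (r (m + 1)) G‖) := by
    intro m
    have hm : (0 : ℝ) ≤ m := m.cast_nonneg
    have h1 := norm_inner_shell_le hM hT hs hf g m
    have h2 : ‖cutShell ((m + 1) * s) ((m + 1 + 1) * s) g‖ ≤ _ :=
      norm_cutShell_le (by positivity) (by nlinarith) hg
    have e : r (m + 1) = (m + 1 + 1) * s := by simp [r]
    rw [e]
    refine h1.trans ?_
    calc _ ≤ 6 * 4 ^ |q| * M * s * ((m + 1) * s) ^ q * (‖f‖ * (2 ^ |p| * ((m + 1) * s) ^ (-p) *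
          ‖cutShell ((m + 1) * s) ((m + 1 + 1) * s) G‖)) := by gcongr
      _ = 6 * 4 ^ |q| * 2 ^ |p| * M * (s * (((m + 1) * s) ^ q * ((m + 1) * s) ^ (-p))) * ‖f‖ *
          ‖cutShell ((m + 1) * s) ((m + 1 + 1) * s) G‖ := by ring
      _ = _ := by
        rw [← Real.rpow_add (by positivity), Real.mul_rpow (by positivity) hs0.le,
          show q + -p = -(p - q) by ring, show 1 - (p - q) = 1 + -(p - q) by ring,
          Real.rpow_add hs0, Real.rpow_one]
        ring
  have hsum : ∀ N : ℕ, ∑ m ∈ Finset.range N,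
      (((m : ℝ) + 1) ^ (-(p - q)) * ‖cutShell (r m) (r (m + 1)) G‖) ≤ S * ‖G‖ := by
    intro N
    refine (Real.sum_mul_le_sqrt_mul_sqrt _ _ _).trans ?_
    gcongr
    · exact Real.sqrt_le_sqrt ((summable_shell hpq).sum_le_tsum _ (fun m _ => sq_nonneg _))
    · exact Real.sqrt_le_iff.2 ⟨norm_nonneg _, sum_norm_cutShell_sq_le hr N G⟩
  -- The expansion is kept finite with an explicit tail, whose norm tends to zero as `N` grows.
  have hN : ∀ N : ℕ, ‖(inner ℂ (cutExterior s g) (T f) : ℂ)‖ ≤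
      shellConst p q * M * s ^ (1 - (p - q)) * (‖f‖ * ‖G‖) + ‖cutExterior (r N) g‖ * ‖T f‖ := by
    intro N
    have h0 : r 0 = s := by simp [r]
    have h1 := cutExterior_eq_sum hr N g
    rw [h0] at h1
    rw [h1, inner_add_left, sum_inner]
    refine (norm_add_le _ _).trans (add_le_add ?_ (norm_inner_le_norm _ _))
    calc _ ≤ ∑ m ∈ Finset.range N, 6 * 4 ^ |q| * 2 ^ |p| * M * s ^ (1 - (p - q)) * ‖f‖ *
          (((m : ℝ) + 1) ^ (-(p - q)) * ‖cutShell (r m) (r (m + 1)) G‖) :=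
        norm_sum_le_of_le _ fun m _ => hterm m
      _ = 6 * 4 ^ |q| * 2 ^ |p| * M * s ^ (1 - (p - q)) * ‖f‖ * ∑ m ∈ Finset.range N,
          (((m : ℝ) + 1) ^ (-(p - q)) * ‖cutShell (r m) (r (m + 1)) G‖) := by rw [Finset.mul_sum]
      _ ≤ 6 * 4 ^ |q| * 2 ^ |p| * M * s ^ (1 - (p - q)) * ‖f‖ * (S * ‖G‖) := by
        gcongr
        exact hsum N
      _ = _ := by rw [shellConst, hS]; ring
  have hlim : Filter.Tendsto (fun N => shellConst p q * M * s ^ (1 - (p - q)) * (‖f‖ * ‖G‖) +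
      ‖cutExterior (r N) g‖ * ‖T f‖) Filter.atTop
      (nhds (shellConst p q * M * s ^ (1 - (p - q)) * (‖f‖ * ‖G‖) + 0 * ‖T f‖)) :=
    ((tendsto_norm_cutExterior hr hr' g).mul_const _).const_add _
  rw [zero_mul, add_zero] at hlim
  exact ge_of_tendsto' hlim hN

/-- The constant in `norm_inner_le_of_shellBound`. -/
def weightConst (p₁ p₂ q : ℝ) : ℝ :=
  (shellConst p₂ q * 2 ^ |p₁| + shellConst p₁ q * 2 ^ |p₂|) *
    (1 - (2 : ℝ) ^ (-(p₁ + p₂ - q - 1)))⁻¹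

/-- Dyadic shells are removed from `f` and `g` simultaneously. At radius `r` the cost is
`r^{1-(p₂-q)}r^{-p₁}`, or the same with `p₁` and `p₂` exchanged; both equal `r^{-γ}`, so `γ > 0`
gives a geometric series. -/
theorem norm_inner_le_of_shellBound {T : L2 →L[ℂ] L2} {M p₁ p₂ q : ℝ} (hM : 0 ≤ M)
    (hT : ShellBound T M q) (h₁ : 1 / 2 < p₁ - q) (h₂ : 1 / 2 < p₂ - q) (h₃ : 0 < p₁ + p₂ - q - 1)
    {f F g G : L2} (hf : ∀ᵐ x, f x = ((bracket x ^ (-p₁) : ℝ) : ℂ) * F x)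
    (hg : ∀ᵐ x, g x = ((bracket x ^ (-p₂) : ℝ) : ℂ) * G x) :
    ‖(inner ℂ g (T f) : ℂ)‖ ≤ weightConst p₁ p₂ q * M * (‖F‖ * ‖G‖) := by
  set γ := p₁ + p₂ - q - 1 with hγ
  set ρ : ℝ := (2 : ℝ) ^ (-γ) with hρ
  have hρ0 : 0 ≤ ρ := by positivity
  have hρ1 : ρ < 1 := Real.rpow_lt_one_of_one_lt_of_neg one_lt_two (by linarith)
  let r : ℕ → ℝ := fun j => 2 ^ j
  have hr : Monotone r := fun a b hab => pow_le_pow_right₀ one_le_two hab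
  have hr' : Filter.Tendsto r Filter.atTop Filter.atTop := tendsto_pow_atTop_atTop_of_one_lt one_lt_two
  have hr1 : ∀ j, 1 ≤ r j := fun j => one_le_pow₀ one_le_two
  have hrs : ∀ j, r (j + 1) = 2 * r j := fun j => pow_succ' 2 j
  have hρj : ∀ j, ρ ^ j = r j ^ (-γ) := fun j => by
    simp only [r, hρ]
    rw [← Real.rpow_natCast, ← Real.rpow_natCast, ← Real.rpow_mul zero_le_two,
      ← Real.rpow_mul zero_le_two, mul_comm]
  set D := (shellConst p₂ q * 2 ^ |p₁| + shellConst p₁ q * 2 ^ |p₂|) * M * (‖F‖ * ‖G‖) with hD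
  have hD0 : 0 ≤ D := by
    have := shellConst_nonneg p₁ q
    have := shellConst_nonneg p₂ q
    positivity
  have hstep : ∀ j, ‖(inner ℂ (cutExterior (r j) g) (T (cutExterior (r j) f)) : ℂ)‖ ≤
      D * ρ ^ j + ‖(inner ℂ (cutExterior (r (j + 1)) g) (T (cutExterior (r (j + 1)) f)) : ℂ)‖ := by
    intro j
    have hj0 : 0 < r j := one_pos.trans_le (hr1 j)
    have hsub : ∀ u : L2, cutExterior (r j) u = cutShell (r j) (r (j + 1)) u +
      cutExterior (r (j + 1)) u := fun u => cutExterior_eq_add (hr j.le_succ) u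
    have hcut : ∀ u : L2, ∀ᵐ x, x ∉ shell (r j) (2 * r j) → cutShell (r j) (r (j + 1)) u x = 0 := by
      intro u
      rw [← hrs]
      exact cut_eq_zero_of_notMem _ _ u
    -- The two removed terms are arranged so that each has one factor in a dyadic shell and the
    -- other in the exterior of that shell's inner radius. No separate near-diagonal estimate is
    -- needed.
    have hdec : (inner ℂ (cutExterior (r j) g) (T (cutExterior (r j) f)) : ℂ) =
        inner ℂ (cutExterior (r j) g) (T (cutShell (r j) (r (j + 1)) f)) +
        inner ℂ (cutShell (r j) (r (j + 1)) g) (T (cutExterior (r (j + 1)) f)) +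
        inner ℂ (cutExterior (r (j + 1)) g) (T (cutExterior (r (j + 1)) f)) := by
      conv_lhs => rw [hsub f, map_add, inner_add_right]
      rw [add_assoc, ← inner_add_left, ← hsub g]
    have hI : ‖(inner ℂ (cutExterior (r j) g) (T (cutShell (r j) (r (j + 1)) f)) : ℂ)‖ ≤
        shellConst p₂ q * 2 ^ |p₁| * M * (‖F‖ * ‖G‖) * ρ ^ j := by
      refine (norm_inner_exterior_le hM hT h₂ (hr1 j) (hcut f) hg).trans ?_
      have h4 := (norm_cutShell_le hj0 (hrs j).le hf).trans
        (mul_le_mul_of_nonneg_left (norm_cut_le _ (measurableSet_shell _ _) F) (by positivity))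
      have := shellConst_nonneg p₂ q
      calc _ ≤ shellConst p₂ q * M * r j ^ (1 - (p₂ - q)) *
            ((2 ^ |p₁| * r j ^ (-p₁) * ‖F‖) * ‖G‖) := by gcongr
        _ = shellConst p₂ q * 2 ^ |p₁| * M * (‖F‖ * ‖G‖) *
            (r j ^ (1 - (p₂ - q)) * r j ^ (-p₁)) := by ring
        _ = _ := by
          rw [hρj, ← Real.rpow_add hj0]
          congr 2
          rw [hγ]; ring
    have hII : ‖(inner ℂ (cutShell (r j) (r (j + 1)) g) (T (cutExterior (r (j + 1)) f)) : ℂ)‖ ≤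
        shellConst p₁ q * 2 ^ |p₂| * M * (‖F‖ * ‖G‖) * ρ ^ j := by
      -- The roles of `f` and `g` are exchanged by passing to the adjoint, which satisfies the same
      -- shell bound by symmetry of the distance.
      rw [← ContinuousLinearMap.adjoint_inner_left, ← inner_conj_symm, RCLike.norm_conj]
      have hle : ‖(inner ℂ (cutExterior (r (j + 1)) f)
          (ContinuousLinearMap.adjoint T (cutShell (r j) (r (j + 1)) g)) : ℂ)‖ ≤
          shellConst p₁ q * M * r j ^ (1 - (p₁ - q)) *
            (‖cutShell (r j) (r (j + 1)) g‖ * ‖F‖) := by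
        have hc : ∀ᵐ x, cutExterior (r (j + 1)) f x = ((bracket x ^ (-p₁) : ℝ) : ℂ) *
            cutExterior (r (j + 1)) F x := by
          filter_upwards [hf, cut_ae (exterior (r (j + 1))) (measurableSet_exterior _) f,
            cut_ae (exterior (r (j + 1))) (measurableSet_exterior _) F] with x h1 h2 h3
          rw [cutExterior, h2, h3]
          by_cases hx : x ∈ exterior (r (j + 1))
          · rw [Set.indicator_of_mem hx, Set.indicator_of_mem hx, h1]
          · rw [Set.indicator_of_notMem hx, Set.indicator_of_notMem hx, mul_zero]
        have h5 := norm_inner_exterior_le hM hT.adjoint h₁ (hr1 j) (hcut g) hc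
        -- The exterior estimate cuts at the inner radius of the shell of `g`. The function already
        -- lives outside the next radius, so this cut changes nothing.
        have h6 : cutExterior (r j) (cutExterior (r (j + 1)) f) = cutExterior (r (j + 1)) f := by
          refine Lp.ext ?_
          filter_upwards [cut_ae (exterior (r (j + 1))) (measurableSet_exterior _) f,
            cut_ae (exterior (r j)) (measurableSet_exterior _) (cutExterior (r (j + 1)) f)]
            with x h1 h2
          rw [cutExterior, h2]
          by_cases hx : x ∈ exterior (r j)
          · rw [Set.indicator_of_mem hx]
          · have hx' : x ∉ exterior (r (j + 1)) := fun h' => hx ((hr j.le_succ).trans h')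
            rw [Set.indicator_of_notMem hx, cutExterior, h1, Set.indicator_of_notMem hx']
        rw [h6] at h5
        refine h5.trans ?_
        have := shellConst_nonneg p₁ q
        gcongr
        exact norm_cut_le _ _ F
      refine hle.trans ?_
      have h4 := (norm_cutShell_le hj0 (hrs j).le hg).trans
        (mul_le_mul_of_nonneg_left (norm_cut_le _ (measurableSet_shell _ _) G) (by positivity))
      have := shellConst_nonneg p₁ q
      calc _ ≤ shellConst p₁ q * M * r j ^ (1 - (p₁ - q)) *
            ((2 ^ |p₂| * r j ^ (-p₂) * ‖G‖) * ‖F‖) := by gcongr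
        _ = shellConst p₁ q * 2 ^ |p₂| * M * (‖F‖ * ‖G‖) *
            (r j ^ (1 - (p₁ - q)) * r j ^ (-p₂)) := by ring
        _ = _ := by
          rw [hρj, ← Real.rpow_add hj0]
          congr 2
          rw [hγ]; ring
    rw [hdec]
    refine (norm_add_le _ _).trans (add_le_add ((norm_add_le _ _).trans ?_) le_rfl)
    rw [hD]
    linarith
  have hN : ∀ N, ‖(inner ℂ g (T f) : ℂ)‖ ≤ D * ∑ j ∈ Finset.range N, ρ ^ j +
      ‖(inner ℂ (cutExterior (r N) g) (T (cutExterior (r N) f)) : ℂ)‖ := by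
    intro N
    induction N with
    | zero => simp [r, cutExterior_one]
    | succ N ih =>
      rw [Finset.sum_range_succ]
      linarith [hstep N]
  -- Plain boundedness of `T` on `L²` suffices for the remainder, since both exterior pieces tend to
  -- zero; the norm of `T` does not enter the final constant.
  have hN' : ∀ N, ‖(inner ℂ g (T f) : ℂ)‖ ≤ D * (1 - ρ)⁻¹ +
      ‖cutExterior (r N) g‖ * (‖T‖ * ‖cutExterior (r N) f‖) := by
    intro N
    refine (hN N).trans (add_le_add ?_ ((norm_inner_le_norm _ _).trans ?_))
    · gcongr
      rw [← tsum_geometric_of_lt_one hρ0 hρ1]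
      exact (summable_geometric_of_lt_one hρ0 hρ1).sum_le_tsum _ fun j _ => by positivity
    · gcongr
      exact T.le_opNorm _
  have hlim : Filter.Tendsto (fun N => D * (1 - ρ)⁻¹ +
      ‖cutExterior (r N) g‖ * (‖T‖ * ‖cutExterior (r N) f‖)) Filter.atTop
      (nhds (D * (1 - ρ)⁻¹ + 0 * (‖T‖ * 0))) :=
    ((tendsto_norm_cutExterior hr hr' g).mul
      ((tendsto_norm_cutExterior hr hr' f).const_mul _)).const_add _
  rw [zero_mul, add_zero] at hlim
  refine (ge_of_tendsto' hlim hN').trans_eq ?_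
  rw [hD, weightConst]
  ring

/-! ### Construction of weighted operators -/

/-- Multiplication by `⟨x⟩^b`, for `b ≤ 0`. -/
def bracketOp (b : ℝ) (hb : b ≤ 0) : L2 →L[ℂ] L2 :=
  mulOp (fun x => ((bracket x ^ b : ℝ) : ℂ)) (Complex.measurable_ofReal.comp (measurable_bracket_rpow b)) 1
    fun x => by
      rw [Complex.norm_real, Real.norm_of_nonneg (Real.rpow_nonneg (bracket_pos x).le _)]
      exact Real.rpow_le_one_of_one_le_of_nonpos (one_le_bracket x) hb

theorem bracketOp_ae (b : ℝ) (hb : b ≤ 0) (f : L2) :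
    ∀ᵐ x, bracketOp b hb f x = ((bracket x ^ b : ℝ) : ℂ) * f x :=
  mulOp_ae _ _ _ _ f

/-- The function `⟨x⟩^a u`. -/
def weighted (a : ℝ) (u : L2) (x : R3) : ℂ := ((bracket x ^ a : ℝ) : ℂ) * u x

theorem measurable_weighted (a : ℝ) (u : L2) : Measurable (weighted a u) :=
  (Complex.measurable_ofReal.comp (measurable_bracket_rpow a)).mul (Lp.stronglyMeasurable u).measurable

theorem weighted_add_ae (a : ℝ) (u v : L2) : weighted a (u + v) =ᵐ[volume] weighted a u + weighted a v := by
  filter_upwards [Lp.coeFn_add u v] with x hx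
  simp only [weighted, Pi.add_apply, hx, mul_add]

theorem weighted_smul_ae (a : ℝ) (c : ℂ) (u : L2) : weighted a (c • u) =ᵐ[volume] c • weighted a u := by
  filter_upwards [Lp.coeFn_smul c u] with x hx
  simp only [weighted, Pi.smul_apply, hx, smul_eq_mul]
  ring

theorem weightedBound_of_forall_two {q : ℝ≥0∞} [Fact (1 ≤ q)] {a b C : ℝ} (hb : b ≤ 0) (hC : 0 ≤ C)
    {T : L2 →L[ℂ] L2}
    (h : ∀ F f : L2, (∀ᵐ x, f x = ((bracket x ^ b : ℝ) : ℂ) * F x) →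
      eLpNorm (weighted a (T f)) q volume ≤ ENNReal.ofReal (C * ‖F‖)) :
    WeightedBound 2 q a T b C := by
  have h' (F : L2) := h F (bracketOp b hb F) (bracketOp_ae b hb F)
  have hmem (F : L2) : MemLp (weighted a (T (bracketOp b hb F))) q volume :=
    ⟨(measurable_weighted a _).aestronglyMeasurable, (h' F).trans_lt ENNReal.ofReal_lt_top⟩
  let S : L2 →ₗ[ℂ] Lp ℂ q (volume : Measure R3) :=
    { toFun := fun F => (hmem F).toLp _
      map_add' := fun F G => by
        rw [← MemLp.toLp_add]
        refine MemLp.toLp_congr _ _ ?_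
        rw [map_add, map_add]
        exact weighted_add_ae a _ _
      map_smul' := fun c F => by
        rw [RingHom.id_apply, ← MemLp.toLp_const_smul]
        refine MemLp.toLp_congr _ _ ?_
        rw [map_smul, map_smul]
        exact weighted_smul_ae a c _ }
  refine ⟨S.mkContinuous C fun F => ?_, S.mkContinuous_norm_le hC _, fun F g hg => ?_⟩
  · change ‖(hmem F).toLp _‖ ≤ _
    rw [Lp.norm_toLp]
    exact ENNReal.toReal_le_of_le_ofReal (by positivity) (h' F)
  · have hgF : g = bracketOp b hb F := by
      refine Lp.ext ?_
      filter_upwards [hg, bracketOp_ae b hb F] with x h1 h2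
      rw [h1, h2]
    rw [hgF]
    exact (hmem F).coeFn_toLp

/-- For `a > 0` it is not known beforehand that `⟨x⟩^a u` lies in `L²`. Its truncations to `⟨x⟩ < n`
do, and testing with the truncation itself gives `‖v_n‖² ≤ C‖v_n‖`. Fatou's lemma removes the
truncation. -/
theorem eLpNorm_weighted_le_of_inner {u : L2} {a C : ℝ} (hC : 0 ≤ C)
    (h : ∀ G g : L2, (∀ᵐ x, g x = ((bracket x ^ a : ℝ) : ℂ) * G x) →
      ‖(inner ℂ g u : ℂ)‖ ≤ C * ‖G‖) :
    eLpNorm (weighted a u) 2 volume ≤ ENNReal.ofReal C := by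
  let A : ℕ → Set R3 := fun n => shell 1 n
  let m : ℕ → R3 → ℂ := fun n => (A n).indicator fun x => ((bracket x ^ a : ℝ) : ℂ)
  have hA : ∀ n, MeasurableSet (A n) := fun n => measurableSet_shell _ _
  have hm : ∀ n, Measurable (m n) := fun n =>
    (Complex.measurable_ofReal.comp (measurable_bracket_rpow a)).indicator (hA n)
  have hbd : ∀ n x, ‖m n x‖ ≤ (n : ℝ) ^ |a| := by
    intro n x
    by_cases hx : x ∈ A n
    · simp only [m]
      rw [Set.indicator_of_mem hx, Complex.norm_real,
        Real.norm_of_nonneg (Real.rpow_nonneg (bracket_pos x).le _)]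
      calc bracket x ^ a ≤ bracket x ^ |a| :=
            Real.rpow_le_rpow_of_exponent_le (one_le_bracket x) (le_abs_self a)
        _ ≤ _ := Real.rpow_le_rpow (bracket_pos x).le hx.2.le (abs_nonneg a)
    · simp only [m]
      rw [Set.indicator_of_notMem hx, norm_zero]
      positivity
  let v : ℕ → L2 := fun n => mulOp (m n) (hm n) _ (hbd n) u
  have hv : ∀ n, ∀ᵐ x, v n x = m n x * u x := fun n => mulOp_ae _ _ _ _ _
  have hvn : ∀ n, ‖v n‖ ≤ C := by
    intro n
    let g : L2 := mulOp (m n) (hm n) _ (hbd n) (v n)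
    have hg : ∀ᵐ x, g x = m n x * v n x := mulOp_ae _ _ _ _ _
    have h1 := h (v n) g (by
      filter_upwards [hg, hv n] with x h1 h2
      rw [h1, h2]
      by_cases hx : x ∈ A n
      · simp only [m, Set.indicator_of_mem hx]
      · simp only [m, Set.indicator_of_notMem hx, zero_mul, mul_zero])
    have h2 : (inner ℂ g u : ℂ) = inner ℂ (v n) (v n) := by
      rw [L2.inner_def, L2.inner_def]
      refine integral_congr_ae ?_
      filter_upwards [hg, hv n] with x h1 h2
      have hreal : starRingEnd ℂ (m n x) = m n x := by
        by_cases hx : x ∈ A n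
        · simp only [m, Set.indicator_of_mem hx, Complex.conj_ofReal]
        · simp only [m, Set.indicator_of_notMem hx, map_zero]
      simp only [RCLike.inner_apply, h1, h2, map_mul, hreal]
      ring
    rw [h2, inner_self_eq_norm_sq_to_K, norm_pow, RCLike.norm_ofReal, abs_norm, sq] at h1
    rcases (norm_nonneg (v n)).eq_or_lt with h0 | h0
    · rw [← h0]; exact hC
    · exact le_of_mul_le_mul_right h1 h0
  have hlim : ∀ᵐ x, Filter.Tendsto (fun n => v n x) Filter.atTop (nhds (weighted a u x)) := by
    filter_upwards [ae_all_iff.2 hv] with x hx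
    refine tendsto_const_nhds.congr' ?_
    filter_upwards [tendsto_natCast_atTop_atTop.eventually_gt_atTop (bracket x)] with n hn
    rw [hx n]
    simp only [m, weighted]
    rw [Set.indicator_of_mem (show x ∈ A n from ⟨one_le_bracket x, hn⟩)]
  refine (Lp.eLpNorm_lim_le_liminf_eLpNorm (fun n => Lp.aestronglyMeasurable (v n)) _ hlim).trans ?_
  refine Filter.liminf_le_of_le (by isBoundedDefault) fun b hb => ?_
  obtain ⟨n, hn⟩ := hb.exists
  refine hn.trans ?_
  rw [← ENNReal.ofReal_toReal (Lp.eLpNorm_ne_top (v n)), ← Lp.norm_def]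
  exact ENNReal.ofReal_le_ofReal (hvn n)

theorem weightedBound_two_two {a b C : ℝ} (hb : b ≤ 0) (hC : 0 ≤ C) {T : L2 →L[ℂ] L2}
    (h : ∀ F f G g : L2, (∀ᵐ x, f x = ((bracket x ^ b : ℝ) : ℂ) * F x) →
      (∀ᵐ x, g x = ((bracket x ^ a : ℝ) : ℂ) * G x) →
      ‖(inner ℂ g (T f) : ℂ)‖ ≤ C * (‖F‖ * ‖G‖)) :
    WeightedBound 2 2 a T b C :=
  weightedBound_of_forall_two hb hC fun F f hf =>
    eLpNorm_weighted_le_of_inner (by positivity) fun G g hg => by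
      rw [mul_assoc]; exact h F f G g hf hg

/-- The pairs `(F, f)` in `L¹ × L²` with `f = ⟨x⟩^b F`. -/
def weightGraph (b : ℝ) : Submodule ℂ (Lp ℂ 1 (volume : Measure R3) × L2) where
  carrier := {p | ∀ᵐ x, p.2 x = ((bracket x ^ b : ℝ) : ℂ) * p.1 x}
  zero_mem' := by
    filter_upwards [Lp.coeFn_zero ℂ 1 (volume : Measure R3), Lp.coeFn_zero ℂ 2 (volume : Measure R3)]
      with x h1 h2
    simp only [Prod.fst_zero, Prod.snd_zero, h1, h2, Pi.zero_apply, mul_zero]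
  add_mem' := by
    intro p q hp hq
    filter_upwards [hp, hq, Lp.coeFn_add p.1 q.1, Lp.coeFn_add p.2 q.2] with x h1 h2 h3 h4
    simp only [Prod.fst_add, Prod.snd_add, h3, h4, Pi.add_apply, h1, h2, mul_add]
  smul_mem' := by
    intro c p hp
    filter_upwards [hp, Lp.coeFn_smul c p.1, Lp.coeFn_smul c p.2] with x h1 h2 h3
    simp only [Prod.smul_fst, Prod.smul_snd, h2, h3, Pi.smul_apply, h1, smul_eq_mul]
    ring

theorem denseRange_weightGraph {b : ℝ} (hb : b ≤ 0) :
    DenseRange ((LinearMap.fst ℂ (Lp ℂ 1 (volume : Measure R3)) L2).comp (weightGraph b).subtype) := by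
  have hd := SchwartzMap.denseRange_toLpCLM (E := R3) (F := ℂ) (p := 1) (by simp)
    (μ := (volume : Measure R3))
  refine hd.mono ?_
  rintro _ ⟨φ, rfl⟩
  refine ⟨⟨(φ.toLp 1, bracketOp b hb (φ.toLp 2)), ?_⟩, rfl⟩
  filter_upwards [bracketOp_ae b hb (φ.toLp 2), φ.coeFn_toLp 1 (volume : Measure R3),
    φ.coeFn_toLp 2 (volume : Measure R3)] with x h1 h2 h3
  simp only [h1, h2, h3]

/-- The operator `T` acts only on `L²`, so the `L¹` map is first defined on the `F` for which `⟨x⟩^b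
F` is square integrable, then extended by continuity. For `b ≤ 0` this domain contains the Schwartz
functions, hence is dense. -/
theorem weightedBound_one_two {a b C : ℝ} (hb : b ≤ 0) (hC : 0 ≤ C) {T : L2 →L[ℂ] L2}
    (h : ∀ (F : Lp ℂ 1 (volume : Measure R3)) (f : L2),
      (∀ᵐ x, f x = ((bracket x ^ b : ℝ) : ℂ) * F x) →
      eLpNorm (weighted a (T f)) 2 volume ≤ ENNReal.ofReal (C * ‖F‖)) :
    WeightedBound 1 2 a T b C := by
  have h' (p : weightGraph b) := h p.1.1 p.1.2 p.2
  have hmem (p : weightGraph b) : MemLp (weighted a (T p.1.2)) 2 volume :=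
    ⟨(measurable_weighted a _).aestronglyMeasurable, (h' p).trans_lt ENNReal.ofReal_lt_top⟩
  let S : weightGraph b →ₗ[ℂ] L2 :=
    { toFun := fun p => (hmem p).toLp _
      map_add' := fun p q => by
        rw [← MemLp.toLp_add]
        refine MemLp.toLp_congr _ _ ?_
        rw [Submodule.coe_add, Prod.snd_add, map_add]
        exact weighted_add_ae a _ _
      map_smul' := fun c p => by
        rw [RingHom.id_apply, ← MemLp.toLp_const_smul]
        refine MemLp.toLp_congr _ _ ?_
        rw [Submodule.coe_smul, Prod.smul_snd, map_smul]
        exact weighted_smul_ae a c _ }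
  let e := (LinearMap.fst ℂ (Lp ℂ 1 (volume : Measure R3)) L2).comp (weightGraph b).subtype
  have hn : ∀ p, ‖S p‖ ≤ C * ‖e p‖ := fun p => by
    change ‖(hmem p).toLp _‖ ≤ _
    rw [Lp.norm_toLp]
    exact ENNReal.toReal_le_of_le_ofReal (by positivity) (h' p)
  refine ⟨S.extendOfNorm e, LinearMap.opNorm_extendOfNorm_le (denseRange_weightGraph hb) hC hn,
    fun F g hg => ?_⟩
  have := LinearMap.extendOfNorm_eq (denseRange_weightGraph hb) ⟨C, hn⟩ ⟨(F, g), hg⟩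
  change S.extendOfNorm e F = S ⟨(F, g), hg⟩ at this
  rw [this]
  exact (hmem ⟨(F, g), hg⟩).coeFn_toLp

/-! ### Bounds from the size of the kernel -/

/-- The convolution is a Bochner integral in `L²`, so pointwise values are reached by duality: it is
tested on arbitrary sets of finite measure, and Tonelli identifies the resulting bound. -/
theorem enorm_convOp_le {K : R3 → ℂ} (hKm : Measurable K) (hK : Integrable K) (f : L2) :
    ∀ᵐ x, ‖convOp K hK f x‖ₑ ≤ ∫⁻ y, ‖K (x - y)‖ₑ * ‖f y‖ₑ := by
  set u := convOp K hK f with hu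
  have hum : Measurable u := (Lp.stronglyMeasurable u).measurable
  have hfm : Measurable f := (Lp.stronglyMeasurable f).measurable
  refine ae_le_of_forall_setLIntegral_le_of_sigmaFinite hum.enorm fun s hs hμs => ?_
  -- Dividing by the modulus makes the pairing with `u` equal to `∫ |u|` over `s`; where `u = 0` the
  -- quotient is `0` by convention.
  let φ : R3 → ℂ := s.indicator fun x => u x / (‖u x‖ : ℂ)
  have hφm : Measurable φ :=
    (hum.div (Complex.measurable_ofReal.comp hum.norm)).indicator hs
  have hφ1 : ∀ x, ‖φ x‖ₑ ≤ s.indicator 1 x := by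
    intro x
    by_cases hx : x ∈ s
    · simp only [φ, Set.indicator_of_mem hx, Pi.one_apply]
      rw [← ofReal_norm, norm_div, Complex.norm_real, norm_norm]
      exact ENNReal.ofReal_le_one.2 (div_self_le_one _)
    · simp [φ, Set.indicator_of_notMem hx]
  have hφ : MemLp φ 2 volume := by
    refine (memLp_indicator_const 2 hs (1 : ℂ) (Or.inr hμs.ne)).of_le hφm.aestronglyMeasurable
      (Filter.Eventually.of_forall fun x => ?_)
    have := hφ1 x
    by_cases hx : x ∈ s
    · simp only [Set.indicator_of_mem hx, Pi.one_apply] at this ⊢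
      rw [← ofReal_norm, ENNReal.ofReal_le_one] at this
      simpa using this
    · simp [φ, Set.indicator_of_notMem hx]
  let g : L2 := hφ.toLp φ
  have hg : ∀ᵐ x, g x = φ x := hφ.coeFn_toLp
  have hinner : ∀ᵐ x, (inner ℂ (g x) (u x) : ℂ) = s.indicator (fun x => (‖u x‖ : ℂ)) x := by
    filter_upwards [hg] with x hx
    rw [hx, RCLike.inner_apply]
    by_cases h : x ∈ s
    · simp only [φ, Set.indicator_of_mem h]
      rcases eq_or_ne (u x) 0 with h0 | h0
      · simp [h0]
      · have h1 : (‖u x‖ : ℂ) ≠ 0 := by simpa using h0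
        rw [map_div₀, Complex.conj_ofReal, ← mul_div_assoc, Complex.mul_conj,
          Complex.normSq_eq_norm_sq]
        push_cast
        field_simp
    · simp [φ, Set.indicator_of_notMem h]
  have h1 : ∫⁻ x in s, ‖u x‖ₑ = ‖(inner ℂ g u : ℂ)‖ₑ := by
    have hint := (L2.integrable_inner g u (𝕜 := ℂ)).congr hinner
    rw [L2.inner_def, integral_congr_ae hinner]
    have e1 : ∫ x, s.indicator (fun x => (‖u x‖ : ℂ)) x =
        ((∫ x, ‖s.indicator (fun x => (‖u x‖ : ℂ)) x‖ : ℝ) : ℂ) := by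
      rw [← integral_complex_ofReal]
      refine integral_congr_ae (Filter.Eventually.of_forall fun x => ?_)
      by_cases h : x ∈ s <;> simp [h]
    have e2 : 0 ≤ ∫ x, ‖s.indicator (fun x => (‖u x‖ : ℂ)) x‖ := integral_nonneg fun _ => norm_nonneg _
    rw [e1, ← ofReal_norm, Complex.norm_real, Real.norm_of_nonneg e2, ofReal_integral_norm_eq_lintegral_enorm hint,
      ← lintegral_indicator hs]
    refine lintegral_congr fun x => ?_
    by_cases h : x ∈ s
    · simp only [Set.indicator_of_mem h]
      rw [← ofReal_norm, ← ofReal_norm, Complex.norm_real, norm_norm]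
    · simp [Set.indicator_of_notMem h]
  have h2 : ∀ z, ‖(inner ℂ g (trans z f) : ℂ)‖ₑ ≤ ∫⁻ x in s, ‖f (x - z)‖ₑ := by
    intro z
    rw [L2.inner_def, ← lintegral_indicator hs]
    refine (enorm_integral_le_lintegral_enorm _).trans (lintegral_mono_ae ?_)
    filter_upwards [hg, trans_ae z f] with x hx hx'
    rw [hx, hx', RCLike.inner_apply, enorm_mul, RCLike.enorm_conj]
    by_cases h : x ∈ s
    · rw [Set.indicator_of_mem h]
      have := hφ1 x
      rw [Set.indicator_of_mem h, Pi.one_apply] at this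
      exact mul_le_of_le_one_right zero_le this
    · simp [φ, Set.indicator_of_notMem h]
  rw [h1, hu, inner_convOp]
  calc _ ≤ ∫⁻ z, ‖K z‖ₑ * ∫⁻ x in s, ‖f (x - z)‖ₑ := by
        refine (enorm_integral_le_lintegral_enorm _).trans (lintegral_mono fun z => ?_)
        rw [enorm_mul]
        exact mul_le_mul_right (h2 z) _
    _ = ∫⁻ z, ∫⁻ x in s, ‖K z‖ₑ * ‖f (x - z)‖ₑ := by
        refine lintegral_congr fun z => ?_
        rw [lintegral_const_mul]
        exact (hfm.comp (measurable_id.sub_const z)).enorm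
    _ = ∫⁻ x in s, ∫⁻ z, ‖K z‖ₑ * ‖f (x - z)‖ₑ := by
        refine lintegral_lintegral_swap (Measurable.aemeasurable ?_)
        exact (hKm.comp measurable_fst).enorm.mul
          (hfm.comp (measurable_snd.sub measurable_fst)).enorm
    _ = _ := by
        refine lintegral_congr fun x => ?_
        rw [← lintegral_sub_left_eq_self _ x]
        simp only [sub_sub_cancel]

/-- The absolute value of the kernel of `⟨x⟩^a K ⟨x⟩^b`. -/
def weightedKernel (a : ℝ) (K : R3 → ℂ) (b : ℝ) (x y : R3) : ℝ≥0∞ :=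
  ENNReal.ofReal (bracket x ^ a) * (‖K (x - y)‖ₑ * ENNReal.ofReal (bracket y ^ b))

theorem measurable_weightedKernel (a : ℝ) {K : R3 → ℂ} (hK : Measurable K) (b : ℝ) :
    Measurable fun p : R3 × R3 => weightedKernel a K b p.1 p.2 :=
  (((measurable_bracket_rpow a).comp measurable_fst).ennreal_ofReal).mul
    (((hK.comp (measurable_fst.sub measurable_snd)).enorm).mul
      (((measurable_bracket_rpow b).comp measurable_snd).ennreal_ofReal))

theorem enorm_weighted_convOp_le {K : R3 → ℂ} (hKm : Measurable K) (hK : Integrable K) {a b : ℝ}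
    {F : R3 → ℂ} {f : L2} (hf : ∀ᵐ x, f x = ((bracket x ^ b : ℝ) : ℂ) * F x) :
    ∀ᵐ x, ‖weighted a (convOp K hK f) x‖ₑ ≤ ∫⁻ y, weightedKernel a K b x y * ‖F y‖ₑ := by
  have hbr : ∀ (c : ℝ) (x : R3), ‖((bracket x ^ c : ℝ) : ℂ)‖ₑ = ENNReal.ofReal (bracket x ^ c) := by
    intro c x
    rw [← ofReal_norm, Complex.norm_real, Real.norm_of_nonneg (Real.rpow_nonneg (bracket_pos x).le _)]
  filter_upwards [enorm_convOp_le hKm hK f] with x hx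
  rw [weighted, enorm_mul, hbr]
  refine (mul_le_mul_right hx _).trans_eq ?_
  rw [← lintegral_const_mul' _ _ ENNReal.ofReal_ne_top]
  refine lintegral_congr_ae ?_
  filter_upwards [hf] with y hy
  rw [hy, enorm_mul, hbr, weightedKernel]
  ring

theorem eLpNorm_top_weighted_convOp_le {K : R3 → ℂ} (hKm : Measurable K) (hK : Integrable K)
    {a b M : ℝ} (hM : 0 ≤ M)
    (h : ∀ x, ∫⁻ y, weightedKernel a K b x y ^ (2 : ℝ) ≤ ENNReal.ofReal M ^ (2 : ℝ)) {F f : L2}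
    (hf : ∀ᵐ x, f x = ((bracket x ^ b : ℝ) : ℂ) * F x) :
    eLpNorm (weighted a (convOp K hK f)) ∞ volume ≤ ENNReal.ofReal (M * ‖F‖) := by
  rw [eLpNorm_exponent_top]
  refine eLpNormEssSup_le_of_ae_enorm_bound ?_
  have hF : ENNReal.ofReal ‖F‖ = (∫⁻ y, ‖F y‖ₑ ^ (2 : ℝ)) ^ (1 / (2 : ℝ)) := by
    rw [Lp.norm_def, ENNReal.ofReal_toReal (Lp.eLpNorm_ne_top F),
      eLpNorm_eq_lintegral_rpow_enorm_toReal (by norm_num) (by norm_num)]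
    simp
  filter_upwards [enorm_weighted_convOp_le hKm hK (a := a) hf] with x hx
  refine hx.trans ((ENNReal.lintegral_mul_le_Lp_mul_Lq volume Real.HolderConjugate.two_two
    ((measurable_weightedKernel a hKm b).comp measurable_prodMk_left).aemeasurable
    (Lp.aestronglyMeasurable F).enorm).trans ?_)
  rw [ENNReal.ofReal_mul hM, hF]
  refine mul_le_mul_left ?_ _
  calc _ ≤ (ENNReal.ofReal M ^ (2 : ℝ)) ^ (1 / (2 : ℝ)) := by
        gcongr
        exact h x
    _ = _ := by rw [← ENNReal.rpow_mul]; norm_num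

theorem rpow_two_lintegral_mul_le {k φ : R3 → ℝ≥0∞} (hk : Measurable k) (hφ : Measurable φ) :
    (∫⁻ y, k y * φ y) ^ (2 : ℝ) ≤ (∫⁻ y, k y ^ (2 : ℝ) * φ y) * ∫⁻ y, φ y := by
  have h0 : ∀ y, k y * φ y = (k y * φ y ^ (1 / 2 : ℝ)) * φ y ^ (1 / 2 : ℝ) := by
    intro y
    rw [mul_assoc, ← ENNReal.rpow_add_of_nonneg _ _ (by norm_num) (by norm_num)]
    norm_num
  have h1 := ENNReal.lintegral_mul_le_Lp_mul_Lq volume Real.HolderConjugate.two_two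
    (hk.mul (hφ.pow_const (1 / 2 : ℝ))).aemeasurable (hφ.pow_const (1 / 2 : ℝ)).aemeasurable
  have h2 := ENNReal.rpow_le_rpow h1 (zero_le_two (α := ℝ))
  rw [ENNReal.mul_rpow_of_nonneg _ _ zero_le_two, ← ENNReal.rpow_mul, ← ENNReal.rpow_mul,
    one_div_mul_cancel (two_ne_zero' ℝ), ENNReal.rpow_one, ENNReal.rpow_one] at h2
  have h3 : ∀ t : ℝ≥0∞, (t ^ (1 / 2 : ℝ)) ^ (2 : ℝ) = t := fun t => by
    rw [← ENNReal.rpow_mul]; norm_num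
  simp only [Pi.mul_apply, ENNReal.mul_rpow_of_nonneg _ _ (zero_le_two (α := ℝ)), h3] at h2
  simpa only [← h0] using h2

/-- Minkowski's integral inequality for exponent two, obtained from Cauchy–Schwarz with respect to
the measure `φ dy` followed by Tonelli. -/
theorem lintegral_rpow_two_lintegral_mul_le {k : R3 → R3 → ℝ≥0∞} {φ : R3 → ℝ≥0∞} {B : ℝ≥0∞}
    (hk : Measurable fun p : R3 × R3 => k p.1 p.2) (hφ : Measurable φ) (hφ' : ∫⁻ y, φ y ≠ ⊤)
    (h : ∀ y, ∫⁻ x, k x y ^ (2 : ℝ) ≤ B) :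
    ∫⁻ x, (∫⁻ y, k x y * φ y) ^ (2 : ℝ) ≤ B * (∫⁻ y, φ y) ^ (2 : ℝ) := by
  have hk₁ : ∀ x, Measurable fun y => k x y := fun x => hk.comp measurable_prodMk_left
  have hk₂ : ∀ y, Measurable fun x => k x y ^ (2 : ℝ) := fun y =>
    (hk.comp measurable_prodMk_right).pow_const _
  calc _ ≤ ∫⁻ x, (∫⁻ y, k x y ^ (2 : ℝ) * φ y) * ∫⁻ y, φ y :=
        lintegral_mono fun x => rpow_two_lintegral_mul_le (hk₁ x) hφ
    _ = (∫⁻ x, ∫⁻ y, k x y ^ (2 : ℝ) * φ y) * ∫⁻ y, φ y := lintegral_mul_const' _ _ hφ'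
    _ = (∫⁻ y, (∫⁻ x, k x y ^ (2 : ℝ)) * φ y) * ∫⁻ y, φ y := by
        rw [lintegral_lintegral_swap ((hk.pow_const _).mul (hφ.comp measurable_snd)).aemeasurable]
        congr 1
        exact lintegral_congr fun y => lintegral_mul_const _ (hk₂ y)
    _ ≤ (∫⁻ y, B * φ y) * ∫⁻ y, φ y :=
        mul_le_mul_left (lintegral_mono fun y => mul_le_mul_left (h y) _) _
    _ = _ := by
        rw [lintegral_const_mul _ hφ, ENNReal.rpow_two, sq, mul_assoc]

theorem eLpNorm_two_weighted_convOp_le {K : R3 → ℂ} (hKm : Measurable K) (hK : Integrable K)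
    {a b M : ℝ} (hM : 0 ≤ M)
    (h : ∀ y, ∫⁻ x, weightedKernel a K b x y ^ (2 : ℝ) ≤ ENNReal.ofReal M ^ (2 : ℝ))
    {F : Lp ℂ 1 (volume : Measure R3)} {f : L2}
    (hf : ∀ᵐ x, f x = ((bracket x ^ b : ℝ) : ℂ) * F x) :
    eLpNorm (weighted a (convOp K hK f)) 2 volume ≤ ENNReal.ofReal (M * ‖F‖) := by
  have hFm : Measurable F := (Lp.stronglyMeasurable F).measurable
  have hF : ∫⁻ y, ‖F y‖ₑ = ENNReal.ofReal ‖F‖ := by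
    rw [Lp.norm_def, ENNReal.ofReal_toReal (Lp.eLpNorm_ne_top F), eLpNorm_one_eq_lintegral_enorm]
  have hFe : Measurable fun y => ‖F y‖ₑ := hFm.enorm
  have h1 := lintegral_rpow_two_lintegral_mul_le (measurable_weightedKernel a hKm b) hFe
    (hF ▸ ENNReal.ofReal_ne_top) h
  have hsq : ∫⁻ x, ‖weighted a (convOp K hK f) x‖ₑ ^ (2 : ℝ) ≤ ENNReal.ofReal (M * ‖F‖) ^ (2 : ℝ) := by
    rw [ENNReal.ofReal_mul hM, ENNReal.mul_rpow_of_nonneg _ _ zero_le_two, ← hF]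
    refine le_trans (lintegral_mono_ae ?_) h1
    filter_upwards [enorm_weighted_convOp_le hKm hK (a := a) hf] with x hx
    exact ENNReal.rpow_le_rpow hx zero_le_two
  rw [eLpNorm_eq_lintegral_rpow_enorm_toReal (by norm_num) (by norm_num), ENNReal.toReal_ofNat]
  calc _ ≤ (ENNReal.ofReal (M * ‖F‖) ^ (2 : ℝ)) ^ (1 / (2 : ℝ)) := by gcongr
    _ = _ := by rw [← ENNReal.rpow_mul]; norm_num

/-! ### Pointwise bounds for the kernels -/

/-- The function `|z|^{-2} ⟨z⟩^{-δ}`. -/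
def envelope (δ : ℝ) (z : R3) : ℝ := (‖z‖ ^ 2)⁻¹ * bracket z ^ (-δ)

theorem envelope_nonneg (δ : ℝ) (z : R3) : 0 ≤ envelope δ z :=
  mul_nonneg (by positivity) (Real.rpow_nonneg (bracket_pos z).le _)

theorem measurable_envelope (δ : ℝ) : Measurable (envelope δ) :=
  (measurable_norm.pow_const 2).inv.mul (measurable_bracket_rpow _)

/-- The volume factor `r²` cancels the singularity at the origin and leaves the one-dimensional
integral of `(1 + r²)^{-δ/2}`. -/
theorem lintegral_envelope_lt_top {δ : ℝ} (hδ : 1 < δ) :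
    ∫⁻ z, ENNReal.ofReal (envelope δ z) < ⊤ := by
  have h0 := lintegral_norm
    (fun r : ℝ => ENNReal.ofReal ((r ^ 2)⁻¹ * Real.sqrt (1 + r ^ 2) ^ (-δ))) (by fun_prop)
  refine lt_of_eq_of_lt h0 ?_
  have hi : Integrable fun r : ℝ => (1 + ‖r‖ ^ 2) ^ (-δ / 2) :=
    integrable_rpow_neg_one_add_norm_sq (by simpa using hδ)
  refine lt_of_le_of_lt ?_ (hi.const_mul (4 * Real.pi)).lintegral_lt_top
  refine (setLIntegral_mono' measurableSet_Ioi fun r hr => ?_).trans (setLIntegral_le_lintegral _ _)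
  have hr : 0 < r := hr
  rw [← ENNReal.ofReal_mul (by positivity), Real.norm_of_nonneg hr.le, Real.sqrt_eq_rpow,
    ← Real.rpow_mul (by positivity)]
  refine (ENNReal.ofReal_le_ofReal (le_of_eq ?_))
  field_simp

/-- The integral of `envelope`. -/
def envelopeIntegral (δ : ℝ) : ℝ := (∫⁻ z, ENNReal.ofReal (envelope δ z)).toReal

theorem lintegral_envelope {δ : ℝ} (hδ : 1 < δ) :
    ∫⁻ z, ENNReal.ofReal (envelope δ z) = ENNReal.ofReal (envelopeIntegral δ) :=
  (ENNReal.ofReal_toReal (lintegral_envelope_lt_top hδ).ne).symm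

theorem norm_le_norm_of_bracket_le {x y : R3} (h : bracket x ≤ bracket y) : ‖x‖ ≤ ‖y‖ := by
  rw [bracket, bracket, Real.sqrt_le_sqrt_iff (by positivity)] at h
  exact (sq_le_sq₀ (norm_nonneg _) (norm_nonneg _)).1 (by linarith)

theorem bracket_rpow_neg_mul_le {α β δ : ℝ} (hα : 0 ≤ α) (h : δ ≤ α + β) {y z : R3}
    (hyz : bracket y ≤ bracket z) :
    bracket z ^ (-α) * bracket y ^ (-β) ≤ bracket y ^ (-δ) := by
  have hy := bracket_pos y
  calc _ ≤ bracket y ^ (-α) * bracket y ^ (-β) :=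
        mul_le_mul_of_nonneg_right (Real.rpow_le_rpow_of_nonpos hy hyz (by linarith))
          (Real.rpow_nonneg hy.le _)
    _ = bracket y ^ (-α + -β) := (Real.rpow_add hy _ _).symm
    _ ≤ _ := Real.rpow_le_rpow_of_exponent_le (one_le_bracket y) (by linarith)

/-- All the decay is moved to whichever of `y`, `z` has the smaller bracket. If this is `y`, then
also `|z|^{-2} ≤ |y|^{-2}`, so the singularity moves with it. The sum of envelopes covers both
cases. -/
theorem inv_sq_mul_bracket_le_envelope {α β δ : ℝ} (hα : 0 ≤ α) (hβ : 0 ≤ β) (h : δ ≤ α + β)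
    {y z : R3} (hy : y ≠ 0) (hz : z ≠ 0) :
    (‖z‖ ^ 2)⁻¹ * (bracket z ^ (-α) * bracket y ^ (-β)) ≤ envelope δ z + envelope δ y := by
  have hy' := norm_pos_iff.2 hy
  have hz' := norm_pos_iff.2 hz
  rcases le_total (bracket y) (bracket z) with hyz | hyz
  · refine le_trans ?_ (le_add_of_nonneg_left (envelope_nonneg δ z))
    have h1 := norm_le_norm_of_bracket_le hyz
    exact mul_le_mul (by gcongr) (bracket_rpow_neg_mul_le hα h hyz)
      (mul_nonneg (Real.rpow_nonneg (bracket_pos z).le _) (Real.rpow_nonneg (bracket_pos y).le _))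
      (by positivity)
  · refine le_trans ?_ (le_add_of_nonneg_right (envelope_nonneg δ y))
    rw [mul_comm (bracket z ^ (-α))]
    exact mul_le_mul_of_nonneg_left (bracket_rpow_neg_mul_le hβ (by linarith) hyz) (by positivity)

theorem bracket_rpow_le_envelope (δ : ℝ) {y : R3} (hy : y ≠ 0) :
    bracket y ^ (-(2 + δ)) ≤ envelope δ y := by
  have hy' := norm_pos_iff.2 hy
  have h0 := bracket_pos y
  rw [neg_add, Real.rpow_add h0, envelope]
  refine mul_le_mul_of_nonneg_right ?_ (Real.rpow_nonneg h0.le _)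
  rw [Real.rpow_neg h0.le, Real.rpow_two]
  have := norm_le_bracket y
  gcongr

theorem bracket_mul_bracket_le_envelope {α β δ : ℝ} (hα : 0 ≤ α) (hβ : 0 ≤ β) (h : 2 + δ ≤ α + β)
    {y z : R3} (hy : y ≠ 0) (hz : z ≠ 0) :
    bracket z ^ (-α) * bracket y ^ (-β) ≤ envelope δ z + envelope δ y := by
  rcases le_total (bracket y) (bracket z) with hyz | hyz
  · exact ((bracket_rpow_neg_mul_le hα h hyz).trans (bracket_rpow_le_envelope δ hy)).trans
      (le_add_of_nonneg_left (envelope_nonneg δ z))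
  · rw [mul_comm]
    exact ((bracket_rpow_neg_mul_le hβ (by linarith) hyz).trans
      (bracket_rpow_le_envelope δ hz)).trans (le_add_of_nonneg_right (envelope_nonneg δ y))

/-- The constant in `exp_neg_mul_norm_sq_le`. -/
def decayConst (p : ℝ) : ℝ := ⌈p⌉₊.factorial * Real.exp 1

theorem decayConst_pos (p : ℝ) : 0 < decayConst p := by
  unfold decayConst; positivity

/-- For `ε ≤ 1` one has `ε⟨z⟩ ≤ 1 + ε|z|`, and the `p`-th power of the right side is at most `⌈p⌉!
e^{1+ε|z|}`. Only one of the two exponential factors is spent. -/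
theorem exp_neg_mul_norm_sq_le {p : ℝ} (hp : 0 ≤ p) {ε : ℝ} (hε : 0 < ε) (hε₁ : ε ≤ 1) (z : R3) :
    Real.exp (-ε * ‖z‖) ^ 2 ≤ decayConst p * (ε ^ (-p) * bracket z ^ (-p)) := by
  have hz := bracket_pos z
  have hn := norm_nonneg z
  have h1 : ε * bracket z ≤ 1 + ε * ‖z‖ := by
    have := mul_le_mul_of_nonneg_left (bracket_le_one_add_norm z) hε.le
    linarith
  have h2 : (ε * bracket z) ^ p ≤ decayConst p * Real.exp (ε * ‖z‖) := by
    have h3 : (1 : ℝ) ≤ 1 + ε * ‖z‖ := by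
      have := mul_nonneg hε.le hn
      linarith
    calc _ ≤ (1 + ε * ‖z‖) ^ p := Real.rpow_le_rpow (by positivity) h1 hp
      _ ≤ (1 + ε * ‖z‖) ^ (⌈p⌉₊ : ℝ) := Real.rpow_le_rpow_of_exponent_le h3 (Nat.le_ceil p)
      _ = (1 + ε * ‖z‖) ^ ⌈p⌉₊ := Real.rpow_natCast _ _
      _ ≤ ⌈p⌉₊.factorial * Real.exp (1 + ε * ‖z‖) := by
          have := Real.pow_div_factorial_le_exp (1 + ε * ‖z‖) (by positivity) ⌈p⌉₊
          rwa [div_le_iff₀' (by positivity)] at this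
      _ = _ := by rw [Real.exp_add, decayConst, mul_assoc]
  have h4 : Real.exp (-ε * ‖z‖) ^ 2 ≤ Real.exp (-ε * ‖z‖) := by
    have h5 : Real.exp (-ε * ‖z‖) ≤ 1 := Real.exp_le_one_iff.2 (by nlinarith)
    nlinarith [Real.exp_pos (-ε * ‖z‖)]
  refine h4.trans ?_
  rw [← Real.mul_rpow hε.le hz.le, Real.rpow_neg (by positivity), neg_mul, Real.exp_neg,
    ← div_eq_mul_inv, le_div_iff₀ (by positivity), inv_mul_le_iff₀ (Real.exp_pos _)]
  linarith

theorem bracket_sub_le (x y : R3) : bracket (x - y) ≤ 3 * (bracket x * bracket y) := by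
  have h1 := bracket_le_one_add_norm (x - y)
  have h2 := norm_sub_le x y
  have h3 := norm_le_bracket x
  have h4 := norm_le_bracket y
  nlinarith [one_le_bracket x, one_le_bracket y]

/-- The square of the kernel of `⟨x⟩^a R₀^{(n)} ⟨x⟩^b` is at most `D E²` times a sum of two
envelopes. -/
def KernelBound (n : ℕ) (ε a b δ D E : ℝ) : Prop :=
  ∀ x y : R3, x - y ≠ 0 → y ≠ 0 →
    (bracket x ^ a * (‖x - y‖⁻¹ * (‖x - y‖ ^ n * Real.exp (-ε * ‖x - y‖)) * bracket y ^ b)) ^ 2 ≤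
      D * E ^ 2 * (envelope δ (x - y) + envelope δ y)

theorem rpow_sq {t : ℝ} (ht : 0 < t) (p : ℝ) : (t ^ p) ^ 2 = t ^ (2 * p) := by
  rw [mul_comm, Real.rpow_mul ht.le, Real.rpow_two]

/-- Trading the exponential for `ε^{-2θ}⟨z⟩^{-2θ}` supplements the weight `⟨y⟩^{-2s}`; the total
decay `2θ + 2s` must reach `δ`. -/
theorem kernelBound_zero {s θ δ ε : ℝ} (hs : 0 ≤ s) (hθ : 0 ≤ θ) (h : δ ≤ 2 * θ + 2 * s)
    (hε : 0 < ε) (hε₁ : ε ≤ 1) :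
    KernelBound 0 ε 0 (-s) δ (decayConst (2 * θ)) (ε ^ (-θ)) := by
  intro x y hz hy
  have h1 := exp_neg_mul_norm_sq_le (p := 2 * θ) (by linarith) hε hε₁ (x - y)
  have h2 := inv_sq_mul_bracket_le_envelope (α := 2 * θ) (β := 2 * s) (by linarith) (by linarith) h hy hz
  rw [Real.rpow_zero, one_mul, pow_zero, one_mul, mul_pow, mul_pow, rpow_sq (bracket_pos y),
    rpow_sq hε, inv_pow]
  calc _ ≤ (‖x - y‖ ^ 2)⁻¹ * (decayConst (2 * θ) * (ε ^ (-(2 * θ)) * bracket (x - y) ^ (-(2 * θ)))) *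
        bracket y ^ (2 * -s) := by
        have := (bracket_pos y).le
        gcongr
    _ = decayConst (2 * θ) * ε ^ (2 * -θ) * ((‖x - y‖ ^ 2)⁻¹ *
        (bracket (x - y) ^ (-(2 * θ)) * bracket y ^ (-(2 * s)))) := by
        rw [mul_neg, mul_neg]; ring
    _ ≤ _ := by
        have := (decayConst_pos (2 * θ)).le
        gcongr

/-- The derivative cancels the singularity `1/|z|`, so the two powers needed to build an envelope
must come from brackets; the additional weight `⟨y⟩^{-1}` provides them. -/
theorem kernelBound_one {s θ δ ε : ℝ} (hs : -1 ≤ s) (hθ : 0 ≤ θ) (h : δ ≤ 2 * θ + 2 * s)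
    (hε : 0 < ε) (hε₁ : ε ≤ 1) :
    KernelBound 1 ε 0 (-1 - s) δ (decayConst (2 * θ)) (ε ^ (-θ)) := by
  intro x y hz hy
  have h1 := exp_neg_mul_norm_sq_le (p := 2 * θ) (by linarith) hε hε₁ (x - y)
  have h2 := bracket_mul_bracket_le_envelope (α := 2 * θ) (β := 2 + 2 * s) (δ := δ) (by linarith)
    (by linarith) (by linarith) hy hz
  rw [Real.rpow_zero, one_mul, pow_one, ← mul_assoc, inv_mul_cancel₀ (norm_ne_zero_iff.2 hz), one_mul,
    mul_pow, rpow_sq (bracket_pos y), rpow_sq hε]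
  calc _ ≤ (decayConst (2 * θ) * (ε ^ (-(2 * θ)) * bracket (x - y) ^ (-(2 * θ)))) *
        bracket y ^ (2 * (-1 - s)) := by
        have := (bracket_pos y).le
        gcongr
    _ = decayConst (2 * θ) * ε ^ (2 * -θ) *
        (bracket (x - y) ^ (-(2 * θ)) * bracket y ^ (-(2 + 2 * s))) := by
        rw [mul_neg, show 2 * (-1 - s) = -(2 + 2 * s) by ring]; ring
    _ ≤ _ := by
        have := (decayConst_pos (2 * θ)).le
        gcongr

/-- The growth `|z|^{2k}` is compensated by the left weight, moved onto `z` through `⟨x⟩^{-m} ≤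
3^m⟨y⟩^m⟨x-y⟩^{-m}`, and by the exponential, which yields `ε^{-(2-2θ)}⟨z⟩^{-(2-2θ)}`. What remains
is `⟨z⟩^{-(2σ-2θ)}⟨y⟩^{-(4+2s-2σ)}`, whence the conditions `θ ≤ σ` and `δ + 2θ ≤ 2 + 2s`. -/
theorem kernelBound_succ {k : ℕ} (hk : 1 ≤ k) {s σ θ δ ε : ℝ} (hσ₀ : 0 ≤ σ) (hσ₁ : σ ≤ 1)
    (hs : -1 ≤ s) (hθ : θ ≤ σ) (h : δ + 2 * θ ≤ 2 + 2 * s) (hε : 0 < ε) (hε₁ : ε ≤ 1) :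
    KernelBound (k + 1) ε (-k + 1 - σ) (-k - 1 - s) δ
      (3 ^ (2 * (k - 1 + σ)) * decayConst (2 - 2 * θ)) (ε ^ (-1 + θ)) := by
  intro x y hz hy
  have hk' : (1 : ℝ) ≤ k := by exact_mod_cast hk
  have hX := bracket_pos x
  have hY := bracket_pos y
  have hR := bracket_pos (x - y)
  have hD := decayConst_pos (2 - 2 * θ)
  have hr : ‖x - y‖ ≠ 0 := norm_ne_zero_iff.2 hz
  set m : ℝ := 2 * (k - 1 + σ) with hm
  have hm0 : 0 ≤ m := by rw [hm]; linarith
  have h1 := exp_neg_mul_norm_sq_le (p := 2 - 2 * θ) (by linarith) hε hε₁ (x - y)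
  have h2 := bracket_mul_bracket_le_envelope (α := 2 * σ - 2 * θ) (β := 4 + 2 * s - 2 * σ) (δ := δ)
    (by linarith) (by linarith) (by linarith) hy hz
  have h3 : bracket x ^ (-m) ≤ 3 ^ m * (bracket y ^ m * bracket (x - y) ^ (-m)) := by
    have h4 := Real.rpow_le_rpow hR.le (bracket_sub_le x y) hm0
    rw [Real.mul_rpow (by norm_num) (by positivity), Real.mul_rpow hX.le hY.le] at h4
    rw [Real.rpow_neg hX.le, Real.rpow_neg hR.le]
    have h5 := Real.rpow_pos_of_pos hX m
    have h6 := Real.rpow_pos_of_pos hR m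
    rw [← mul_assoc, ← div_eq_mul_inv, le_div_iff₀ h6, inv_mul_le_iff₀ h5]
    linarith
  have h7 : ‖x - y‖ ^ (2 * k) ≤ bracket (x - y) ^ (2 * k : ℝ) := by
    have : (2 * k : ℝ) = ((2 * k : ℕ) : ℝ) := by push_cast; ring
    rw [this, Real.rpow_natCast]
    exact pow_le_pow_left₀ (norm_nonneg _) (norm_le_bracket _) _
  have h8 : ‖x - y‖⁻¹ * (‖x - y‖ ^ (k + 1) * Real.exp (-ε * ‖x - y‖)) =
      ‖x - y‖ ^ k * Real.exp (-ε * ‖x - y‖) := by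
    field_simp
    ring
  rw [h8, mul_pow, mul_pow, mul_pow, rpow_sq hX, rpow_sq hY, rpow_sq hε, ← pow_mul, mul_comm k,
    show 2 * (-k + 1 - σ) = -m by rw [hm]; ring]
  calc _ ≤ 3 ^ m * (bracket y ^ m * bracket (x - y) ^ (-m)) * (bracket (x - y) ^ (2 * k : ℝ) *
        (decayConst (2 - 2 * θ) * (ε ^ (-(2 - 2 * θ)) * bracket (x - y) ^ (-(2 - 2 * θ)))) *
          bracket y ^ (2 * (-k - 1 - s))) := by gcongr
    _ = 3 ^ m * decayConst (2 - 2 * θ) * ε ^ (-(2 - 2 * θ)) * (bracket (x - y) ^ (-m) *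
        bracket (x - y) ^ (2 * k : ℝ) * bracket (x - y) ^ (-(2 - 2 * θ)) *
        (bracket y ^ m * bracket y ^ (2 * (-k - 1 - s)))) := by ring
    _ = 3 ^ m * decayConst (2 - 2 * θ) * ε ^ (2 * (-1 + θ)) *
        (bracket (x - y) ^ (-(2 * σ - 2 * θ)) * bracket y ^ (-(4 + 2 * s - 2 * σ))) := by
        rw [← Real.rpow_add hR, ← Real.rpow_add hR, ← Real.rpow_add hY]
        congr 3
        · ring
        · rw [hm]; ring
        · rw [hm]; ring
    _ ≤ _ := by gcongr

theorem norm_freeKernel_le (n : ℕ) {τ : ℝ} (hτ : τ = 1 ∨ τ = -1) (lam ε : ℝ) (z : R3) :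
    ‖freeKernel n τ lam ε z‖ ≤ ‖z‖⁻¹ * (‖z‖ ^ n * Real.exp (-ε * ‖z‖)) := by
  rw [freeKernel, norm_radialKernel, norm_freeProfile n hτ lam ε (norm_nonneg z), mul_inv]
  have hp : (4 * Real.pi)⁻¹ ≤ 1 := inv_le_one_of_one_le₀ (by linarith [Real.pi_gt_three])
  have := mul_le_of_le_one_left (inv_nonneg.2 (norm_nonneg z)) hp
  gcongr

theorem measurable_freeKernel (n : ℕ) (τ lam ε : ℝ) : Measurable (freeKernel n τ lam ε) :=
  measurable_radialKernel (continuous_freeProfile n τ lam ε).measurable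

/-- The constant in the weighted bounds from the size of the kernel. -/
def kernelConst (δ D : ℝ) : ℝ := Real.sqrt (2 * D * envelopeIntegral δ)

theorem kernelConst_nonneg (δ D : ℝ) : 0 ≤ kernelConst δ D := Real.sqrt_nonneg _

theorem lintegral_weightedKernel_freeKernel_le {n : ℕ} {τ : ℝ} (hτ : τ = 1 ∨ τ = -1) (lam : ℝ)
    {ε a b δ D E : ℝ} (hδ : 1 < δ) (hD : 0 ≤ D) (hE : 0 ≤ E) (h : KernelBound n ε a b δ D E) (x : R3) :
    ∫⁻ y, weightedKernel a (freeKernel n τ lam ε) b x y ^ (2 : ℝ) ≤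
      ENNReal.ofReal (kernelConst δ D * E) ^ (2 : ℝ) := by
  have hI : 0 ≤ envelopeIntegral δ := ENNReal.toReal_nonneg
  have hne : ∀ c : R3, ∀ᵐ y : R3, y ≠ c := fun c => Measure.ae_ne volume c
  have hW := measurable_envelope δ
  calc _ ≤ ∫⁻ y, ENNReal.ofReal (D * E ^ 2) *
        (ENNReal.ofReal (envelope δ (x - y)) + ENNReal.ofReal (envelope δ y)) := by
        refine lintegral_mono_ae ?_
        filter_upwards [hne 0, hne x] with y hy hyx
        rw [← ENNReal.ofReal_add (envelope_nonneg _ _) (envelope_nonneg _ _),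
          ← ENNReal.ofReal_mul (by positivity), ENNReal.rpow_two, weightedKernel, ← ofReal_norm,
          ← ENNReal.ofReal_mul (norm_nonneg _),
          ← ENNReal.ofReal_mul (Real.rpow_nonneg (bracket_pos x).le _), ← ENNReal.ofReal_pow]
        · refine ENNReal.ofReal_le_ofReal (le_trans ?_ (h x y (sub_ne_zero.2 hyx.symm) hy))
          have h1 := norm_freeKernel_le n hτ lam ε (x - y)
          have h2 := (bracket_pos x).le
          have h3 := (bracket_pos y).le
          gcongr
        · have h2 := (bracket_pos x).le
          have h3 := (bracket_pos y).le
          positivity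
    _ = ENNReal.ofReal (D * E ^ 2) *
        (ENNReal.ofReal (envelopeIntegral δ) + ENNReal.ofReal (envelopeIntegral δ)) := by
        rw [lintegral_const_mul' _ _ ENNReal.ofReal_ne_top, lintegral_add_right _ hW.ennreal_ofReal,
          lintegral_sub_left_eq_self (fun y => ENNReal.ofReal (envelope δ y)) x,
          lintegral_envelope hδ]
    _ = _ := by
        have hc := kernelConst_nonneg δ D
        rw [← ENNReal.ofReal_add hI hI, ← ENNReal.ofReal_mul (by positivity), ENNReal.rpow_two,
          ← ENNReal.ofReal_pow (by positivity), mul_pow, kernelConst, Real.sq_sqrt (by positivity)]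
        congr 1
        ring

theorem freeKernel_neg (n : ℕ) (τ lam ε : ℝ) (z : R3) :
    freeKernel n τ lam ε (-z) = freeKernel n τ lam ε z := by
  simp only [freeKernel, radialKernel, norm_neg]

theorem weightedKernel_freeKernel_swap (n : ℕ) (τ lam ε a b : ℝ) (x y : R3) :
    weightedKernel b (freeKernel n τ lam ε) a x y = weightedKernel a (freeKernel n τ lam ε) b y x := by
  rw [weightedKernel, weightedKernel, ← neg_sub x y, freeKernel_neg]
  ring

/-- The kernel is even in `x - y`, so exchanging the two weights transposes the weighted kernel: one
uniform `L²` bound in a single variable serves both mapping properties. -/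
theorem weightedBound_freeOp_of_kernelBound {n : ℕ} {τ : ℝ} (hτ : τ = 1 ∨ τ = -1) (lam : ℝ)
    {ε a b δ D E : ℝ} (hε : 0 < ε) (ha : a ≤ 0) (hb : b ≤ 0) (hδ : 1 < δ) (hD : 0 ≤ D) (hE : 0 ≤ E)
    (h : KernelBound n ε a b δ D E) :
    WeightedBound 2 ⊤ a (freeOp n hτ lam hε) b (kernelConst δ D * E) ∧
      WeightedBound 1 2 b (freeOp n hτ lam hε) a (kernelConst δ D * E) := by
  have hM : 0 ≤ kernelConst δ D * E := mul_nonneg (kernelConst_nonneg δ D) hE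
  have hK := lintegral_weightedKernel_freeKernel_le hτ lam hδ hD hE h
  refine ⟨weightedBound_of_forall_two hb hM fun F f hf => ?_,
    weightedBound_one_two ha hM fun F f hf => ?_⟩
  · exact eLpNorm_top_weighted_convOp_le (measurable_freeKernel n τ lam ε) _ hM hK hf
  · refine eLpNorm_two_weighted_convOp_le (measurable_freeKernel n τ lam ε) _ hM (fun y => ?_) hf
    simpa only [weightedKernel_freeKernel_swap n τ lam ε a b] using hK y

/-! ### Weighted bounds for the free resolvent -/

theorem WeightedBound.mono {p q : ℝ≥0∞} [Fact (1 ≤ p)] [Fact (1 ≤ q)] {a b C C' : ℝ} {T : L2 →L[ℂ] L2}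
    (h : WeightedBound p q a T b C) (hC : C ≤ C') : WeightedBound p q a T b C' := by
  obtain ⟨S, hS, h⟩ := h
  exact ⟨S, hS.trans hC, h⟩

theorem shellBound_freeOp (n : ℕ) {θ : ℝ} (hθ₀ : 0 ≤ θ) (hθ₁ : θ < 1) {τ : ℝ}
    (hτ : τ = 1 ∨ τ = -1) {lam : ℝ} (hlam : 0 < lam) {ε : ℝ} (hε : 0 < ε) :
    ShellBound (freeOp n hτ lam hε) ((n + 1) * (1 - θ)⁻¹ * lam⁻¹ * ε ^ (-θ)) (n - θ) :=
  fun _ _ _ _ _ _ ha hab hb hf hg hAB =>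
    norm_inner_freeOp_le n hθ₀ hθ₁ hτ hlam hε ha hab hb (inner_trans_eq_zero hf hg hAB)

/-- The constant in `weightedBound_freeOp_two_two`. -/
def freeConst (n : ℕ) (s s₁ θ : ℝ) : ℝ :=
  weightConst (n + s₁) (n + s) (n - θ) * ((n + 1) * (1 - θ)⁻¹)

theorem freeConst_nonneg (n : ℕ) {s s₁ θ : ℝ} (hθ₁ : θ < 1) (hs₁ : 1 / 2 < s₁)
    (hs : 1 / 2 < s + θ) : 0 ≤ freeConst n s s₁ θ := by
  have hn : (0 : ℝ) ≤ n := n.cast_nonneg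
  have h1 : 0 ≤ 1 - (2 : ℝ) ^ (-((n + s₁) + (n + s) - (n - θ) - 1)) :=
    sub_nonneg.2 (Real.rpow_le_one_of_one_le_of_nonpos one_le_two (by linarith))
  have h2 := shellConst_nonneg (n + s) (n - θ)
  have h3 := shellConst_nonneg (n + s₁) (n - θ)
  have h4 : 0 ≤ 1 - θ := by linarith
  rw [freeConst, weightConst]
  positivity

/-- Here the weights are `p₁ = n + s₁` and `p₂ = n + s`, and `q = n - θ`. The conditions become `s₁
+ θ > 1/2`, `s + θ > 1/2` and `n + s + s₁ + θ > 1`, the last a consequence of `s₁ > 1/2` and `s + θ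
> 1/2`. -/
theorem weightedBound_freeOp_two_two (n : ℕ) {s s₁ θ : ℝ} (hθ₀ : 0 ≤ θ) (hθ₁ : θ < 1)
    (hs₁ : 1 / 2 < s₁) (hs : 1 / 2 < s + θ) {τ : ℝ} (hτ : τ = 1 ∨ τ = -1) {lam : ℝ} (hlam : 0 < lam)
    {ε : ℝ} (hε : 0 < ε) :
    WeightedBound 2 2 (-n - s) (freeOp n hτ lam hε) (-n - s₁)
      (freeConst n s s₁ θ * lam⁻¹ * ε ^ (-θ)) := by
  have hn : (0 : ℝ) ≤ n := n.cast_nonneg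
  have hc := freeConst_nonneg n hθ₁ hs₁ hs
  have h4 : 0 ≤ 1 - θ := by linarith
  refine weightedBound_two_two (by linarith) (by positivity) fun F f G g hf hg => ?_
  rw [← neg_add'] at hf hg
  refine (norm_inner_le_of_shellBound (by positivity) (shellBound_freeOp n hθ₀ hθ₁ hτ hlam hε)
    (by linarith) (by linarith) (by linarith) hf hg).trans_eq ?_
  rw [freeConst]
  ring

end FreeResolvent

end

/-! ### Choice of exponents and assembly of the estimates -/

theorem proposition2p1 (s s₁ σ : ℝ) (k : ℕ) (hs : -1 / 2 < s) (hs₁ : 1 / 2 < s₁)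
    (hσ₀ : 0 ≤ σ) (hσ₁ : σ ≤ 1) (hk : 1 ≤ k) :
    -- the resolvent exists and is a smooth function of `lam`
    (∀ τ : ℝ, (τ = 1 ∨ τ = -1) → ∀ ε : ℝ, 0 < ε → ε ≤ 1 →
      (∀ lam : ℝ, FreeResolvent.IsResolventAt FreeResolvent.G0
        (FreeResolvent.specParam τ lam ε ^ 2) (FreeResolvent.R0 τ lam ε)) ∧
      ContDiff ℝ ∞ (fun lam : ℝ => FreeResolvent.R0 τ lam ε)) ∧
    -- `L² → L²`, equal weights: the constant does not depend on `lam₀`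
    (∃ C : ℝ, 0 < C ∧ ∀ lam₀ : ℝ, 0 < lam₀ → ∀ τ : ℝ, (τ = 1 ∨ τ = -1) →
      ∀ lam : ℝ, lam₀ ≤ lam → ∀ ε : ℝ, 0 < ε → ε ≤ 1 →
        FreeResolvent.WeightedBound 2 2 (-s₁) (FreeResolvent.R0 τ lam ε) (-s₁) (C * lam⁻¹)) ∧
    -- `L² → L²`, different weights, for `R₀` and `R₀^{(k)}`: the constant may depend on `lam₀`
    (∀ lam₀ : ℝ, 0 < lam₀ → ∀ η : ℝ, 0 < η → ∃ C : ℝ, 0 < C ∧ ∀ τ : ℝ, (τ = 1 ∨ τ = -1) →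
      ∀ lam : ℝ, lam₀ ≤ lam → ∀ ε : ℝ, 0 < ε → ε ≤ 1 →
        FreeResolvent.WeightedBound 2 2 (-s) (FreeResolvent.R0 τ lam ε) (-s₁)
          (C * lam⁻¹ * ε ^ (-max (1 / 2 - s + η) 0)) ∧
        FreeResolvent.WeightedBound 2 2 (-k - s) (FreeResolvent.R0deriv k τ lam ε) (-k - s₁)
          (C * lam⁻¹ * ε ^ (-max (1 / 2 - s + η) 0))) ∧
    -- `L² → L^∞` and `L¹ → L²`
    (∀ η : ℝ, 0 < η → ∃ C : ℝ, 0 < C ∧ ∀ τ : ℝ, (τ = 1 ∨ τ = -1) →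
      ∀ lam : ℝ, 0 ≤ lam → ∀ ε : ℝ, 0 < ε → ε ≤ 1 →
        (0 ≤ s → FreeResolvent.WeightedBound 2 ∞ 0 (FreeResolvent.R0 τ lam ε) (-s)
          (C * ε ^ (-max (1 / 2 - s + η) 0))) ∧
        FreeResolvent.WeightedBound 2 ∞ 0 (FreeResolvent.R0deriv 1 τ lam ε) (-1 - s)
          (C * ε ^ (-max (1 / 2 - s + η) 0)) ∧
        FreeResolvent.WeightedBound 2 ∞ (-k + 1 - σ) (FreeResolvent.R0deriv (k + 1) τ lam ε)
          (-k - 1 - s) (C * ε ^ (-1 + min σ (s + 1 / 2 - η))) ∧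
        (0 ≤ s → FreeResolvent.WeightedBound 1 2 (-s) (FreeResolvent.R0 τ lam ε) 0
          (C * ε ^ (-max (1 / 2 - s + η) 0))) ∧
        FreeResolvent.WeightedBound 1 2 (-1 - s) (FreeResolvent.R0deriv 1 τ lam ε) 0
          (C * ε ^ (-max (1 / 2 - s + η) 0)) ∧
        FreeResolvent.WeightedBound 1 2 (-k - 1 - s) (FreeResolvent.R0deriv (k + 1) τ lam ε)
          (-k + 1 - σ) (C * ε ^ (-1 + min σ (s + 1 / 2 - η)))) := by
  open FreeResolvent in
  refine ⟨fun τ hτ ε hε _ => ⟨fun lam => ?_, contDiff_R0 hτ hε⟩, ?_, fun lam₀ hlam₀ η hη => ?_,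
    fun η hη => ?_⟩
  · rw [R0_eq_freeOp hτ lam hε]
    exact isResolventAt_freeOp hτ lam hε
  · have hc := freeConst_nonneg 0 one_pos hs₁ (s := s₁) (by linarith)
    -- With equal weights above `1/2` the choice `θ = 0` is allowed, so no power of `ε` is lost and
    -- the constant involves neither `η` nor `lam₀`. Adding `1` only ensures positivity.
    refine ⟨freeConst 0 s₁ s₁ 0 + 1, by linarith, fun lam₀ hlam₀ τ hτ lam hlam ε hε _ => ?_⟩
    have hlam' := hlam₀.trans_le hlam
    have h := weightedBound_freeOp_two_two 0 le_rfl one_pos hs₁ (s := s₁) (by linarith) hτ hlam' hε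
    rw [Nat.cast_zero, neg_zero, zero_sub, Real.rpow_zero, mul_one] at h
    rw [R0_eq_freeOp hτ lam hε]
    exact h.mono (mul_le_mul_of_nonneg_right (by linarith) (inv_nonneg.2 hlam'.le))
  · set η' := min η ((s + 1 / 2) / 2) with hη'
    have hη'0 : 0 < η' := lt_min hη (by linarith)
    have hη'1 : η' ≤ η := min_le_left _ _
    have hη'2 : η' ≤ (s + 1 / 2) / 2 := min_le_right _ _
    set θ := max (1 / 2 - s + η') 0 with hθ
    have hθ₀ : 0 ≤ θ := le_max_right _ _
    have hθ₁ : θ < 1 := max_lt (by linarith) one_pos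
    have hsθ : 1 / 2 < s + θ := by
      have := le_max_left (1 / 2 - s + η') 0
      linarith
    have hle : θ ≤ max (1 / 2 - s + η) 0 := max_le_max_right _ (by linarith)
    have h0 := freeConst_nonneg 0 hθ₁ hs₁ hsθ
    have h1 := freeConst_nonneg k hθ₁ hs₁ hsθ
    refine ⟨freeConst 0 s s₁ θ + freeConst k s s₁ θ + 1, by linarith,
      fun τ hτ lam hlam ε hε hε₁ => ?_⟩
    have hlam' := hlam₀.trans_le hlam
    have hpow : ε ^ (-θ) ≤ ε ^ (-max (1 / 2 - s + η) 0) :=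
      Real.rpow_le_rpow_of_exponent_ge hε hε₁ (by linarith)
    have hmono (c : ℝ) (hc : c ≤ freeConst 0 s s₁ θ + freeConst k s s₁ θ + 1) :
        c * lam⁻¹ * ε ^ (-θ) ≤ (freeConst 0 s s₁ θ + freeConst k s s₁ θ + 1) * lam⁻¹ *
          ε ^ (-max (1 / 2 - s + η) 0) := by gcongr
    rw [R0_eq_freeOp hτ lam hε, R0deriv_eq_freeOp k hτ lam hε]
    refine ⟨?_, ?_⟩
    · have h := weightedBound_freeOp_two_two 0 hθ₀ hθ₁ hs₁ hsθ hτ hlam' hε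
      rw [Nat.cast_zero, neg_zero, zero_sub, zero_sub] at h
      exact h.mono (hmono _ (by linarith))
    · exact (weightedBound_freeOp_two_two k hθ₀ hθ₁ hs₁ hsθ hτ hlam' hε).mono (hmono _ (by linarith))
  · set θ := max (1 / 2 - s + η) 0 with hθ
    set θ' := min σ (s + 1 / 2 - η) with hθ'
    have hθ₀ : 0 ≤ θ := le_max_right _ _
    have hθ₁ : 1 / 2 - s + η ≤ θ := le_max_left _ _
    have hθ'₀ : θ' ≤ σ := min_le_left _ _
    have hθ'₁ : θ' ≤ s + 1 / 2 - η := min_le_right _ _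
    -- The choice `δ = 1 + 2η` is the largest permitted by `θ ≥ 1/2 - s + η` and by `θ' ≤ s + 1/2 -
    -- η`; it exceeds `1`, so the envelope is integrable.
    have hδ : 1 < 1 + 2 * η := by linarith
    have hk' : (1 : ℝ) ≤ k := by exact_mod_cast hk
    set D := decayConst (2 * θ)
    have hD : 0 ≤ D := (decayConst_pos _).le
    set D' := 3 ^ (2 * (k - 1 + σ)) * decayConst (2 - 2 * θ')
    have hD' : 0 ≤ D' := mul_nonneg (by positivity) (decayConst_pos _).le
    set c := kernelConst (1 + 2 * η) D
    set c' := kernelConst (1 + 2 * η) D'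
    have hc : 0 ≤ c := kernelConst_nonneg _ _
    have hc' : 0 ≤ c' := kernelConst_nonneg _ _
    refine ⟨c + c' + 1, by linarith, fun τ hτ lam _ ε hε hε₁ => ?_⟩
    rw [R0_eq_freeOp hτ lam hε, R0deriv_eq_freeOp 1 hτ lam hε, R0deriv_eq_freeOp (k + 1) hτ lam hε]
    have hE : 0 ≤ ε ^ (-θ) := Real.rpow_nonneg hε.le _
    have hE' : 0 ≤ ε ^ (-1 + θ') := Real.rpow_nonneg hε.le _
    have hm : c * ε ^ (-θ) ≤ (c + c' + 1) * ε ^ (-θ) :=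
      mul_le_mul_of_nonneg_right (by linarith) hE
    have hm' : c' * ε ^ (-1 + θ') ≤ (c + c' + 1) * ε ^ (-1 + θ') :=
      mul_le_mul_of_nonneg_right (by linarith) hE'
    have b₀ (hs0 : 0 ≤ s) := weightedBound_freeOp_of_kernelBound hτ lam hε le_rfl
      (neg_nonpos.2 hs0) hδ hD hE (kernelBound_zero hs0 hθ₀ (by linarith) hε hε₁)
    have b₁ := weightedBound_freeOp_of_kernelBound hτ lam hε le_rfl (by linarith) hδ hD hE
      (kernelBound_one (s := s) (by linarith) hθ₀ (by linarith) hε hε₁)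
    have b₂ := weightedBound_freeOp_of_kernelBound hτ lam hε (by linarith) (by linarith) hδ hD' hE'
      (kernelBound_succ hk hσ₀ hσ₁ (s := s) (by linarith) hθ'₀ (by linarith) hε hε₁)
    exact ⟨fun h => (b₀ h).1.mono hm, b₁.1.mono hm, b₂.1.mono hm', fun h => (b₀ h).2.mono hm,
      b₁.2.mono hm, b₂.2.mono hm'⟩
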